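/- Let $0=k_1<k_2<\dots<k_n=k$ be integers with $\gcd(k_2,\dots,k_n)=1$, let $A=\begin{bmatrix}1&\cdots&1\\k_1&\cdots&k_n\end{bmatrix}$, and let $H_A(\beta)$, $\beta\in\mathbb C^2$, be the $A$-hypergeometric system: $\partial^u\Phi=\partial^v\Phi$ for all $u,v\in\mathbb N^n$ with $Au=Av$, $\sum_j x_j\partial_j\Phi=\beta_1\Phi$ and $\sum_j k_jx_j\partial_j\Phi=\beta_2\Phi$. Let $G_0=\mathbb N\{k_2,\dots,k_n\}$ and $G_k=\mathbb N\{k-k_1,\dots,k-k_{n-1}\}$. The polar locus $\mathrm{Pol}(A)\subset\mathbb C^2$ is the union of the polar lines $L_0(N)=\{\beta_2=N\}$, $N\in G_0$, and $L_k(N)=\{k\beta_1-\beta_2=N\}$, $N\in G_k$. For $x\in\mathbb C^n$ with $x_1x_n\neq0$ let $f(z)=\sum_i x_iz^{k_i}$. For a connected component $\Theta\subset\mathbb R/2\pi\mathbb Z$ of the complement of the set of arguments of the zeros of $f$, and for continuous branches of $\log z$ and $\log f(z)$ on the sector $S_\Theta=\{z\ne0:\arg z\in\Theta\}$, the Euler–Mellin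 integral is $M_f^\Theta(x,\beta)=\int_{\arg z=\theta}f(z)^{\beta_1}z^{-\beta_2}\frac{dz}{z}$ with any $\theta\in\Theta$. The extended Euler–Mellin integral is the entire function $\beta\mapsto\Psi_f^\Theta(x,\beta)$ such that $$M_f^\Theta(x,\beta)=\frac{\Psi_f^\Theta(x,\beta)}{\Gamma(-\beta_1)}\,\Gamma(-\beta_2)\,\Gamma(\beta_2-k\beta_1)\prod_{\kappa\in\mathbb N\setminus G_0}(\beta_2-\kappa)\prod_{\kappa\in\mathbb N\setminus G_k}(k\beta_1-\beta_2-\kappa)$$ whenever $\operatorname{Re}\beta_2<0$ and $\operatorname{Re}(k\beta_1-\beta_2)<0$ (where the integral converges and does not depend on $\theta\in\Theta$); it exists and is unique. The branches determine a logarithm $v$ of $x_1$, namely $v=\lim_{z\to0}\log f(z)$, and a logarithm $v$ of $x_n$, namely $v=\lim_{z\to\infty}(\log f(z)-k\log z)$, the limits being taken in $S_\Theta$. **Theorem.** Let $L\subset\mathbb C^2$ be a complex affine line contained in $\mathrm{Pol}(A)$. Then either $L=L_0(N)$ with $N\in G_0$, and we set $w_i=k_i$, $b=1$, $G=G_0$,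 $G'=G_k$; or $L=L_k(N)$ with $N\in G_k$, and we set $w_i=k-k_i$, $b=n$, $G=G_k$, $G'=G_0$. Let $P$ be the finite set of finite sequences $p=(p_1,\dots,p_l)$ of indices $p_j\neq b$ with $w_{p_1}+\dots+w_{p_l}=N$, write $|p|=l$, let $\ell$ be the smallest length of an element of $P$, and for a logarithm $v$ of $x_b$ put $$S_v(x,\lambda)=e^{\lambda v}\sum_{p\in P}\ \prod_{i=\ell}^{|p|-1}(\lambda-i)\ \prod_{j=1}^{|p|}\frac{w_{p_j}}{N-(w_{p_1}+\dots+w_{p_{j-1}})}\cdot\frac{x_{p_j}}{x_b},$$ a finitely supported series in $x$. There is an entire function $h$ of $\lambda$, independent of $x$, of $\Theta$ and of the branches, given for $\lambda\notin\mathbb N$, $k\lambda-N\notin\mathbb N$ by $$h(\lambda)=\frac{(-1)^{N+\ell}\,N!\;\Gamma(\ell-\lambda)}{\Gamma(N-k\lambda)\,\prod_{\kappa\in\mathbb N\setminus G}(N-\kappa)\,\prod_{\kappa\in\mathbb N\setminus G'}(k\lambda-N-\kappa)},$$ such that the following hold. 1. For every $x$ with $x_1x_n\ne0$, every component $\Theta$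 and all branches, $\Psi_f^\Theta(x,\beta)=h(\beta_1)\,S_v(x,\beta_1)$ for all $\beta\in L$, where $v$ is the logarithm of $x_b$ determined by the branches. For every logarithm $v$ of $x_b$, each component $\Theta$ has branches that determine $v$, and all extended Euler–Mellin integrals whose branches determine the same $v$ coincide on $L$. 2. For every nonempty open $U\subset\mathbb C^n\setminus V(x_1x_n)$ and every continuous branch $v(x)$ of $\log x_b$ on $U$, the function $S_{v(x)}(x,\beta_1)$ is analytic in $(x,\beta)$ on $U\times L$, and for each $\beta\in L$ it is, as a function of $x\in U$, a solution of $H_A(\beta)$ that is not identically zero. -/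

import Mathlib

namespace ToricCurve

open Filter Topology MeasureTheory

/-- The exponents `0 = k 0 < k 1 < ⋯ < k n` of a projective toric curve: the matrix `A` has the
`n + 1` columns `(1, k i)`. The gcd condition says that the columns generate `ℤ²`
(in particular `n ≥ 1`). -/
structure IsCurve {n : ℕ} (k : Fin (n + 1) → ℕ) : Prop where
  zero : k 0 = 0
  strictMono : StrictMono k
  gcd_eq_one : Finset.univ.gcd k = 1

/-- The degree of the curve, i.e. the largest exponent. -/
def degree {n : ℕ} (k : Fin (n + 1) → ℕ) : ℕ := k (Fin.last n)

/-- The polynomial function `f(z) = ∑ x i * z ^ k i`. -/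
noncomputable def poly {n : ℕ} (k : Fin (n + 1) → ℕ) (x : Fin (n + 1) → ℂ) (z : ℂ) : ℂ :=
  ∑ i, x i * z ^ k i

/-! ### Facets and the polar locus -/

/-- The two facets of the cone over the columns of `A`: `origin` is spanned by the first column
`(1, 0)`, and `infinity` by the last column `(1, degree k)`. -/
inductive Facet where
  | origin
  | infinity

/-- The facet opposite to a given one. -/
def Facet.opp : Facet → Facet
  | .origin => .infinity
  | .infinity => .origin

/-- The index of the column of `A` that spans the facet. -/
def Facet.vertex {n : ℕ} : Facet → Fin (n + 1)
  | .origin => 0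
  | .infinity => Fin.last n

/-- Lattice distance of the exponents from the facet: `k i`, respectively `degree k - k i`. -/
def Facet.weight {n : ℕ} (k : Fin (n + 1) → ℕ) : Facet → Fin (n + 1) → ℕ
  | .origin => k
  | .infinity => fun i => degree k - k i

/-- The linear form on the parameter space that vanishes on the span of the facet and takes the
value `weight k F i` on the `i`-th column of `A`: `β₂`, respectively `degree k * β₁ - β₂`. -/
def Facet.form {n : ℕ} (k : Fin (n + 1) → ℕ) : Facet → ℂ × ℂ → ℂ
  | .origin => fun β => β.2
  | .infinity => fun β => degree k * β.1 - β.2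

/-- The numerical monoid of the facet. -/
def Facet.monoid {n : ℕ} (k : Fin (n + 1) → ℕ) (F : Facet) : AddSubmonoid ℕ :=
  AddSubmonoid.closure (Set.range (F.weight k))

/-- The product of the linear factors `s - κ` over the (finitely many) gaps `κ` of the monoid. -/
noncomputable def Facet.gapProd {n : ℕ} (k : Fin (n + 1) → ℕ) (F : Facet) (s : ℂ) : ℂ :=
  ∏ᶠ (κ : ℕ) (_ : κ ∉ F.monoid k), (s - κ)

/-- The line of parameters on which the form of the facet equals `N`. -/
def polarLine {n : ℕ} (k : Fin (n + 1) → ℕ) (F : Facet) (N : ℕ) : Set (ℂ × ℂ) :=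
  {β | F.form k β = N}

/-- The polar locus of `A`. -/
def polarLocus {n : ℕ} (k : Fin (n + 1) → ℕ) : Set (ℂ × ℂ) :=
  {β | ∃ F : Facet, ∃ N ∈ F.monoid k, β ∈ polarLine k F N}

/-! ### Euler–Mellin integrals -/

/-- The coamoeba of `f`: the set of arguments of its zeros in `ℂ^*`. -/
def coamoeba {n : ℕ} (k : Fin (n + 1) → ℕ) (x : Fin (n + 1) → ℂ) : Set Real.Angle :=
  (fun z : ℂ => (Complex.arg z : Real.Angle)) '' {z | z ≠ 0 ∧ poly k x z = 0}

/-- `Θ` is a connected component of the complement of the coamoeba. -/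
def IsComponent {n : ℕ} (k : Fin (n + 1) → ℕ) (x : Fin (n + 1) → ℂ) (Θ : Set Real.Angle) : Prop :=
  ∃ θ ∈ (coamoeba k x)ᶜ, Θ = connectedComponentIn (coamoeba k x)ᶜ θ

/-- The open sector of all `z ≠ 0` with argument in `Θ`. -/
def sector (Θ : Set Real.Angle) : Set ℂ :=
  {z | z ≠ 0 ∧ (Complex.arg z : Real.Angle) ∈ Θ}

/-- `lz` and `lf` are branches of `log z` and of `log f(z)` on the sector of `Θ`. They fix the
meaning of `z ^ (-β₂)` and `f(z) ^ β₁` there. -/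
structure IsBranch {n : ℕ} (k : Fin (n + 1) → ℕ) (x : Fin (n + 1) → ℂ) (Θ : Set Real.Angle)
    (lz lf : ℂ → ℂ) : Prop where
  continuousOn_z : ContinuousOn lz (sector Θ)
  exp_z : ∀ z ∈ sector Θ, Complex.exp (lz z) = z
  continuousOn_f : ContinuousOn lf (sector Θ)
  exp_f : ∀ z ∈ sector Θ, Complex.exp (lf z) = poly k x z

/-- The point of absolute value `r` on the ray with argument `θ`. -/
noncomputable def rayPoint (θ : Real.Angle) (r : ℝ) : ℂ := (r : ℂ) * (θ.toCircle : ℂ)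

/-- The integrand `f(z) ^ β₁ * z ^ (-β₂) dz / z` on the ray with argument `θ`, in terms of
`r = |z|`; on the ray `dz / z = dr / r`. -/
noncomputable def integrand (lz lf : ℂ → ℂ) (θ : Real.Angle) (β : ℂ × ℂ) (r : ℝ) : ℂ :=
  Complex.exp (β.1 * lf (rayPoint θ r) - β.2 * lz (rayPoint θ r)) / r

/-- The Euler–Mellin integral along the ray with argument `θ`. -/
noncomputable def eulerMellin (lz lf : ℂ → ℂ) (θ : Real.Angle) (β : ℂ × ℂ) : ℂ :=
  ∫ r in Set.Ioi (0 : ℝ), integrand lz lf θ β r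

/-- The tubular domain of convergence of the Euler–Mellin integrals. -/
def convergenceDomain {n : ℕ} (k : Fin (n + 1) → ℕ) : Set (ℂ × ℂ) :=
  {β | ∀ F : Facet, (F.form k β).re < 0}

/-- `Ψ` is the extended Euler–Mellin integral, as a function of `β`, of the component `Θ` and the
branches `lz`, `lf`: it is entire, and for `β` in the domain of convergence the Euler–Mellin
integral over the ray of any `θ ∈ Θ` converges and is the product of `Ψ β` with the stated
Gamma factors and linear factors. -/
structure IsExtendedEulerMellin {n : ℕ} (k : Fin (n + 1) → ℕ) (Θ : Set Real.Angle)
    (lz lf : ℂ → ℂ) (Ψ : ℂ × ℂ → ℂ) : Prop where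
  entire : Differentiable ℂ Ψ
  integrable : ∀ θ ∈ Θ, ∀ β ∈ convergenceDomain k,
    IntegrableOn (integrand lz lf θ β) (Set.Ioi (0 : ℝ))
  eq : ∀ θ ∈ Θ, ∀ β ∈ convergenceDomain k,
    eulerMellin lz lf θ β =
      Ψ β / Complex.Gamma (-β.1)
        * Complex.Gamma (-(Facet.origin.form k β)) * Complex.Gamma (-(Facet.infinity.form k β))
        * Facet.origin.gapProd k (Facet.origin.form k β)
        * Facet.infinity.gapProd k (Facet.infinity.form k β)

/-- The logarithm `v` of the coefficient of `f` at the vertex of the facet that the branches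
determine: `log f(z) → v` as `z → 0`, respectively `log f(z) - degree k * log z → v` as
`z → ∞`, in the sector. -/
def IsVertexLog {n : ℕ} (k : Fin (n + 1) → ℕ) (Θ : Set Real.Angle) (lz lf : ℂ → ℂ) (v : ℂ) :
    Facet → Prop
  | .origin => Tendsto lf (𝓝[sector Θ] 0) (𝓝 v)
  | .infinity =>
      Tendsto (fun z => lf z - degree k * lz z) (Bornology.cobounded ℂ ⊓ 𝓟 (sector Θ)) (𝓝 v)

/-! ### The finitely supported series -/

/-- Ordered partitions of `N` of length `l` with nonzero parts among the `w i`, given by the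
sequences of the indices of their parts. -/
def orderedPartitions {n : ℕ} (w : Fin (n + 1) → ℕ) (N l : ℕ) : Finset (Fin l → Fin (n + 1)) :=
  {p | (∀ j, w (p j) ≠ 0) ∧ ∑ j, w (p j) = N}

/-- The smallest length of an ordered partition of `N`. -/
noncomputable def minLength {n : ℕ} (w : Fin (n + 1) → ℕ) (N : ℕ) : ℕ :=
  sInf {l | (orderedPartitions w N l).Nonempty}

/-- The finite sum, over the ordered partitions `p` of `N` with parts the nonzero `w i`, of
the monomials `x_b ^ t * ∏_j (x_{p_j} / x_b)`, with the coefficients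
`∏_{i = ℓ}^{|p| - 1} (t - i) * ∏_j w_{p_j} / (N - s_j)`; here `ℓ` is the smallest length of such a
partition, and `s_j` is the sum of the parts of `p` that precede the part number `j`. The
argument `v` is a logarithm of `x_b`, which fixes the branch of `x_b ^ t`. -/
noncomputable def polarSeries {n : ℕ} (w : Fin (n + 1) → ℕ) (b : Fin (n + 1)) (N : ℕ)
    (v : ℂ) (x : Fin (n + 1) → ℂ) (t : ℂ) : ℂ :=
  Complex.exp (t * v) *
    ∑ l ∈ Finset.range (N + 1), ∑ p ∈ orderedPartitions w N l,
      (∏ i ∈ Finset.Ico (minLength w N) l, (t - i)) *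
        ∏ j : Fin l, (((w (p j) : ℂ) / ((N : ℂ) - ∑ i ∈ Finset.Iio j, (w (p i) : ℂ))) *
          (x (p j) / x b))

/-! ### The hypergeometric system -/

/-- The partial derivative with respect to the `j`-th coordinate. -/
noncomputable def partialDeriv {n : ℕ} (j : Fin (n + 1)) (Φ : (Fin (n + 1) → ℂ) → ℂ) :
    (Fin (n + 1) → ℂ) → ℂ :=
  fun x => fderiv ℂ Φ x (Pi.single j 1)

/-- The operator `∂ ^ u`. -/
noncomputable def monomialDeriv {n : ℕ} (u : Fin (n + 1) → ℕ) (Φ : (Fin (n + 1) → ℂ) → ℂ) :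
    (Fin (n + 1) → ℂ) → ℂ :=
  (List.finRange (n + 1)).foldr (fun j g => (partialDeriv j)^[u j] g) Φ

/-- `Φ` is an analytic solution on `U` of the `A`-hypergeometric system with parameter `β`: it is
annihilated by the toric operators `∂ ^ u - ∂ ^ v` with `A u = A v` and by the two Euler
operators, which generate the left ideal. -/
structure IsSolution {n : ℕ} (k : Fin (n + 1) → ℕ) (β : ℂ × ℂ) (U : Set (Fin (n + 1) → ℂ))
    (Φ : (Fin (n + 1) → ℂ) → ℂ) : Prop where
  analytic : AnalyticOnNhd ℂ Φ U
  toric : ∀ u v : Fin (n + 1) → ℕ, ∑ i, u i = ∑ i, v i → ∑ i, k i * u i = ∑ i, k i * v i →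
    ∀ x ∈ U, monomialDeriv u Φ x = monomialDeriv v Φ x
  euler_one : ∀ x ∈ U, ∑ j, x j * partialDeriv j Φ x = β.1 * Φ x
  euler_two : ∀ x ∈ U, ∑ j, (k j : ℂ) * x j * partialDeriv j Φ x = β.2 * Φ x

/-- The complement of `V(x_1 x_n)`: the first and the last coordinate are nonzero. -/
def nonzeroEnds (n : ℕ) : Set (Fin (n + 1) → ℂ) :=
  {x | x 0 ≠ 0 ∧ x (Fin.last n) ≠ 0}

end ToricCurve

open ToricCurve

namespace ToricCurve

open Filter Topology MeasureTheory

/-! ### Coefficients of complex powers of a polynomial -/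

/-! Fix a facet with weights `w`, vertex `b` and opposite weights `w' = degree - w`, and let a_i be
the columns of A. Everything compares two recursions of the same shape.

The first is algebraic. Write f for the sum of the x_i z^(w_i), and let `powerCoeff` be the
coefficient [z^N] f^t, with f^t expanded at z = 0 using a logarithm v of x_b. From z (f^t)' = t
f^(t-1) z f' and f · f^(t-1) = f^t one gets N [z^N] f^t = t ∑ w_i x_i [z^(N-w_i)] f^(t-1)
(`mul_powerCoeff`) and ∑ x_i [z^(N-w_i)] f^(t-1) = [z^N] f^t (`sum_mul_powerCoeff`). Moreover ∂_j
[z^N] f^t = t [z^(N-w_j)] f^(t-1), so ∂^u depends only on Au, and the two recursions are the Euler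
equations. The coefficient is the polar series times ∏_{i<ℓ} (t - i) (`prod_mul_polarSeries`). Hence
the series solves the system for t outside ℕ, and by continuity in t everywhere. After removal of
that factor it is never identically zero: the terms of the shortest length ℓ have positive
coefficients independent of t.

The second is analytic. Integration by parts along a ray gives F(β) M(β) = β₁ ∑ w_i x_i M(β - a_i)
for either facet form F (`form_mul_eulerMellin`). Dividing by the Gamma and gap factors turns this
into a relation for Ψ with entire coefficients, because each zero of a gap product either is a zero
of the shifted gap product or cancels against a Gamma quotient. Composing the relations of both
facets lowers both forms by at least 1 in every term, so Ψ extends from the convergence domain to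
all of ℂ² (`exists_entire_of_shift`).

On the line F = 0 the same integration by parts leaves a single boundary term, the limit exp(tv) of
the kernel at the vertex, where t = β₁. This fixes Ψ on that line. On F = N, N > 0, a term with w_i
> N has a vanishing coefficient, and a term with 0 < w_i ≤ N involves the line F = N - w_i at t - 1.
This is the recursion of [z^N] f^t, so induction on N gives (`gapMul_linePoint`) that Ψ times the
gap products divided by Γ(-t) equals (-1)^N N! / Γ(N - degree·t) times [z^N] f^t. Cancelling ∏_{i<ℓ}
(t - i) for generic t leaves h(t) times the series, and only v remains of Θ and the branches.

The factor h is entire (`exists_entire_factor`): a pole of Γ(ℓ - t) lies at t = ℓ + m, where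
degree·t - N is an element of the opposite monoid, so 1/Γ(N - degree·t) vanishes there while the
opposite gap product does not. Finally, a line in the polar locus is one of the polar lines, because
ℂ is uncountable (`exists_eq_polarLine`). -/

/-- The sum over the ordered partitions of `N` of length `l` of the weighted monomials in `y`. -/
noncomputable def partitionSum {n : ℕ} (w : Fin (n + 1) → ℕ) (y : Fin (n + 1) → ℂ) (N l : ℕ) : ℂ :=
  ∑ p ∈ orderedPartitions w N l,
    ∏ j : Fin l, (((w (p j) : ℂ) / ((N : ℂ) - ∑ i ∈ Finset.Iio j, (w (p i) : ℂ))) * y (p j))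

theorem orderedPartitions_eq_empty {n : ℕ} (w : Fin (n + 1) → ℕ) {N l : ℕ} (h : N < l) :
    orderedPartitions w N l = ∅ := by
  rw [orderedPartitions, Finset.filter_eq_empty_iff]
  rintro p - ⟨hp, hs⟩
  have : ∑ j : Fin l, 1 ≤ ∑ j, w (p j) :=
    Finset.sum_le_sum fun j _ => Nat.one_le_iff_ne_zero.2 (hp j)
  simp at this
  omega

theorem partitionSum_eq_zero {n : ℕ} (w : Fin (n + 1) → ℕ) (y : Fin (n + 1) → ℂ) {N l : ℕ}
    (h : N < l) : partitionSum w y N l = 0 := by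
  rw [partitionSum, orderedPartitions_eq_empty w h, Finset.sum_empty]

theorem partitionSum_zero_right {n : ℕ} (w : Fin (n + 1) → ℕ) (y : Fin (n + 1) → ℂ) (N : ℕ) :
    partitionSum w y N 0 = if N = 0 then 1 else 0 := by
  simp only [partitionSum, orderedPartitions]
  split_ifs with h <;> simp [eq_comm, h]

/-- Peel off the first part: nothing precedes it, so its factor is `w i / N`, and the remaining
denominators are those of a partition of `N - w i`. This recursion is all that is used about the
weights of the partitions. -/
theorem mul_partitionSum_succ {n : ℕ} (w : Fin (n + 1) → ℕ) (y : Fin (n + 1) → ℂ) (N l : ℕ) :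
    (N : ℂ) * partitionSum w y N (l + 1) =
      ∑ i, if w i ≤ N then (w i : ℂ) * y i * partitionSum w y (N - w i) l else 0 := by
  simp only [partitionSum, orderedPartitions, Finset.sum_filter]
  rw [← (Fin.consEquiv fun _ : Fin (l + 1) => Fin (n + 1)).sum_comp, Fintype.sum_prod_type,
    Finset.mul_sum]
  refine Finset.sum_congr rfl fun i _ => ?_
  simp only [Fin.consEquiv_apply, Fin.forall_fin_succ, Fin.cons_zero, Fin.cons_succ,
    Fin.sum_univ_succ, Fin.prod_univ_succ]
  by_cases h0 : w i = 0
  · simp [h0]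
  by_cases hi : w i ≤ N
  · have hN : (N : ℂ) ≠ 0 := by
      have : N ≠ 0 := by omega
      exact_mod_cast this
    rw [if_pos hi, Finset.mul_sum, Finset.mul_sum]
    refine Finset.sum_congr rfl fun p _ => ?_
    have hc : ((w i ≠ 0 ∧ ∀ j, w (p j) ≠ 0) ∧ w i + ∑ j, w (p j) = N) ↔
        ((∀ j, w (p j) ≠ 0) ∧ ∑ j, w (p j) = N - w i) := by
      constructor
      · rintro ⟨⟨_, h⟩, h'⟩
        exact ⟨h, by omega⟩
      · rintro ⟨h, h'⟩
        exact ⟨⟨h0, h⟩, by omega⟩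
    by_cases h : (∀ j, w (p j) ≠ 0) ∧ ∑ j, w (p j) = N - w i
    · rw [if_pos (hc.2 h), if_pos h]
      have hs : ∀ j : Fin l, ∑ m ∈ Finset.Iio j.succ,
          (w ((Fin.cons i p : Fin (l + 1) → Fin (n + 1)) m) : ℂ)
            = w i + ∑ m ∈ Finset.Iio j, (w (p m) : ℂ) := by
        intro j
        have : (Finset.Iio j.succ : Finset (Fin (l + 1)))
            = Finset.cons 0 ((Finset.Iio j).map (Fin.succEmb l)) (by simp) := by
          ext m
          refine Fin.cases ?_ (fun m => ?_) m <;> simp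
        rw [this, Finset.sum_cons, Finset.sum_map]
        simp
      simp only [hs, Nat.cast_sub hi]
      have hz : (Finset.Iio (0 : Fin (l + 1))) = ∅ := by ext m; simp
      rw [hz, Finset.sum_empty, sub_zero]
      simp only [sub_sub]
      field_simp
    · rw [if_neg (fun h' => h (hc.1 h')), if_neg h]
      simp
  · rw [if_neg hi, Finset.sum_eq_zero, mul_zero]
    intro p _
    rw [if_neg]
    rintro ⟨-, h⟩
    omega

/-- The coefficient of `z ^ N` in the `t`-th power of `∑ x i * z ^ w i`, where `v` is a logarithm
of the constant coefficient `x b`. -/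
noncomputable def powerCoeff {n : ℕ} (w : Fin (n + 1) → ℕ) (b : Fin (n + 1)) (v : ℂ)
    (x : Fin (n + 1) → ℂ) (N : ℤ) (t : ℂ) : ℂ :=
  if 0 ≤ N then Complex.exp (t * v) * ∑ l ∈ Finset.range (N.toNat + 1),
    (∏ i ∈ Finset.range l, (t - i)) * partitionSum w (fun i => x i / x b) N.toNat l else 0

theorem powerCoeff_of_neg {n : ℕ} (w : Fin (n + 1) → ℕ) (b : Fin (n + 1)) (v : ℂ)
    (x : Fin (n + 1) → ℂ) {N : ℤ} (hN : N < 0) (t : ℂ) : powerCoeff w b v x N t = 0 :=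
  if_neg (not_le.2 hN)

theorem powerCoeff_zero {n : ℕ} (w : Fin (n + 1) → ℕ) (b : Fin (n + 1)) (v : ℂ)
    (x : Fin (n + 1) → ℂ) (t : ℂ) : powerCoeff w b v x 0 t = Complex.exp (t * v) := by
  simp [powerCoeff, partitionSum_zero_right]

theorem prod_range_sub_shift (t : ℂ) (l : ℕ) :
    ∏ i ∈ Finset.range (l + 1), (t - i) = t * ∏ i ∈ Finset.range l, (t - 1 - i) := by
  rw [Finset.prod_range_succ']
  simp only [Nat.cast_zero, sub_zero, Nat.cast_add, Nat.cast_one]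
  rw [mul_comm]
  congr 1
  exact Finset.prod_congr rfl fun i _ => by ring

/-- Coefficient form of z (f^t)' = t f^(t-1) z f', obtained by peeling off the first part of each
partition. Integer indices let coefficients of negative order be zero, so no side condition `w i ≤
N` is needed. -/
theorem mul_powerCoeff {n : ℕ} (w : Fin (n + 1) → ℕ) (b : Fin (n + 1)) {v : ℂ}
    {x : Fin (n + 1) → ℂ} (hv : Complex.exp v = x b) (N : ℤ) (t : ℂ) :
    (N : ℂ) * powerCoeff w b v x N t =
      t * ∑ i, (w i : ℂ) * x i * powerCoeff w b v x (N - w i) (t - 1) := by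
  have hb : x b ≠ 0 := hv ▸ Complex.exp_ne_zero v
  rcases lt_or_ge N 0 with hN | hN
  · rw [powerCoeff_of_neg _ _ _ _ hN, Finset.sum_eq_zero]
    · simp
    · intro i _
      rw [powerCoeff_of_neg _ _ _ _ (by omega), mul_zero]
  obtain ⟨m, rfl⟩ := Int.eq_ofNat_of_zero_le hN
  rw [powerCoeff, if_pos hN, Int.toNat_natCast, Finset.sum_range_succ']
  have h0 : ((m : ℤ) : ℂ) * partitionSum w (fun i => x i / x b) m 0 = 0 := by
    rw [partitionSum_zero_right]
    split_ifs with h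
    · simp [h]
    · simp
  have h1 : ∀ l : ℕ, ((m : ℤ) : ℂ) * partitionSum w (fun i => x i / x b) m (l + 1) =
      ∑ i, if w i ≤ m then (w i : ℂ) * (x i / x b) *
        partitionSum w (fun i => x i / x b) (m - w i) l else 0 :=
    fun l => by rw [← mul_partitionSum_succ]; simp
  calc _ = Complex.exp (t * v) * ∑ l ∈ Finset.range m, (∏ i ∈ Finset.range (l + 1), (t - i)) *
        (((m : ℤ) : ℂ) * partitionSum w (fun i => x i / x b) m (l + 1)) := by
        rw [mul_left_comm, mul_add, mul_left_comm ((m : ℤ) : ℂ) _ (partitionSum _ _ m 0), h0,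
          mul_zero, add_zero, Finset.mul_sum]
        congr 1
        exact Finset.sum_congr rfl fun l _ => by ring
    _ = ∑ i, t * ((w i : ℂ) * x i * powerCoeff w b v x (m - w i) (t - 1)) := by
        simp only [h1, Finset.mul_sum]
        rw [Finset.sum_comm]
        refine Finset.sum_congr rfl fun i _ => ?_
        by_cases h0 : w i = 0
        · simp [h0]
        by_cases hi : w i ≤ m
        · have he : Complex.exp (t * v) = Complex.exp ((t - 1) * v) * x b := by
            rw [← hv, ← Complex.exp_add]
            ring_nf
          have hcast : ((m : ℤ) - (w i : ℤ)) = ((m - w i : ℕ) : ℤ) := by omega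
          rw [powerCoeff, if_pos (by omega), hcast, Int.toNat_natCast]
          -- No partition of `m - w i` has more than `m - w i` parts, so the inner sum may run over
          -- all lengths below `m`.
          have hsub : Finset.range (m - w i + 1) ⊆ Finset.range m :=
            Finset.range_subset_range.2 (by omega)
          rw [Finset.sum_subset hsub (fun l _ hl => by
            rw [partitionSum_eq_zero _ _ (by simpa using hl), mul_zero])]
          simp only [Finset.mul_sum, if_pos hi]
          refine Finset.sum_congr rfl fun l _ => ?_
          rw [prod_range_sub_shift, he]
          field_simp
        · rw [powerCoeff_of_neg _ _ _ _ (by omega)]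
          simp [hi]
    _ = _ := by rw [Finset.mul_sum]

/-- Coefficient form of f · f^(t-1) = f^t, by strong induction on N. Multiply by N = (N - w_j) + w_j
and apply `mul_powerCoeff` to the first summand. The induction hypothesis at N - w_i collapses the
double sum, leaving (t - 1) + 1 = t times the sum in `mul_powerCoeff`. -/
theorem sum_mul_powerCoeff {n : ℕ} {w : Fin (n + 1) → ℕ} {b : Fin (n + 1)}
    (hw : ∀ i, w i = 0 ↔ i = b) {v : ℂ} {x : Fin (n + 1) → ℂ} (hv : Complex.exp v = x b)
    (N : ℤ) (t : ℂ) :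
    ∑ i, x i * powerCoeff w b v x (N - w i) (t - 1) = powerCoeff w b v x N t := by
  rcases lt_or_ge N 0 with hN | hN
  · rw [powerCoeff_of_neg _ _ _ _ hN, Finset.sum_eq_zero]
    intro i _
    rw [powerCoeff_of_neg _ _ _ _ (by omega), mul_zero]
  obtain ⟨m, rfl⟩ := Int.eq_ofNat_of_zero_le hN
  clear hN
  induction m using Nat.strong_induction_on generalizing t with
  | _ m ih =>
    rcases Nat.eq_zero_or_pos m with rfl | hm
    · rw [Finset.sum_eq_single b]
      · rw [(hw b).2 rfl]
        simp only [Nat.cast_zero, sub_zero]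
        rw [powerCoeff_zero, powerCoeff_zero, ← hv, ← Complex.exp_add]
        ring_nf
      · intro i _ hi
        have := (hw i).not.2 hi
        rw [powerCoeff_of_neg _ _ _ _ (by omega), mul_zero]
      · simp
    have hm' : ((m : ℤ) : ℂ) ≠ 0 := by
      have : m ≠ 0 := by omega
      exact_mod_cast this
    apply mul_left_cancel₀ hm'
    rw [mul_powerCoeff w b hv, Finset.mul_sum]
    have key : ∀ i, ∑ j, x j * powerCoeff w b v x (m - w i - w j) (t - 1 - 1) * (w i * x i)
        = w i * x i * powerCoeff w b v x (m - w i) (t - 1) := by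
      intro i
      rw [← Finset.sum_mul]
      by_cases h0 : w i = 0
      · simp [h0]
      by_cases hi : w i ≤ m
      · have hcast : ((m : ℤ) - (w i : ℤ)) = ((m - w i : ℕ) : ℤ) := by omega
        rw [hcast, ih (m - w i) (by omega)]
        ring
      · rw [powerCoeff_of_neg _ _ _ _ (by omega), Finset.sum_eq_zero]
        · simp
        · intro j _
          rw [powerCoeff_of_neg _ _ _ _ (by omega), mul_zero]
    have h1 : ∀ j, ((m : ℤ) : ℂ) * (x j * powerCoeff w b v x (m - w j) (t - 1)) =
        (t - 1) * (∑ i, x j * powerCoeff w b v x (m - w i - w j) (t - 1 - 1) * (w i * x i))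
          + w j * x j * powerCoeff w b v x (m - w j) (t - 1) := by
      intro j
      have := mul_powerCoeff w b hv (m - w j) (t - 1)
      have e : ∑ i, x j * powerCoeff w b v x (m - w i - w j) (t - 1 - 1) * (w i * x i)
          = x j * ∑ i, (w i : ℂ) * x i * powerCoeff w b v x (m - w j - w i) (t - 1 - 1) := by
        rw [Finset.mul_sum]
        refine Finset.sum_congr rfl fun i _ => ?_
        rw [sub_right_comm]
        ring
      rw [e]
      push_cast at this ⊢
      linear_combination x j * this
    simp only [h1]
    rw [Finset.sum_add_distrib, ← Finset.mul_sum, Finset.sum_comm]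
    simp only [key]
    ring

theorem minLength_le {n : ℕ} {w : Fin (n + 1) → ℕ} {N l : ℕ}
    (h : (orderedPartitions w N l).Nonempty) : minLength w N ≤ l :=
  Nat.sInf_le h

theorem polarSeries_eq {n : ℕ} (w : Fin (n + 1) → ℕ) (b : Fin (n + 1)) (N : ℕ)
    (v : ℂ) (x : Fin (n + 1) → ℂ) (t : ℂ) :
    polarSeries w b N v x t = Complex.exp (t * v) * ∑ l ∈ Finset.range (N + 1),
      (∏ i ∈ Finset.Ico (minLength w N) l, (t - i)) * partitionSum w (fun i => x i / x b) N l := by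
  simp only [polarSeries, partitionSum, Finset.mul_sum]

/-- There are no partitions shorter than `minLength`, so the factors with i < `minLength` are common
to all terms of the power coefficient. The polar series is what remains when they are removed, which
matters when t is a natural number. -/
theorem prod_mul_polarSeries {n : ℕ} (w : Fin (n + 1) → ℕ) (b : Fin (n + 1)) (N : ℕ)
    (v : ℂ) (x : Fin (n + 1) → ℂ) (t : ℂ) :
    (∏ i ∈ Finset.range (minLength w N), (t - i)) * polarSeries w b N v x t =
      powerCoeff w b v x N t := by
  rw [polarSeries_eq, powerCoeff, if_pos (by omega), Int.toNat_natCast, mul_left_comm,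
    Finset.mul_sum]
  congr 1
  refine Finset.sum_congr rfl fun l _ => ?_
  by_cases h : (orderedPartitions w N l).Nonempty
  · rw [← mul_assoc, Finset.range_eq_Ico, Finset.range_eq_Ico,
      Finset.prod_Ico_consecutive _ (Nat.zero_le _) (minLength_le h)]
  · rw [partitionSum, Finset.not_nonempty_iff_eq_empty.1 h]
    simp

/-! ### Analytic preliminaries -/

/-- Two entire functions on a complex normed space that agree near a point are equal. -/
theorem eq_of_eventuallyEq_of_differentiable {E : Type*} [NormedAddCommGroup E] [NormedSpace ℂ E]
    {f g : E → ℂ} (hf : Differentiable ℂ f) (hg : Differentiable ℂ g) {p : E}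
    (h : f =ᶠ[𝓝 p] g) : f = g := by
  funext q
  -- Restricting to the complex line through `p` and `q` reduces to the one-variable identity
  -- theorem.
  let c : ℂ → E := fun t => p + t • (q - p)
  have hc : Differentiable ℂ c := by fun_prop
  have h0 : Tendsto c (𝓝 0) (𝓝 p) := by
    have := hc.continuous.tendsto 0
    simpa [c] using this
  have := AnalyticOnNhd.eqOn_of_preconnected_of_eventuallyEq
    ((hf.comp hc).differentiableOn.analyticOnNhd isOpen_univ)
    ((hg.comp hc).differentiableOn.analyticOnNhd isOpen_univ) isPreconnected_univ
    (Set.mem_univ (0 : ℂ)) (h0.eventually h) (Set.mem_univ 1)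
  simpa [c] using this

/-- A continuous logarithm of an analytic function is analytic. -/
theorem analyticAt_of_exp_eq {E : Type*} [NormedAddCommGroup E] [NormedSpace ℂ E]
    {l F : E → ℂ} {p : E} (hl : ContinuousAt l p) (hF : AnalyticAt ℂ F p)
    (h : ∀ᶠ q in 𝓝 p, Complex.exp (l q) = F q) : AnalyticAt ℂ l p := by
  have hp : Complex.exp (l p) = F p := h.self_of_nhds
  have hne : F p ≠ 0 := hp ▸ Complex.exp_ne_zero _
  have ha : AnalyticAt ℂ (fun q => l p + Complex.log (F q / F p)) p := by
    refine analyticAt_const.add ((hF.div analyticAt_const hne).clog ?_)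
    simp [hne, Complex.one_mem_slitPlane]
  refine ha.congr ?_
  -- A difference of norm below 1 < π has imaginary part in the strip where the principal logarithm
  -- inverts `exp`.
  have hs : ∀ᶠ q in 𝓝 p, ‖l q - l p‖ < 1 := by
    have h1 : Tendsto (fun q => ‖l q - l p‖) (𝓝 p) (𝓝 0) := by
      simpa using (hl.tendsto.sub_const (l p)).norm
    exact h1.eventually (gt_mem_nhds one_pos)
  filter_upwards [h, hs] with q hq hq'
  have him : |(l q - l p).im| < 1 := (Complex.abs_im_le_norm _).trans_lt hq'
  rw [abs_lt] at him
  have hpi := Real.pi_gt_three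
  rw [← hq, ← hp, ← Complex.exp_sub, Complex.log_exp (by linarith) (by linarith)]
  ring

/-- The set of complex numbers that are not natural numbers is dense. -/
theorem dense_setOf_forall_ne_natCast : Dense {t : ℂ | ∀ j : ℕ, t ≠ j} := by
  have : {t : ℂ | ∀ j : ℕ, t ≠ j} = (Set.range fun j : ℕ => (j : ℂ))ᶜ := by
    ext t
    simp [eq_comm]
  rw [this]
  exact (Set.countable_range _).dense_compl ℝ

/-! ### The series solves the hypergeometric system -/

theorem analyticAt_polarSeries {n : ℕ} (w : Fin (n + 1) → ℕ) (b : Fin (n + 1)) (N : ℕ)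
    {v : (Fin (n + 1) → ℂ) → ℂ} {q : (Fin (n + 1) → ℂ) × ℂ} (hv : AnalyticAt ℂ v q.1)
    (hb : q.1 b ≠ 0) :
    AnalyticAt ℂ (fun q : (Fin (n + 1) → ℂ) × ℂ => polarSeries w b N (v q.1) q.1 q.2) q := by
  have hv' : AnalyticAt ℂ (fun q : (Fin (n + 1) → ℂ) × ℂ => v q.1) q :=
    hv.comp_of_eq analyticAt_fst rfl
  have hx : ∀ i, AnalyticAt ℂ (fun q : (Fin (n + 1) → ℂ) × ℂ => q.1 i) q := fun i =>
    ((ContinuousLinearMap.proj (R := ℂ) (φ := fun _ : Fin (n + 1) => ℂ) i).comp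
      (ContinuousLinearMap.fst ℂ (Fin (n + 1) → ℂ) ℂ)).analyticAt q
  unfold polarSeries
  refine (analyticAt_snd.mul hv').cexp.mul ?_
  refine Finset.analyticAt_fun_sum _ fun l _ => Finset.analyticAt_fun_sum _ fun p _ => ?_
  refine (Finset.analyticAt_fun_prod _ fun i _ => analyticAt_snd.sub analyticAt_const).mul ?_
  exact Finset.analyticAt_fun_prod _ fun j _ => analyticAt_const.mul ((hx _).div (hx b) hb)

/-- Data for the analytic properties of the series near the points of an open set: a continuous
branch of the logarithm of the coordinate `b`. -/
structure IsLogBranch {n : ℕ} (b : Fin (n + 1)) (U : Set (Fin (n + 1) → ℂ))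
    (v : (Fin (n + 1) → ℂ) → ℂ) : Prop where
  isOpen : IsOpen U
  continuousOn : ContinuousOn v U
  exp_eq : ∀ x ∈ U, Complex.exp (v x) = x b

namespace IsLogBranch

variable {n : ℕ} {b : Fin (n + 1)} {U : Set (Fin (n + 1) → ℂ)} {v : (Fin (n + 1) → ℂ) → ℂ}

theorem ne_zero (h : IsLogBranch b U v) {x : Fin (n + 1) → ℂ} (hx : x ∈ U) : x b ≠ 0 :=
  h.exp_eq x hx ▸ Complex.exp_ne_zero _

theorem analyticAt (h : IsLogBranch b U v) {x : Fin (n + 1) → ℂ} (hx : x ∈ U) :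
    AnalyticAt ℂ v x :=
  analyticAt_of_exp_eq (h.continuousOn.continuousAt (h.isOpen.mem_nhds hx))
    ((ContinuousLinearMap.proj (R := ℂ) (φ := fun _ : Fin (n + 1) => ℂ) b).analyticAt x)
    (Filter.eventually_of_mem (h.isOpen.mem_nhds hx) fun y hy => h.exp_eq y hy)

theorem analyticOnNhd_polarSeries (h : IsLogBranch b U v) (w : Fin (n + 1) → ℕ) (N : ℕ) :
    AnalyticOnNhd ℂ (fun q : (Fin (n + 1) → ℂ) × ℂ => polarSeries w b N (v q.1) q.1 q.2)
      (U ×ˢ Set.univ) :=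
  fun _ hq => analyticAt_polarSeries w b N (h.analyticAt hq.1) (h.ne_zero hq.1)

theorem analyticAt_polarSeries (h : IsLogBranch b U v) (w : Fin (n + 1) → ℕ) (N : ℕ) (t : ℂ)
    {x : Fin (n + 1) → ℂ} (hx : x ∈ U) :
    AnalyticAt ℂ (fun x => polarSeries w b N (v x) x t) x := by
  have := h.analyticOnNhd_polarSeries w N (x, t) ⟨hx, Set.mem_univ t⟩
  exact this.comp_of_eq (analyticAt_id.prod analyticAt_const) rfl

theorem differentiableAt_powerCoeff (h : IsLogBranch b U v) (w : Fin (n + 1) → ℕ) (N : ℤ) (t : ℂ)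
    {x : Fin (n + 1) → ℂ} (hx : x ∈ U) :
    DifferentiableAt ℂ (fun x => powerCoeff w b (v x) x N t) x := by
  rcases lt_or_ge N 0 with hN | hN
  · simp only [powerCoeff_of_neg _ _ _ _ hN]
    exact differentiableAt_const _
  · obtain ⟨m, rfl⟩ := Int.eq_ofNat_of_zero_le hN
    simp only [← prod_mul_polarSeries]
    exact (h.analyticAt_polarSeries w m t hx).differentiableAt.const_mul _

end IsLogBranch

/-! ### Derivatives of the power coefficients -/

theorem partialDeriv_congr {n : ℕ} {j : Fin (n + 1)} {Φ Φ' : (Fin (n + 1) → ℂ) → ℂ}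
    {U : Set (Fin (n + 1) → ℂ)} (hU : IsOpen U) (h : Set.EqOn Φ Φ' U) :
    Set.EqOn (partialDeriv j Φ) (partialDeriv j Φ') U := fun x hx => by
  simp only [partialDeriv, (h.eventuallyEq_of_mem (hU.mem_nhds hx)).fderiv_eq]

theorem partialDeriv_const_mul {n : ℕ} {j : Fin (n + 1)} {Φ : (Fin (n + 1) → ℂ) → ℂ}
    {x : Fin (n + 1) → ℂ} (h : DifferentiableAt ℂ Φ x) (c : ℂ) :
    partialDeriv j (fun y => c * Φ y) x = c * partialDeriv j Φ x := by
  simp only [partialDeriv, fderiv_const_mul h]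
  simp

/-- The formula ∂_j f^t = t z^(w_j) f^(t-1), read off at z^N. It follows by induction on N from
differentiating `mul_powerCoeff`: differentiating the coefficients contributes N - w_j,
differentiating the explicit x_j contributes w_j. For N = 0 the derivative of v comes from exp v =
x_b. -/
theorem IsLogBranch.partialDeriv_powerCoeff {n : ℕ} {b : Fin (n + 1)}
    {U : Set (Fin (n + 1) → ℂ)} {v : (Fin (n + 1) → ℂ) → ℂ} (h : IsLogBranch b U v)
    {w : Fin (n + 1) → ℕ} (hw : ∀ i, w i = 0 ↔ i = b) (j : Fin (n + 1)) (N : ℤ) (t : ℂ)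
    {x : Fin (n + 1) → ℂ} (hx : x ∈ U) :
    partialDeriv j (fun x => powerCoeff w b (v x) x N t) x =
      t * powerCoeff w b (v x) x (N - w j) (t - 1) := by
  rcases lt_or_ge N 0 with hN | hN
  · simp only [powerCoeff_of_neg _ _ _ _ hN, powerCoeff_of_neg w b (v x) x
      (show N - w j < 0 by omega)]
    simp [partialDeriv]
  obtain ⟨m, rfl⟩ := Int.eq_ofNat_of_zero_le hN
  clear hN
  have hproj : ∀ i, HasFDerivAt (fun y : Fin (n + 1) → ℂ => y i)
      (ContinuousLinearMap.proj (R := ℂ) (φ := fun _ : Fin (n + 1) => ℂ) i) x := fun i =>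
    (ContinuousLinearMap.proj (R := ℂ) (φ := fun _ : Fin (n + 1) => ℂ) i).hasFDerivAt
  induction m using Nat.strong_induction_on generalizing t with
  | _ m ih =>
    rcases Nat.eq_zero_or_pos m with rfl | hm
    · simp only [Nat.cast_zero, powerCoeff_zero]
      have hv := (h.analyticAt hx).differentiableAt
      have hb : fderiv ℂ (fun y => Complex.exp (v y)) x =
          ContinuousLinearMap.proj (R := ℂ) (φ := fun _ : Fin (n + 1) => ℂ) b := by
        rw [((show Set.EqOn (fun y => Complex.exp (v y)) (fun y => y b) U from
          fun y hy => h.exp_eq y hy).eventuallyEq_of_mem (h.isOpen.mem_nhds hx)).fderiv_eq]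
        exact (hproj b).fderiv
      rw [hv.hasFDerivAt.cexp.fderiv] at hb
      have hb' := congrArg (fun L => L (Pi.single j 1)) hb
      simp only [smul_apply, ContinuousLinearMap.proj_apply,
        smul_eq_mul] at hb'
      rw [partialDeriv, (hv.hasFDerivAt.const_mul t).cexp.fderiv]
      simp only [smul_apply, smul_eq_mul]
      have he : Complex.exp (t * v x) = Complex.exp ((t - 1) * v x) * Complex.exp (v x) := by
        rw [← Complex.exp_add]
        ring_nf
      by_cases hj : j = b
      · subst hj
        rw [(hw j).2 rfl, he]
        simp only [Nat.cast_zero, sub_zero, powerCoeff_zero]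
        simp only [Pi.single_eq_same] at hb'
        linear_combination t * Complex.exp ((t - 1) * v x) * hb'
      · have := (hw j).not.2 hj
        rw [powerCoeff_of_neg _ _ _ _ (by omega), he]
        simp only [Pi.single_eq_of_ne' hj] at hb'
        linear_combination t * Complex.exp ((t - 1) * v x) * hb'
    have hm' : ((m : ℤ) : ℂ) ≠ 0 := by
      have : m ≠ 0 := by omega
      exact_mod_cast this
    apply mul_left_cancel₀ hm'
    rw [← partialDeriv_const_mul (h.differentiableAt_powerCoeff w m t hx)]
    rw [partialDeriv_congr h.isOpen (fun y hy => mul_powerCoeff w b (h.exp_eq y hy) m t) hx]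
    have hd : ∀ i, HasFDerivAt (fun y => (w i : ℂ) * y i *
        powerCoeff w b (v y) y (m - w i) (t - 1)) _ x := fun i =>
      ((hproj i).const_mul (w i : ℂ)).mul
        (h.differentiableAt_powerCoeff w (m - w i) (t - 1) hx).hasFDerivAt
    have key : ∀ i, (w i : ℂ) * fderiv ℂ (fun y => powerCoeff w b (v y) y (m - w i) (t - 1)) x
        (Pi.single j 1) = w i * ((t - 1) * powerCoeff w b (v x) x (m - w j - w i) (t - 1 - 1)) := by
      intro i
      by_cases h0 : w i = 0
      · simp [h0]
      rw [sub_right_comm]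
      by_cases hi : w i ≤ m
      · have hcast : ((m : ℤ) - (w i : ℤ)) = ((m - w i : ℕ) : ℤ) := by omega
        rw [hcast, ← ih (m - w i) (by omega), partialDeriv]
      · simp only [powerCoeff_of_neg w b _ _ (show (m : ℤ) - w i < 0 by omega),
          powerCoeff_of_neg w b _ _ (show (m : ℤ) - w i - w j < 0 by omega)]
        simp
    rw [partialDeriv, ((HasFDerivAt.fun_sum fun i _ => hd i).const_mul t).fderiv]
    simp only [smul_apply, sum_apply,
      add_apply, ContinuousLinearMap.proj_apply, smul_eq_mul]
    rw [Finset.sum_add_distrib]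
    have e1 : ∑ i, (w i : ℂ) * x i * fderiv ℂ
        (fun y => powerCoeff w b (v y) y (m - w i) (t - 1)) x (Pi.single j 1) =
        ((m : ℤ) - (w j : ℤ) : ℤ) * powerCoeff w b (v x) x (m - w j) (t - 1) := by
      rw [mul_powerCoeff w b (h.exp_eq x hx), Finset.mul_sum]
      refine Finset.sum_congr rfl fun i _ => ?_
      linear_combination x i * key i
    have e2 : ∑ i, powerCoeff w b (v x) x (m - w i) (t - 1) *
        ((w i : ℂ) * (Pi.single j 1 : Fin (n + 1) → ℂ) i) =
        w j * powerCoeff w b (v x) x (m - w j) (t - 1) := by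
      rw [Finset.sum_eq_single j]
      · simp
        ring
      · intro i _ hi
        simp [Pi.single_eq_of_ne hi]
      · simp
    rw [e1, e2]
    push_cast
    ring

theorem prod_range_sub_add (t : ℂ) (a c : ℕ) :
    ∏ i ∈ Finset.range (a + c), (t - i) =
      (∏ i ∈ Finset.range a, (t - i)) * ∏ i ∈ Finset.range c, (t - a - i) := by
  rw [Finset.prod_range_add]
  congr 1
  exact Finset.prod_congr rfl fun i _ => by push_cast; ring

theorem IsLogBranch.iterate_partialDeriv_powerCoeff {n : ℕ} {b : Fin (n + 1)}
    {U : Set (Fin (n + 1) → ℂ)} {v : (Fin (n + 1) → ℂ) → ℂ} (h : IsLogBranch b U v)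
    {w : Fin (n + 1) → ℕ} (hw : ∀ i, w i = 0 ↔ i = b) (j : Fin (n + 1)) (a : ℕ) {c : ℂ} {N : ℤ}
    {t : ℂ} {Φ : (Fin (n + 1) → ℂ) → ℂ}
    (hΦ : Set.EqOn Φ (fun x => c * powerCoeff w b (v x) x N t) U) :
    Set.EqOn ((partialDeriv j)^[a] Φ) (fun x => c * (∏ i ∈ Finset.range a, (t - i)) *
      powerCoeff w b (v x) x (N - (w j * a : ℕ)) (t - a)) U := by
  induction a with
  | zero => simpa using hΦ
  | succ a ih =>
    intro x hx
    rw [Function.iterate_succ_apply', partialDeriv_congr h.isOpen ih hx,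
      partialDeriv_const_mul (h.differentiableAt_powerCoeff w _ _ hx),
      h.partialDeriv_powerCoeff hw j _ _ hx, Finset.prod_range_succ]
    have e1 : N - ((w j * a : ℕ) : ℤ) - (w j : ℤ) = N - ((w j * (a + 1) : ℕ) : ℤ) := by
      push_cast
      ring
    have e2 : t - (a : ℂ) - 1 = t - ((a + 1 : ℕ) : ℂ) := by
      push_cast
      ring
    rw [e1, e2]
    ring

/-- Each derivative lowers the exponent by 1 and the order by its weight, so the outcome sees `u`
only through its total degree and weighted degree. This is why the toric operators annihilate the
power coefficients. -/
theorem IsLogBranch.monomialDeriv_powerCoeff {n : ℕ} {b : Fin (n + 1)}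
    {U : Set (Fin (n + 1) → ℂ)} {v : (Fin (n + 1) → ℂ) → ℂ} (h : IsLogBranch b U v)
    {w : Fin (n + 1) → ℕ} (hw : ∀ i, w i = 0 ↔ i = b) (u : Fin (n + 1) → ℕ) {c : ℂ} {N : ℤ}
    {t : ℂ} {Φ : (Fin (n + 1) → ℂ) → ℂ}
    (hΦ : Set.EqOn Φ (fun x => c * powerCoeff w b (v x) x N t) U) :
    Set.EqOn (monomialDeriv u Φ) (fun x => c * (∏ i ∈ Finset.range (∑ j, u j), (t - i)) *
      powerCoeff w b (v x) x (N - (∑ j, w j * u j : ℕ)) (t - (∑ j, u j : ℕ))) U := by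
  rw [Fin.sum_univ_def, Fin.sum_univ_def, monomialDeriv]
  induction List.finRange (n + 1) with
  | nil => simpa using hΦ
  | cons j L ih =>
    intro x hx
    rw [List.foldr_cons, h.iterate_partialDeriv_powerCoeff hw j (u j) ih hx, List.map_cons,
      List.sum_cons, List.map_cons, List.sum_cons, add_comm (u j), prod_range_sub_add]
    have e1 : ∀ p q : ℕ, N - (p : ℤ) - (q : ℤ) = N - ((q + p : ℕ) : ℤ) := by
      intro p q
      push_cast
      ring
    have e2 : ∀ p q : ℕ, t - (p : ℂ) - (q : ℂ) = t - ((p + q : ℕ) : ℂ) := by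
      intro p q
      push_cast
      ring
    rw [e1, e2]
    ring

/-! ### Joint analyticity of derivatives in the variables and the exponent -/

theorem analyticOnNhd_partialDeriv {n : ℕ} {U : Set (Fin (n + 1) → ℂ)} (hU : IsOpen U)
    (j : Fin (n + 1)) {Φ : (Fin (n + 1) → ℂ) → ℂ → ℂ}
    (hΦ : AnalyticOnNhd ℂ (fun q : (Fin (n + 1) → ℂ) × ℂ => Φ q.1 q.2) (U ×ˢ Set.univ)) :
    AnalyticOnNhd ℂ (fun q : (Fin (n + 1) → ℂ) × ℂ => partialDeriv j (fun y => Φ y q.2) q.1)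
      (U ×ˢ Set.univ) := by
  -- The partial derivative in x is the total derivative in the direction (e_j, 0), hence again
  -- jointly analytic.
  have h1 : AnalyticOnNhd ℂ (fun q => fderiv ℂ (fun q : (Fin (n + 1) → ℂ) × ℂ => Φ q.1 q.2) q
      (Pi.single j 1, 0)) (U ×ˢ Set.univ) := fun q hq =>
    ((ContinuousLinearMap.apply ℂ ℂ ((Pi.single j 1, 0) : (Fin (n + 1) → ℂ) × ℂ)).analyticAt
      _).comp (hΦ.fderiv q hq)
  refine h1.congr (hU.prod isOpen_univ) fun q hq => ?_
  have hd : DifferentiableAt ℂ (fun q : (Fin (n + 1) → ℂ) × ℂ => Φ q.1 q.2) (q.1, q.2) :=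
    (hΦ q hq).differentiableAt
  have := hd.hasFDerivAt.comp q.1 ((hasFDerivAt_id (𝕜 := ℂ) q.1).prodMk
    (hasFDerivAt_const q.2 q.1))
  have h2 := this.fderiv
  simp only [partialDeriv]
  change _ = fderiv ℂ ((fun q : (Fin (n + 1) → ℂ) × ℂ => Φ q.1 q.2) ∘ fun y => (id y, q.2)) q.1 _
  rw [h2]
  simp

theorem analyticOnNhd_monomialDeriv {n : ℕ} {U : Set (Fin (n + 1) → ℂ)} (hU : IsOpen U)
    (u : Fin (n + 1) → ℕ) {Φ : (Fin (n + 1) → ℂ) → ℂ → ℂ}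
    (hΦ : AnalyticOnNhd ℂ (fun q : (Fin (n + 1) → ℂ) × ℂ => Φ q.1 q.2) (U ×ˢ Set.univ)) :
    AnalyticOnNhd ℂ (fun q : (Fin (n + 1) → ℂ) × ℂ => monomialDeriv u (fun y => Φ y q.2) q.1)
      (U ×ˢ Set.univ) := by
  have hit : ∀ (j : Fin (n + 1)) (a : ℕ) (Ψ : (Fin (n + 1) → ℂ) → ℂ → ℂ),
      AnalyticOnNhd ℂ (fun q : (Fin (n + 1) → ℂ) × ℂ => Ψ q.1 q.2) (U ×ˢ Set.univ) →
      AnalyticOnNhd ℂ (fun q : (Fin (n + 1) → ℂ) × ℂ =>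
        (partialDeriv j)^[a] (fun y => Ψ y q.2) q.1) (U ×ˢ Set.univ) := by
    intro j a
    induction a with
    | zero => exact fun Ψ h => h
    | succ a ih =>
      intro Ψ h
      exact ih (fun x t => partialDeriv j (fun y => Ψ y t) x) (analyticOnNhd_partialDeriv hU j h)
  simp only [monomialDeriv]
  induction List.finRange (n + 1) with
  | nil => exact hΦ
  | cons j L ih =>
    exact hit j (u j)
      (fun x t => L.foldr (fun j g => (partialDeriv j)^[u j] g) (fun y => Φ y t) x) ih

theorem continuous_slice {n : ℕ} {U : Set (Fin (n + 1) → ℂ)}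
    {Φ : (Fin (n + 1) → ℂ) → ℂ → ℂ}
    (hΦ : AnalyticOnNhd ℂ (fun q : (Fin (n + 1) → ℂ) × ℂ => Φ q.1 q.2) (U ×ˢ Set.univ))
    {x : Fin (n + 1) → ℂ} (hx : x ∈ U) : Continuous (Φ x) := by
  refine continuous_iff_continuousAt.2 fun t => ?_
  exact (hΦ (x, t) ⟨hx, Set.mem_univ t⟩).continuousAt.comp (f := fun t => (x, t))
    (by fun_prop)

/-! ### Toric and Euler operators on the polar series -/

section Solution

variable {n : ℕ} {b : Fin (n + 1)} {U : Set (Fin (n + 1) → ℂ)} {v : (Fin (n + 1) → ℂ) → ℂ}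
  {w : Fin (n + 1) → ℕ}

theorem prod_range_sub_ne_zero {t : ℂ} (ht : ∀ j : ℕ, t ≠ j) (l : ℕ) :
    ∏ i ∈ Finset.range l, (t - i) ≠ 0 :=
  Finset.prod_ne_zero_iff.2 fun i _ => sub_ne_zero.2 (ht i)

theorem polarSeries_eq_inv_mul {t : ℂ} (ht : ∀ j : ℕ, t ≠ j) (w : Fin (n + 1) → ℕ) (N : ℕ) (v : ℂ)
    (x : Fin (n + 1) → ℂ) : polarSeries w b N v x t =
      (∏ i ∈ Finset.range (minLength w N), (t - i))⁻¹ * powerCoeff w b v x N t := by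
  rw [← prod_mul_polarSeries, inv_mul_cancel_left₀ (prod_range_sub_ne_zero ht _)]

theorem IsLogBranch.partialDeriv_polarSeries (h : IsLogBranch b U v)
    (hw : ∀ i, w i = 0 ↔ i = b) (N : ℕ) (j : Fin (n + 1)) {t : ℂ} (ht : ∀ j : ℕ, t ≠ j)
    {x : Fin (n + 1) → ℂ} (hx : x ∈ U) :
    partialDeriv j (fun x => polarSeries w b N (v x) x t) x =
      (∏ i ∈ Finset.range (minLength w N), (t - i))⁻¹ *
        (t * powerCoeff w b (v x) x (N - w j) (t - 1)) := by
  simp only [polarSeries_eq_inv_mul ht]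
  rw [partialDeriv_const_mul (h.differentiableAt_powerCoeff w N t hx),
    h.partialDeriv_powerCoeff hw j N t hx]

/-- For t outside ℕ the series is a nonzero constant times a power coefficient. Both sides are
continuous in t and the complement of ℕ is dense, so the equality persists where the constant
degenerates. -/
theorem IsLogBranch.monomialDeriv_polarSeries_eq (h : IsLogBranch b U v)
    (hw : ∀ i, w i = 0 ↔ i = b) (N : ℕ) (t : ℂ) (u u' : Fin (n + 1) → ℕ)
    (h1 : ∑ i, u i = ∑ i, u' i) (h2 : ∑ i, w i * u i = ∑ i, w i * u' i)
    {x : Fin (n + 1) → ℂ} (hx : x ∈ U) :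
    monomialDeriv u (fun x => polarSeries w b N (v x) x t) x =
      monomialDeriv u' (fun x => polarSeries w b N (v x) x t) x := by
  have hc := fun u => continuous_slice
    (Φ := fun x t => monomialDeriv u (fun x => polarSeries w b N (v x) x t) x)
    (analyticOnNhd_monomialDeriv (Φ := fun x t => polarSeries w b N (v x) x t) h.isOpen u
      (h.analyticOnNhd_polarSeries w N)) hx
  refine congrFun ((hc u).ext_on dense_setOf_forall_ne_natCast (hc u') fun t ht => ?_) t
  have he : Set.EqOn (fun x => polarSeries w b N (v x) x t)
    (fun x => (∏ i ∈ Finset.range (minLength w N), (t - i))⁻¹ * powerCoeff w b (v x) x N t) U :=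
    fun x _ => polarSeries_eq_inv_mul ht w N _ _
  dsimp only
  rw [h.monomialDeriv_powerCoeff hw u he hx, h.monomialDeriv_powerCoeff hw u' he hx, h1, h2]

/-- The two Euler equations are `sum_mul_powerCoeff` and `mul_powerCoeff`, divided by ∏_{i<ℓ} (t -
i) for t outside ℕ and extended to all t by continuity. -/
theorem IsLogBranch.sum_mul_partialDeriv_polarSeries (h : IsLogBranch b U v)
    (hw : ∀ i, w i = 0 ↔ i = b) (N : ℕ) (t : ℂ) {x : Fin (n + 1) → ℂ} (hx : x ∈ U) :
    ∑ j, x j * partialDeriv j (fun x => polarSeries w b N (v x) x t) x =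
        t * polarSeries w b N (v x) x t ∧
      ∑ j, (w j : ℂ) * x j * partialDeriv j (fun x => polarSeries w b N (v x) x t) x =
        N * polarSeries w b N (v x) x t := by
  have hc := fun j => continuous_slice
    (Φ := fun x t => partialDeriv j (fun x => polarSeries w b N (v x) x t) x)
    (analyticOnNhd_partialDeriv (Φ := fun x t => polarSeries w b N (v x) x t) h.isOpen j
      (h.analyticOnNhd_polarSeries w N)) hx
  have hs := continuous_slice (Φ := fun x t => polarSeries w b N (v x) x t)
    (h.analyticOnNhd_polarSeries w N) hx
  constructor
  · refine congrFun (Continuous.ext_on dense_setOf_forall_ne_natCast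
      (f := fun t => ∑ j, x j * partialDeriv j (fun x => polarSeries w b N (v x) x t) x)
      (g := fun t => t * polarSeries w b N (v x) x t)
      (continuous_finsetSum _ fun j _ => continuous_const.mul (hc j))
      (continuous_id.mul hs) fun t ht => ?_) t
    simp only [h.partialDeriv_polarSeries hw N _ ht hx]
    simp only [polarSeries_eq_inv_mul ht,
      ← sum_mul_powerCoeff hw (h.exp_eq x hx) N t, Finset.mul_sum]
    exact Finset.sum_congr rfl fun j _ => by ring
  · refine congrFun (Continuous.ext_on dense_setOf_forall_ne_natCast
      (f := fun t => ∑ j, (w j : ℂ) * x j *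
        partialDeriv j (fun x => polarSeries w b N (v x) x t) x)
      (g := fun t => N * polarSeries w b N (v x) x t)
      (continuous_finsetSum _ fun j _ => continuous_const.mul (hc j))
      (continuous_const.mul hs) fun t ht => ?_) t
    have hr := mul_powerCoeff w b (h.exp_eq x hx) N t
    simp only [h.partialDeriv_polarSeries hw N _ ht hx]
    simp only [polarSeries_eq_inv_mul ht]
    rw [Int.cast_natCast] at hr
    rw [mul_left_comm, hr, Finset.mul_sum, Finset.mul_sum]
    exact Finset.sum_congr rfl fun j _ => by ring

end Solution

/-! ### The series does not vanish identically -/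

/-- Membership in the monoid is essential: `sInf ∅ = 0` would make `minLength` meaningless for a
gap. Generators of weight zero are dropped from a representation. -/
theorem orderedPartitions_minLength_nonempty {n : ℕ} {w : Fin (n + 1) → ℕ} {N : ℕ}
    (hN : N ∈ AddSubmonoid.closure (Set.range w)) :
    (orderedPartitions w N (minLength w N)).Nonempty := by
  refine Nat.sInf_mem (s := {l | (orderedPartitions w N l).Nonempty}) ?_
  induction hN using AddSubmonoid.closure_induction_left with
  | zero => exact ⟨0, fun j => j.elim0,
      Finset.mem_filter.2 ⟨Finset.mem_univ _, fun j => j.elim0, by simp⟩⟩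
  | add_left y hy N hN ih =>
    obtain ⟨i, rfl⟩ := hy
    obtain ⟨l, p, hp⟩ := ih
    simp only [orderedPartitions, Finset.mem_filter, Finset.mem_univ, true_and] at hp
    by_cases h0 : w i = 0
    · exact ⟨l, p, by simpa [orderedPartitions, h0] using hp⟩
    · refine ⟨l + 1, Fin.cons i p, ?_⟩
      simp [orderedPartitions, Fin.forall_fin_succ, Fin.sum_univ_succ, h0, hp.1, hp.2]

/-- Every factor is positive, since `N` minus the preceding parts is at least the current part. The
sum is therefore positive as soon as one partition exists. -/
theorem partitionSum_one_ne_zero {n : ℕ} {w : Fin (n + 1) → ℕ} {N l : ℕ}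
    (h : (orderedPartitions w N l).Nonempty) : partitionSum w (fun _ => 1) N l ≠ 0 := by
  have hpos : 0 < ∑ p ∈ orderedPartitions w N l,
      ∏ j : Fin l, ((w (p j) : ℝ) / ((N : ℝ) - ∑ i ∈ Finset.Iio j, (w (p i) : ℝ))) := by
    refine Finset.sum_pos (fun p hp => Finset.prod_pos fun j _ => ?_) h
    simp only [orderedPartitions, Finset.mem_filter, Finset.mem_univ, true_and] at hp
    have h0 : 0 < w (p j) := Nat.pos_of_ne_zero (hp.1 j)
    have h1 : ∑ i ∈ Finset.Iio j, w (p i) + w (p j) ≤ N := by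
      rw [← hp.2, ← Finset.sum_erase_add _ _ (Finset.mem_univ j)]
      gcongr
      intro i hi
      simp only [Finset.mem_Iio] at hi
      simp [hi.ne]
    have h2 : (0 : ℝ) < (N : ℝ) - ∑ i ∈ Finset.Iio j, (w (p i) : ℝ) := by
      have h3 : ∑ i ∈ Finset.Iio j, w (p i) < N := by omega
      have : ((∑ i ∈ Finset.Iio j, w (p i) : ℕ) : ℝ) < N := by exact_mod_cast h3
      push_cast at this
      linarith
    have h4 : (0 : ℝ) < w (p j) := by exact_mod_cast h0
    positivity
  have : partitionSum w (fun _ => 1) N l = ((∑ p ∈ orderedPartitions w N l,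
      ∏ j : Fin l, ((w (p j) : ℝ) / ((N : ℝ) - ∑ i ∈ Finset.Iio j, (w (p i) : ℝ))) : ℝ) : ℂ) := by
    simp [partitionSum]
  rw [this]
  exact_mod_cast hpos.ne'

theorem partitionSum_div {n : ℕ} (w : Fin (n + 1) → ℕ) (x : Fin (n + 1) → ℂ) (c : ℂ) (N l : ℕ) :
    partitionSum w (fun i => x i / c) N l = partitionSum w x N l / c ^ l := by
  simp only [partitionSum, Finset.sum_div]
  refine Finset.sum_congr rfl fun p _ => ?_
  simp only [mul_div_assoc', Finset.prod_div_distrib, Finset.prod_const, Finset.card_univ,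
    Fintype.card_fin]

theorem partitionSum_congr {n : ℕ} (w : Fin (n + 1) → ℕ) {x y : Fin (n + 1) → ℂ}
    (h : ∀ i, w i ≠ 0 → x i = y i) (N l : ℕ) : partitionSum w x N l = partitionSum w y N l := by
  refine Finset.sum_congr rfl fun p hp => Finset.prod_congr rfl fun j _ => ?_
  simp only [orderedPartitions, Finset.mem_filter, Finset.mem_univ, true_and] at hp
  rw [h _ (hp.1 j)]

/-- Up to the exponential factor, x_b^N times the series is a polynomial in x, so vanishing on an
open set makes it the zero polynomial. Setting x_b = τ and all other coordinates to 1, different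
lengths give different powers of τ. The power N - ℓ carries the empty product in t times a positive
sum, so it survives for every t. -/
theorem IsLogBranch.exists_polarSeries_ne_zero {n : ℕ} {b : Fin (n + 1)}
    {U : Set (Fin (n + 1) → ℂ)} {v : (Fin (n + 1) → ℂ) → ℂ} (h : IsLogBranch b U v)
    (hne : U.Nonempty) {w : Fin (n + 1) → ℕ} (hw : ∀ i, w i = 0 ↔ i = b) {N : ℕ}
    (hN : N ∈ AddSubmonoid.closure (Set.range w)) (t : ℂ) :
    ∃ x ∈ U, polarSeries w b N (v x) x t ≠ 0 := by
  by_contra! hcon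
  have hℓ := orderedPartitions_minLength_nonempty hN
  have hℓN : minLength w N ≤ N := by
    by_contra! hlt
    rw [orderedPartitions_eq_empty w hlt] at hℓ
    simp at hℓ
  let c : ℕ → ℂ := fun l => ∏ i ∈ Finset.Ico (minLength w N) l, (t - i)
  let P : (Fin (n + 1) → ℂ) → ℂ := fun x =>
    ∑ l ∈ Finset.range (N + 1), c l * x b ^ (N - l) * partitionSum w x N l
  have hP : Differentiable ℂ P := by
    unfold P partitionSum
    fun_prop
  obtain ⟨x₀, hx₀⟩ := hne
  have hP0 : P = fun _ => 0 := by
    refine eq_of_eventuallyEq_of_differentiable hP (differentiable_const _) (p := x₀) ?_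
    filter_upwards [h.isOpen.mem_nhds hx₀] with x hx
    have hS := hcon x hx
    have hb := h.ne_zero hx
    rw [polarSeries_eq, mul_eq_zero, or_iff_right (Complex.exp_ne_zero _)] at hS
    have : P x = x b ^ N * ∑ l ∈ Finset.range (N + 1), c l *
        partitionSum w (fun i => x i / x b) N l := by
      rw [Finset.mul_sum]
      refine Finset.sum_congr rfl fun l hl => ?_
      have hl : l ≤ N := Nat.lt_succ_iff.1 (Finset.mem_range.1 hl)
      rw [partitionSum_div]
      have : x b ^ N = x b ^ (N - l) * x b ^ l := by rw [← pow_add, Nat.sub_add_cancel hl]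
      rw [this]
      field_simp
    rw [this, hS, mul_zero]
  let R : Polynomial ℂ := ∑ l ∈ Finset.range (N + 1),
    Polynomial.monomial (N - l) (c l * partitionSum w (fun _ => 1) N l)
  have hR : R = 0 := by
    refine Polynomial.funext fun τ => ?_
    have := congrFun hP0 (Function.update (fun _ => 1) b τ)
    simp only [R, Polynomial.eval_finsetSum, Polynomial.eval_monomial, Polynomial.eval_zero]
    rw [← this]
    refine Finset.sum_congr rfl fun l _ => ?_
    rw [partitionSum_congr w (x := Function.update (fun _ => 1) b τ) (y := fun _ => 1)]
    · rw [Function.update_self]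
      ring
    · intro i hi
      exact Function.update_of_ne ((hw i).not.1 hi) _ _
  have hcoeff : R.coeff (N - minLength w N) = partitionSum w (fun _ => 1) N (minLength w N) := by
    simp only [R, Polynomial.finsetSum_coeff, Polynomial.coeff_monomial]
    rw [Finset.sum_eq_single (minLength w N)]
    · simp [c]
    · intro l hl hne
      have hl : l ≤ N := Nat.lt_succ_iff.1 (Finset.mem_range.1 hl)
      rw [if_neg (by omega)]
    · intro hnot
      exact absurd (Finset.mem_range.2 (Nat.lt_succ_iff.2 hℓN)) hnot
  rw [hR, Polynomial.coeff_zero] at hcoeff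
  exact partitionSum_one_ne_zero hℓ hcoeff.symm

/-! ### Facets -/

section Facet

variable {n : ℕ} {k : Fin (n + 1) → ℕ}

theorem IsCurve.le_degree (hk : IsCurve k) (i : Fin (n + 1)) : k i ≤ degree k :=
  hk.strictMono.monotone (Fin.le_last i)

theorem IsCurve.degree_pos (hk : IsCurve k) : 0 < degree k := by
  by_contra h
  have h0 : Finset.univ.gcd k = 0 := Finset.gcd_eq_zero_iff.2 fun i _ => by
    have := hk.le_degree i
    omega
  rw [hk.gcd_eq_one] at h0
  exact one_ne_zero h0

theorem IsCurve.weight_eq_zero_iff (hk : IsCurve k) (F : Facet) (i : Fin (n + 1)) :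
    F.weight k i = 0 ↔ i = F.vertex := by
  cases F with
  | origin =>
    simp only [Facet.weight, Facet.vertex]
    rw [← hk.strictMono.injective.eq_iff, hk.zero]
  | infinity =>
    simp only [Facet.weight, Facet.vertex, Nat.sub_eq_zero_iff_le]
    rw [← hk.strictMono.injective.eq_iff]
    have := hk.le_degree i
    unfold degree at *
    omega

theorem IsCurve.weight_add_weight_opp (hk : IsCurve k) (F : Facet) (i : Fin (n + 1)) :
    F.weight k i + F.opp.weight k i = degree k := by
  have := hk.le_degree i
  cases F <;> simp only [Facet.weight, Facet.opp] <;> omega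

theorem Facet.form_add_form_opp (F : Facet) (β : ℂ × ℂ) :
    F.form k β + F.opp.form k β = degree k * β.1 := by
  cases F <;> simp only [Facet.form, Facet.opp] <;> ring

/-- The columns of the matrix `A`. -/
def column (k : Fin (n + 1) → ℕ) (i : Fin (n + 1)) : ℂ × ℂ := (1, k i)

theorem IsCurve.form_sub_column (hk : IsCurve k) (F : Facet) (β : ℂ × ℂ) (i : Fin (n + 1)) :
    F.form k (β - column k i) = F.form k β - F.weight k i := by
  cases F
  · simp [Facet.form, Facet.weight, column]
  · simp only [Facet.form, Facet.weight, column, Prod.fst_sub, Prod.snd_sub]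
    rw [Nat.cast_sub (hk.le_degree i)]
    ring

theorem Facet.differentiable_form (F : Facet) : Differentiable ℂ (F.form k) := by
  cases F <;> simp only [Facet.form] <;> fun_prop

theorem Facet.form_sub (F : Facet) (β γ : ℂ × ℂ) :
    F.form k (β - γ) = F.form k β - F.form k γ := by
  cases F
  · rfl
  · simp only [Facet.form, Prod.fst_sub, Prod.snd_sub]
    ring

/-- A numerical monoid contains all large multiples of the gcd of its generators, and here this gcd
is 1. At infinity the weight of column 0 is the degree, so a common divisor of all `degree k - k i`
also divides every `k i`. -/
theorem IsCurve.finite_gaps (hk : IsCurve k) (F : Facet) : {κ | κ ∉ F.monoid k}.Finite := by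
  obtain ⟨m, hm⟩ := Nat.exists_mem_closure_of_ge (Set.range (F.weight k))
  refine (Set.finite_lt_nat m).subset fun κ hκ => ?_
  by_contra hlt
  refine hκ (hm κ (not_lt.1 hlt) ?_)
  suffices h : Nat.setGcd (Set.range (F.weight k)) ∣ 1 from h.trans (one_dvd κ)
  have hd : ∀ i, Nat.setGcd (Set.range (F.weight k)) ∣ F.weight k i := fun i =>
    Nat.setGcd_dvd_of_mem ⟨i, rfl⟩
  refine (Finset.dvd_gcd (f := k) (s := Finset.univ) fun i _ => ?_).trans hk.gcd_eq_one.dvd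
  cases F with
  | origin => exact hd i
  | infinity =>
    have h0 := hd 0
    simp only [Facet.weight, hk.zero, Nat.sub_zero] at h0
    exact (Nat.dvd_sub_iff_right (hk.le_degree i) h0).1 (hd i)

/-- The finite set of gaps of the monoid of the facet. -/
noncomputable def IsCurve.gaps (hk : IsCurve k) (F : Facet) : Finset ℕ :=
  (hk.finite_gaps F).toFinset

theorem IsCurve.mem_gaps (hk : IsCurve k) (F : Facet) {κ : ℕ} :
    κ ∈ hk.gaps F ↔ κ ∉ F.monoid k := by
  simp [gaps]

theorem IsCurve.gapProd_eq (hk : IsCurve k) (F : Facet) (s : ℂ) :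
    F.gapProd k s = ∏ κ ∈ hk.gaps F, (s - κ) :=
  finprod_mem_eq_finite_toFinset_prod _ (hk.finite_gaps F)

theorem IsCurve.differentiable_gapProd (hk : IsCurve k) (F : Facet) :
    Differentiable ℂ (F.gapProd k) := by
  simp only [funext (hk.gapProd_eq F)]
  fun_prop

theorem IsCurve.gapProd_eq_zero_iff (hk : IsCurve k) (F : Facet) (s : ℂ) :
    F.gapProd k s = 0 ↔ ∃ κ : ℕ, κ ∉ F.monoid k ∧ s = κ := by
  simp [hk.gapProd_eq, Finset.prod_eq_zero_iff, sub_eq_zero, hk.mem_gaps]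

theorem IsCurve.gapProd_ne_zero_of_re_neg (hk : IsCurve k) (F : Facet) {s : ℂ} (hs : s.re < 0) :
    F.gapProd k s ≠ 0 := by
  rw [Ne, hk.gapProd_eq_zero_iff]
  rintro ⟨κ, -, rfl⟩
  simp only [Complex.natCast_re] at hs
  exact absurd hs (not_lt.2 (Nat.cast_nonneg κ))

theorem IsCurve.gapProd_natCast_ne_zero (hk : IsCurve k) (F : Facet) {N : ℕ}
    (hN : N ∈ F.monoid k) : F.gapProd k N ≠ 0 := by
  rw [Ne, hk.gapProd_eq_zero_iff]
  rintro ⟨κ, hκ, h⟩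
  exact hκ (Nat.cast_injective h ▸ hN)

theorem Facet.weight_mem_monoid (F : Facet) (i : Fin (n + 1)) : F.weight k i ∈ F.monoid k :=
  AddSubmonoid.subset_closure ⟨i, rfl⟩

/-- The zeros of `gapProd` are cancelled by those of the shifted product and the given factors. -/
theorem IsCurve.exists_mul_gapProd_eq (hk : IsCurve k) (F : Facet) {a : ℕ} (ha : a ∈ F.monoid k)
    {J : Finset ℕ} (hJ : ∀ j, j ∈ J → j < a) (hJ' : ∀ j, j ∉ F.monoid k → j < a → j ∈ J) :
    ∃ R : ℂ → ℂ, Differentiable ℂ R ∧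
      ∀ s, R s * F.gapProd k s = (∏ j ∈ J, (j - s)) * F.gapProd k (s - a) := by
  let B : Finset ℕ := J ∪ (hk.gaps F).map (addRightEmbedding a)
  have hdisj : Disjoint J ((hk.gaps F).map (addRightEmbedding a)) := by
    rw [Finset.disjoint_left]
    intro j hj hj'
    have := hJ j hj
    simp only [Finset.mem_map, addRightEmbedding_apply] at hj'
    omega
  -- For a gap κ ≥ a the number κ - a is again a gap, because adding the monoid element a to an
  -- element would give an element. As all these zeros are simple, inclusion of zero sets means
  -- divisibility.
  have hsub : hk.gaps F ⊆ B := by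
    intro κ hκ
    rw [hk.mem_gaps] at hκ
    simp only [B, Finset.mem_union, Finset.mem_map, addRightEmbedding_apply, hk.mem_gaps]
    rcases lt_or_ge κ a with h | h
    · exact Or.inl (hJ' κ hκ h)
    · refine Or.inr ⟨κ - a, fun hmem => hκ ?_, Nat.sub_add_cancel h⟩
      have := (F.monoid k).add_mem hmem ha
      rwa [Nat.sub_add_cancel h] at this
  refine ⟨fun s => (-1) ^ J.card * ∏ κ ∈ B \ hk.gaps F, (s - κ), by fun_prop, fun s => ?_⟩
  rw [hk.gapProd_eq, hk.gapProd_eq, mul_assoc, Finset.prod_sdiff hsub, Finset.prod_union hdisj,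
    Finset.prod_map, ← mul_assoc, ← Finset.prod_const, ← Finset.prod_mul_distrib]
  congr 1
  · exact Finset.prod_congr rfl fun j _ => by ring
  · exact Finset.prod_congr rfl fun j _ => by simp only [addRightEmbedding_apply]; push_cast; ring

/-- Replace each part of the partition by its opposite weight and add `m - l` copies of the opposite
weight of the vertex, which is the degree. -/
theorem mul_degree_mem_monoid_opp (hk : IsCurve k) (F : Facet) {N l m : ℕ}
    (hl : (orderedPartitions (F.weight k) N l).Nonempty) (hm : l ≤ m) :
    ∃ q ∈ F.opp.monoid k, N + q = degree k * m := by
  obtain ⟨p, hp⟩ := hl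
  simp only [orderedPartitions, Finset.mem_filter, Finset.mem_univ, true_and] at hp
  refine ⟨∑ j, F.opp.weight k (p j) + (m - l) • F.opp.weight k F.vertex,
    (F.opp.monoid k).add_mem (sum_mem fun j _ => F.opp.weight_mem_monoid _)
      (nsmul_mem (F.opp.weight_mem_monoid _) _), ?_⟩
  have h1 : F.opp.weight k F.vertex = degree k := by
    rw [← hk.weight_add_weight_opp F F.vertex, (hk.weight_eq_zero_iff F _).2 rfl, zero_add]
  rw [h1, ← hp.2, ← add_assoc, ← Finset.sum_add_distrib]
  simp only [hk.weight_add_weight_opp F]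
  simp only [Finset.sum_const, Finset.card_univ, Fintype.card_fin, smul_eq_mul]
  rw [← add_mul, Nat.add_sub_cancel' hm, mul_comm]

end Facet

/-! ### Gamma factors and the entire factor on a polar line -/

/-- The functional equation for the reciprocal of Γ. In this form it holds at the poles as well,
where the inverse is 0. -/
theorem inv_Gamma_neg_eq (s : ℂ) (a : ℕ) :
    (Complex.Gamma (-s))⁻¹ = (∏ j ∈ Finset.range a, ((j : ℂ) - s)) * (Complex.Gamma (a - s))⁻¹ := by
  induction a with
  | zero => simp
  | succ a ih =>
    rw [ih, Finset.prod_range_succ]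
    have := Complex.one_div_Gamma_eq_self_mul_one_div_Gamma_add_one (a - s)
    have e : ((a + 1 : ℕ) : ℂ) - s = a - s + 1 := by push_cast; ring
    rw [this, e]
    ring

/-- A quotient of entire functions is entire if the zeros of the denominator are simple and
contained in those of the numerator. -/
theorem exists_differentiable_eq_div {A B : ℂ → ℂ} (hA : Differentiable ℂ A)
    (hB : ∀ p, B p = 0 → A p = 0 ∧ ∃ P : ℂ → ℂ, Differentiable ℂ P ∧ P p ≠ 0 ∧
      ∀ t, B t = (t - p) * P t) (hB' : Differentiable ℂ B) :
    ∃ h : ℂ → ℂ, Differentiable ℂ h ∧ ∀ t, B t ≠ 0 → h t = A t / B t := by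
  classical
  -- At a zero of `B` the value is the one given by l'Hôpital's rule. Near p the quotient is then
  -- `dslope A p / P`, which is differentiable.
  refine ⟨fun t => if B t = 0 then deriv A t / deriv B t else A t / B t, fun p => ?_,
    fun t ht => if_neg ht⟩
  by_cases hp : B p = 0
  · obtain ⟨hAp, P, hP, hPp, hBP⟩ := hB p hp
    have hd : DifferentiableAt ℂ (fun t => dslope A p t / P t) p := by
      refine DifferentiableAt.div ?_ (hP p) hPp
      exact ((Complex.differentiableOn_dslope (Filter.univ_mem)).2
        hA.differentiableOn).differentiableAt Filter.univ_mem
    refine hd.congr_of_eventuallyEq ?_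
    filter_upwards [(hP p).continuousAt.eventually_ne hPp] with t ht
    by_cases htp : t = p
    · subst htp
      have hdB : deriv B t = P t := by
        have : HasDerivAt B (1 * P t + (t - t) * deriv P t) t := by
          rw [funext hBP]
          exact ((hasDerivAt_id t).sub_const t).mul (hP t).hasDerivAt
        simpa using this.deriv
      rw [if_pos hp, dslope_same, hdB]
    · have h1 : t - p ≠ 0 := sub_ne_zero.2 htp
      rw [if_neg (by rw [hBP]; exact mul_ne_zero h1 ht), dslope_of_ne _ htp, slope_def_field, hAp,
        hBP]
      field_simp
      ring
  · refine ((hA p).div (hB' p) hp).congr_of_eventuallyEq ?_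
    filter_upwards [(hB' p).continuousAt.eventually_ne hp] with t ht
    exact if_neg ht

/-- The denominator `B` vanishes at poles of Γ(ℓ - t) and at zeros of the opposite gap product. In
both cases degree·t - N is a natural number, so the numerator 1/Γ(N - degree·t) vanishes too. The
zeros are simple because the first kind yields an element of the opposite monoid and the second a
gap, so they never coincide. -/
theorem IsCurve.exists_entire_factor {n : ℕ} {k : Fin (n + 1) → ℕ} (hk : IsCurve k) (F : Facet)
    {N : ℕ} (hN : N ∈ F.monoid k) :
    ∃ h : ℂ → ℂ, Differentiable ℂ h ∧
      ∀ t : ℂ, (∀ j : ℕ, t ≠ j) → (∀ j : ℕ, degree k * t ≠ N + j) →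
        h t = (-1) ^ (N + minLength (F.weight k) N) * (N.factorial : ℂ)
            * Complex.Gamma (minLength (F.weight k) N - t)
          / (Complex.Gamma (N - degree k * t) * F.gapProd k N
            * F.opp.gapProd k (degree k * t - N)) := by
  set ℓ := minLength (F.weight k) N with hℓ
  have hne : (orderedPartitions (F.weight k) N ℓ).Nonempty :=
    orderedPartitions_minLength_nonempty hN
  have hd : (degree k : ℂ) ≠ 0 := by exact_mod_cast hk.degree_pos.ne'
  set C : ℂ := (-1) ^ (N + ℓ) * (N.factorial : ℂ) / F.gapProd k N
  let A : ℂ → ℂ := fun t => C * (Complex.Gamma (N - degree k * t))⁻¹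
  let B : ℂ → ℂ := fun t => (Complex.Gamma (ℓ - t))⁻¹ * F.opp.gapProd k (degree k * t - N)
  have hΓ : ∀ a c : ℂ, Differentiable ℂ fun t => (Complex.Gamma (a - c * t))⁻¹ := fun a c =>
    Complex.differentiable_one_div_Gamma.comp (by fun_prop)
  have hΓ1 : ∀ a : ℂ, Differentiable ℂ fun t => (Complex.Gamma (a - t))⁻¹ := fun a =>
    Complex.differentiable_one_div_Gamma.comp (by fun_prop)
  have hgap : Differentiable ℂ fun t => F.opp.gapProd k (degree k * t - N) :=
    (hk.differentiable_gapProd F.opp).comp (by fun_prop)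
  have hA : Differentiable ℂ A := (hΓ _ _).const_mul C
  have hAzero : ∀ (p : ℂ) (q : ℕ), degree k * p - N = q → A p = 0 := by
    intro p q hq
    have : (N : ℂ) - degree k * p = -q := by rw [← hq]; ring
    simp only [A, this, Complex.Gamma_neg_nat_eq_zero, inv_zero, mul_zero]
  have hpole : ∀ p : ℂ, (Complex.Gamma (ℓ - p))⁻¹ = 0 →
      ∃ m : ℕ, p = ℓ + m ∧ ∃ q ∈ F.opp.monoid k, degree k * p - N = (q : ℕ) := by
    intro p hp
    rw [inv_eq_zero, Complex.Gamma_eq_zero_iff] at hp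
    obtain ⟨m, hm⟩ := hp
    have hpm : p = ℓ + m := by linear_combination -hm
    obtain ⟨q, hq, hq'⟩ := mul_degree_mem_monoid_opp hk F hne (Nat.le_add_right ℓ m)
    refine ⟨m, hpm, q, hq, ?_⟩
    have : (N : ℂ) + q = degree k * (ℓ + m) := by exact_mod_cast hq'
    rw [hpm, ← this]
    ring
  have hB : ∀ p, B p = 0 → A p = 0 ∧ ∃ P : ℂ → ℂ, Differentiable ℂ P ∧ P p ≠ 0 ∧
      ∀ t, B t = (t - p) * P t := by
    intro p hp
    by_cases h0 : (Complex.Gamma (ℓ - p))⁻¹ = 0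
    · obtain ⟨m, hm, q, hq, hpq⟩ := hpole p h0
      -- Shifting Γ by m + 1 steps writes 1/Γ(ℓ - t) as a product of linear factors over Γ(ℓ + m + 1
      -- - t), which is Γ(1) at p. The last linear factor is -(t - p), and the others are nonzero at
      -- p.
      refine ⟨hAzero p q hpq, fun t => -(∏ j ∈ Finset.range m, ((j : ℂ) - (t - ℓ))) *
        (Complex.Gamma (ℓ + (m + 1) - t))⁻¹ * F.opp.gapProd k (degree k * t - N), ?_, ?_, ?_⟩
      · refine (Differentiable.mul ?_ (hΓ1 _)).mul hgap
        fun_prop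
      · refine mul_ne_zero (mul_ne_zero (neg_ne_zero.2 (Finset.prod_ne_zero_iff.2 ?_)) ?_) ?_
        · intro j hj
          have hj' : j ≠ m := (Finset.mem_range.1 hj).ne
          rw [hm, add_sub_cancel_left, sub_ne_zero]
          exact_mod_cast hj'
        · have : (ℓ : ℂ) + (m + 1) - p = 1 := by rw [hm]; ring
          rw [this, Complex.Gamma_one]
          simp
        · rw [hpq]
          exact hk.gapProd_natCast_ne_zero F.opp hq
      · intro t
        have h1 := inv_Gamma_neg_eq (t - ℓ) (m + 1)
        have e1 : -(t - (ℓ : ℂ)) = ℓ - t := by ring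
        have e2 : ((m + 1 : ℕ) : ℂ) - (t - ℓ) = ℓ + (m + 1) - t := by push_cast; ring
        rw [e1, e2, Finset.prod_range_succ] at h1
        simp only [B]
        rw [h1, hm]
        ring
    · have hg : F.opp.gapProd k (degree k * p - N) = 0 := by
        simpa [B, h0] using hp
      obtain ⟨κ, hκ, hpκ⟩ := (hk.gapProd_eq_zero_iff F.opp _).1 hg
      refine ⟨hAzero p κ hpκ, fun t => (Complex.Gamma (ℓ - t))⁻¹ * (degree k *
        ∏ κ' ∈ (hk.gaps F.opp).erase κ, (degree k * t - N - κ')), ?_, ?_, ?_⟩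
      · refine (hΓ1 _).mul ?_
        fun_prop
      · refine mul_ne_zero h0 (mul_ne_zero hd (Finset.prod_ne_zero_iff.2 fun κ' hκ' => ?_))
        rw [hpκ, sub_ne_zero]
        exact_mod_cast (Finset.ne_of_mem_erase hκ').symm
      · intro t
        simp only [B]
        rw [hk.gapProd_eq, ← Finset.mul_prod_erase _ _ ((hk.mem_gaps F.opp).2 hκ)]
        have : degree k * t - N - (κ : ℂ) = (t - p) * degree k := by rw [← hpκ]; ring
        rw [this]
        ring
  obtain ⟨h, hh, hh'⟩ := exists_differentiable_eq_div hA hB ((hΓ1 ℓ).mul hgap)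
  refine ⟨h, hh, fun t ht ht' => ?_⟩
  have hg : F.opp.gapProd k (degree k * t - N) ≠ 0 := by
    rw [Ne, hk.gapProd_eq_zero_iff]
    rintro ⟨κ, -, hκ⟩
    exact ht' κ (by linear_combination hκ)
  have hG : (Complex.Gamma (ℓ - t))⁻¹ ≠ 0 := by
    intro h0
    obtain ⟨m, hm, -⟩ := hpole t h0
    exact ht (ℓ + m) (by rw [hm]; push_cast; ring)
  rw [hh' t (mul_ne_zero hG hg)]
  simp only [A, B, C, div_eq_mul_inv, mul_inv, inv_inv]
  ring

/-! ### Sectors and branches of logarithms -/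

/-- A continuous function on a preconnected set whose exponential is constant is constant. -/
theorem eq_of_exp_eq_const {X : Type*} [TopologicalSpace X] {S : Set X} (hS : IsPreconnected S)
    {g : X → ℂ} {c : ℂ} (hg : ContinuousOn g S) (h : ∀ z ∈ S, Complex.exp (g z) = c) {z z' : X}
    (hz : z ∈ S) (hz' : z' ∈ S) : g z = g z' := by
  have hc : (Set.range fun m : ℤ => g z + m * (2 * Real.pi * Complex.I)).Countable :=
    Set.countable_range _
  refine hc.isTotallyDisconnected (g '' S) ?_ (hS.image g hg) ⟨z, hz, rfl⟩ ⟨z', hz', rfl⟩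
  rintro _ ⟨y, hy, rfl⟩
  obtain ⟨m, hm⟩ := Complex.exp_eq_exp_iff_exists_int.1 ((h y hy).trans (h z hz).symm)
  exact ⟨m, hm.symm⟩

theorem continuous_toCircle : Continuous fun θ : Real.Angle => (θ.toCircle : ℂ) := by
  have : Continuous Real.Angle.toCircle :=
    continuous_coinduced_dom.mpr Circle.exp.continuous
  exact continuous_subtype_val.comp this

theorem norm_rayPoint (θ : Real.Angle) {r : ℝ} (hr : 0 < r) : ‖rayPoint θ r‖ = r := by
  rw [rayPoint, norm_mul, Circle.norm_coe, mul_one, Complex.norm_real, Real.norm_of_nonneg hr.le]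

theorem rayPoint_mem_sector {Θ : Set Real.Angle} {θ : Real.Angle} (hθ : θ ∈ Θ) {r : ℝ}
    (hr : 0 < r) : rayPoint θ r ∈ sector Θ := by
  refine ⟨norm_pos_iff.1 (by rwa [norm_rayPoint θ hr]), ?_⟩
  rw [rayPoint, Complex.arg_real_mul _ hr, Real.Angle.arg_toCircle]
  exact hθ

theorem rayPoint_arg_norm (z : ℂ) : rayPoint (Complex.arg z) ‖z‖ = z := by
  rw [rayPoint, Real.Angle.toCircle_coe, Circle.coe_exp, Complex.norm_mul_exp_arg_mul_I]

theorem continuous_rayPoint : Continuous fun q : Real.Angle × ℝ => rayPoint q.1 q.2 := by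
  unfold rayPoint
  exact (Complex.continuous_ofReal.comp continuous_snd).mul
    (continuous_toCircle.comp continuous_fst)

theorem isPreconnected_sector_inter {Θ : Set Real.Angle} (hΘ : IsPreconnected Θ) {I : Set ℝ}
    (hI : IsPreconnected I) (hpos : ∀ r ∈ I, 0 < r) :
    IsPreconnected {z | z ∈ sector Θ ∧ ‖z‖ ∈ I} := by
  have : {z | z ∈ sector Θ ∧ ‖z‖ ∈ I} = (fun q : Real.Angle × ℝ => rayPoint q.1 q.2) '' (Θ ×ˢ I) := by
    ext z
    constructor
    · rintro ⟨hz, hzI⟩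
      exact ⟨(Complex.arg z, ‖z‖), ⟨hz.2, hzI⟩, rayPoint_arg_norm z⟩
    · rintro ⟨⟨θ, r⟩, ⟨hθ, hr⟩, rfl⟩
      refine ⟨rayPoint_mem_sector hθ (hpos r hr), ?_⟩
      rwa [norm_rayPoint θ (hpos r hr)]
  rw [this]
  exact (hΘ.prod hI).image _ continuous_rayPoint.continuousOn

theorem isOpen_sector {Θ : Set Real.Angle} (hΘ : IsOpen Θ) : IsOpen (sector Θ) := by
  rw [isOpen_iff_mem_nhds]
  rintro z ⟨hz, hzΘ⟩
  filter_upwards [isOpen_ne.mem_nhds hz,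
    (Complex.continuousAt_arg_coe_angle hz).preimage_mem_nhds (hΘ.mem_nhds hzΘ)] with y hy hy'
  exact ⟨hy, hy'⟩

/-- The polynomial with value `poly k x z` at `z`. -/
noncomputable def curvePolynomial {n : ℕ} (k : Fin (n + 1) → ℕ) (x : Fin (n + 1) → ℂ) :
    Polynomial ℂ :=
  ∑ i, Polynomial.monomial (k i) (x i)

theorem eval_curvePolynomial {n : ℕ} (k : Fin (n + 1) → ℕ) (x : Fin (n + 1) → ℂ) (z : ℂ) :
    (curvePolynomial k x).eval z = poly k x z := by
  simp [curvePolynomial, poly, Polynomial.eval_finsetSum]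

theorem poly_zero_right {n : ℕ} {w : Fin (n + 1) → ℕ} {b : Fin (n + 1)}
    (hw : ∀ i, w i = 0 ↔ i = b) (x : Fin (n + 1) → ℂ) : poly w x 0 = x b := by
  rw [poly, Finset.sum_eq_single b]
  · simp [(hw b).2 rfl]
  · intro i _ hi
    simp [(hw i).not.2 hi]
  · simp

theorem continuous_poly {n : ℕ} (w : Fin (n + 1) → ℕ) (x : Fin (n + 1) → ℂ) :
    Continuous (poly w x) := by
  unfold poly
  fun_prop

section Component

variable {n : ℕ} {k : Fin (n + 1) → ℕ} {x : Fin (n + 1) → ℂ} {Θ : Set Real.Angle}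

theorem IsCurve.curvePolynomial_ne_zero (hk : IsCurve k) (hx : x ∈ nonzeroEnds n) :
    curvePolynomial k x ≠ 0 := by
  intro h
  have := eval_curvePolynomial k x 0
  rw [h, Polynomial.eval_zero] at this
  exact hx.1 ((poly_zero_right (hk.weight_eq_zero_iff Facet.origin) x).symm.trans this.symm)

theorem IsCurve.natDegree_curvePolynomial_pos (hk : IsCurve k) (hx : x ∈ nonzeroEnds n) :
    0 < (curvePolynomial k x).natDegree := by
  refine hk.degree_pos.trans_le (Polynomial.le_natDegree_of_ne_zero ?_)
  rw [curvePolynomial, Polynomial.finsetSum_coeff, Finset.sum_eq_single (Fin.last n)]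
  · simpa [Polynomial.coeff_monomial, degree] using hx.2
  · intro i _ hi
    rw [Polynomial.coeff_monomial, if_neg]
    exact hk.strictMono.injective.ne hi
  · simp

theorem IsCurve.isClosed_coamoeba (hk : IsCurve k) (hx : x ∈ nonzeroEnds n) :
    IsClosed (coamoeba k x) := by
  refine Set.Finite.isClosed (Set.Finite.image _ ?_)
  refine ((curvePolynomial k x).roots.toFinset.finite_toSet).subset fun z hz => ?_
  simp [hk.curvePolynomial_ne_zero hx, eval_curvePolynomial, hz.2]

theorem IsComponent.isOpen (h : IsComponent k x Θ) (hk : IsCurve k) (hx : x ∈ nonzeroEnds n) :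
    IsOpen Θ := by
  obtain ⟨θ, -, rfl⟩ := h
  have : LocallyConnectedSpace Real.Angle :=
    (isQuotientMap_quotient_mk' (s := QuotientAddGroup.leftRel
      (AddSubgroup.zmultiples (2 * Real.pi)))).isCoinducing.locallyConnectedSpace
  exact (hk.isClosed_coamoeba hx).isOpen_compl.connectedComponentIn

theorem IsComponent.isPreconnected (h : IsComponent k x Θ) : IsPreconnected Θ := by
  obtain ⟨θ, -, rfl⟩ := h
  exact isPreconnected_connectedComponentIn

theorem IsComponent.nonempty (h : IsComponent k x Θ) : Θ.Nonempty := by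
  obtain ⟨θ, hθ, rfl⟩ := h
  exact ⟨θ, mem_connectedComponentIn hθ⟩

theorem IsComponent.disjoint (h : IsComponent k x Θ) {z ζ : ℂ} (hz : z ∈ sector Θ) (hζ : ζ ≠ 0)
    (hζ' : poly k x ζ = 0) : (Complex.arg z : Real.Angle) ≠ Complex.arg ζ := by
  obtain ⟨θ, -, rfl⟩ := h
  intro he
  exact connectedComponentIn_subset _ _ hz.2 ⟨ζ, ⟨hζ, hζ'⟩, he.symm⟩

/-- If a continuous logarithm of `F` is defined on a connected set on which `F` is close to its
limit `c`, then it converges to a logarithm of `c`. -/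
theorem exists_tendsto_log {S : Set ℂ} (hS : IsPreconnected S) (hne : S.Nonempty) {l : Filter ℂ}
    (hSl : S ∈ l) {g F : ℂ → ℂ} {c : ℂ} (hc : c ≠ 0) (hg : ContinuousOn g S)
    (hgF : ∀ z ∈ S, Complex.exp (g z) = F z) (hF : ∀ z ∈ S, F z / c ∈ Metric.ball (1 : ℂ) 1)
    (hlim : Tendsto F l (𝓝 c)) : ∃ v, Complex.exp v = c ∧ Tendsto g l (𝓝 v) := by
  obtain ⟨z₀, hz₀⟩ := hne
  have hslit : ∀ z ∈ S, F z / c ∈ Complex.slitPlane := fun z hz =>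
    Complex.ball_one_subset_slitPlane (hF z hz)
  have hFc : ContinuousOn F S := hg.cexp.congr fun z hz => (hgF z hz).symm
  have hu : ContinuousOn (fun z => g z - Complex.log (F z / c)) S :=
    hg.sub ((hFc.div_const c).clog hslit)
  have hexp : ∀ z ∈ S, Complex.exp (g z - Complex.log (F z / c)) = c := by
    intro z hz
    rw [Complex.exp_sub, Complex.exp_log (Complex.slitPlane_ne_zero (hslit z hz)), hgF z hz]
    have : F z ≠ 0 := hgF z hz ▸ Complex.exp_ne_zero _
    field_simp
  refine ⟨g z₀ - Complex.log (F z₀ / c), hexp z₀ hz₀, ?_⟩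
  have h1 : Tendsto (fun z => g z₀ - Complex.log (F z₀ / c) + Complex.log (F z / c)) l
      (𝓝 (g z₀ - Complex.log (F z₀ / c) + Complex.log 1)) := by
    refine tendsto_const_nhds.add (Tendsto.clog ?_ Complex.one_mem_slitPlane)
    simpa [hc] using hlim.div_const c
  rw [Complex.log_one, add_zero] at h1
  refine h1.congr' ?_
  filter_upwards [hSl] with z hz
  have := eq_of_exp_eq_const hS hu hexp hz hz₀
  rw [← this]
  ring

/-- In the coordinate 1/z at infinity, f(z)/z^degree is the polynomial with the opposite weights.
This lets both facets be treated alike. -/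
theorem IsCurve.poly_div_pow (hk : IsCurve k) {z : ℂ} (hz : z ≠ 0) :
    poly k x z / z ^ degree k = poly (Facet.infinity.weight k) x z⁻¹ := by
  rw [poly, poly, Finset.sum_div]
  refine Finset.sum_congr rfl fun i _ => ?_
  have h : z ^ degree k = z ^ k i * z ^ (Facet.infinity.weight k i) := by
    rw [← pow_add, ← hk.weight_add_weight_opp Facet.origin i]
    rfl
  rw [h, inv_pow]
  have h1 := pow_ne_zero (k i) hz
  field_simp

variable {lz lf : ℂ → ℂ}

theorem IsBranch.exp_sub_mul (hb : IsBranch k x Θ lz lf) (hk : IsCurve k) {z : ℂ}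
    (hz : z ∈ sector Θ) :
    Complex.exp (lf z - degree k * lz z) = poly (Facet.infinity.weight k) x z⁻¹ := by
  rw [Complex.exp_sub, hb.exp_f z hz, Complex.exp_nat_mul, hb.exp_z z hz, hk.poly_div_pow hz.1]

/-- Near the vertex, f (divided by z^degree at infinity) is close to x_b. The part of the sector
near that end is connected, so the branch differs there from the principal logarithm of the quotient
by a constant. -/
theorem IsBranch.exists_vertexLog (hb : IsBranch k x Θ lz lf) (hk : IsCurve k)
    (hx : x ∈ nonzeroEnds n) (hΘ : IsComponent k x Θ) (F : Facet) :
    ∃ v, Complex.exp v = x F.vertex ∧ IsVertexLog k Θ lz lf v F := by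
  have hc : x F.vertex ≠ 0 := by cases F; exacts [hx.1, hx.2]
  have hlim : Tendsto (poly (F.weight k) x) (𝓝 0) (𝓝 (x F.vertex)) := by
    have := (continuous_poly (F.weight k) x).tendsto 0
    rwa [poly_zero_right (hk.weight_eq_zero_iff F)] at this
  have hball : ∀ᶠ z in 𝓝 (0 : ℂ), poly (F.weight k) x z / x F.vertex ∈ Metric.ball (1 : ℂ) 1 := by
    have h1 := hlim.div_const (x F.vertex)
    rw [div_self hc] at h1
    exact h1.eventually (Metric.ball_mem_nhds 1 one_pos)
  obtain ⟨ε, hε, hball⟩ := Metric.eventually_nhds_iff.1 hball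
  simp only [dist_zero_right] at hball
  obtain ⟨θ, hθ⟩ := hΘ.nonempty
  cases F with
  | origin =>
    refine exists_tendsto_log
      (isPreconnected_sector_inter hΘ.isPreconnected (isPreconnected_Ioo (a := 0) (b := ε))
        fun r hr => hr.1) ⟨rayPoint θ (ε / 2), rayPoint_mem_sector hθ (half_pos hε), ?_⟩ ?_ hc
      (hb.continuousOn_f.mono fun z hz => hz.1) (fun z hz => hb.exp_f z hz.1)
      (fun z hz => hball hz.2.2) (hlim.mono_left nhdsWithin_le_nhds)
    · rw [norm_rayPoint θ (half_pos hε)]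
      exact ⟨half_pos hε, half_lt_self hε⟩
    · filter_upwards [self_mem_nhdsWithin, mem_nhdsWithin_of_mem_nhds
        (Metric.ball_mem_nhds (0 : ℂ) hε)] with z hz hz'
      exact ⟨hz, norm_pos_iff.2 hz.1, by simpa using hz'⟩
  | infinity =>
    have hε' : 0 < ε⁻¹ := inv_pos.2 hε
    refine exists_tendsto_log (F := fun z => poly (Facet.infinity.weight k) x z⁻¹)
      (isPreconnected_sector_inter hΘ.isPreconnected (isPreconnected_Ioi (a := ε⁻¹))
        fun r hr => hε'.trans hr) ⟨rayPoint θ (ε⁻¹ + 1), rayPoint_mem_sector hθ (by positivity), ?_⟩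
      ?_ hc ((hb.continuousOn_f.sub (continuousOn_const.mul hb.continuousOn_z)).mono
        fun z hz => hz.1) (fun z hz => hb.exp_sub_mul hk hz.1)
      (fun z hz => hball ?_) ((hlim.comp tendsto_inv₀_cobounded).mono_left inf_le_left)
    · rw [norm_rayPoint θ (by positivity)]
      exact lt_add_one ε⁻¹
    · filter_upwards [mem_inf_of_right (mem_principal_self _), mem_inf_of_left
        (Bornology.isBounded_def.1 (Metric.isBounded_closedBall (x := (0 : ℂ)) (r := ε⁻¹)))]
        with z hz hz'
      exact ⟨hz, by simpa using hz'⟩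
    · rw [norm_inv]
      exact inv_lt_of_inv_lt₀ hε hz.2

/-- The complement of the ray through `ζ` is a domain of a logarithm of `z`, and `1 - z / ζ`
stays in the slit plane there. -/
theorem neg_div_mem_slitPlane {z ζ : ℂ} (hz : z ≠ 0) (hζ : ζ ≠ 0)
    (h : (Complex.arg z : Real.Angle) ≠ Complex.arg ζ) : -(z / ζ) ∈ Complex.slitPlane := by
  by_contra hcon
  rw [Complex.mem_slitPlane_iff] at hcon
  push Not at hcon
  simp only [Complex.neg_re, Complex.neg_im, neg_eq_zero] at hcon
  apply h
  have hre : 0 < (z / ζ).re := by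
    rcases (neg_nonpos.1 hcon.1).lt_or_eq with h1 | h1
    · exact h1
    · exact absurd (Complex.ext h1.symm hcon.2) (div_ne_zero hz hζ)
  have h2 : z = ((z / ζ).re : ℂ) * ζ := by
    have : z / ζ = ((z / ζ).re : ℂ) := Complex.ext (by simp) (by simp [hcon.2])
    rw [← this]
    field_simp
  rw [h2, Complex.arg_real_mul _ hre]

theorem one_sub_div_mem_slitPlane {z ζ : ℂ} (hz : z ≠ 0) (hζ : ζ ≠ 0)
    (h : (Complex.arg z : Real.Angle) ≠ Complex.arg ζ) : 1 - z / ζ ∈ Complex.slitPlane := by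
  have h1 := neg_div_mem_slitPlane hz hζ h
  rw [Complex.mem_slitPlane_iff] at h1 ⊢
  rcases h1 with h1 | h1
  · left
    simp only [Complex.neg_re, Complex.sub_re, Complex.one_re] at h1 ⊢
    linarith
  · right
    simpa using h1

/-- Factor f(z) as x_0 ∏ (1 - z/ζ) over its roots. On the sector z/ζ is never positive real, so each
1 - z/ζ has a principal logarithm, and the sum of these is a branch of log f. A branch of log z
comes from log(-z/ζ₀), which needs one root ζ₀. It exists since the degree is positive. -/
theorem exists_isBranch (hk : IsCurve k) (hx : x ∈ nonzeroEnds n) (hΘ : IsComponent k x Θ) :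
    ∃ lz lf, IsBranch k x Θ lz lf := by
  set p := curvePolynomial k x with hp
  have hp0 := hk.curvePolynomial_ne_zero hx
  have heval0 : p.eval 0 = x 0 := by
    rw [eval_curvePolynomial]
    exact poly_zero_right (hk.weight_eq_zero_iff Facet.origin) x
  have hroot : ∀ ζ ∈ p.roots, ζ ≠ 0 ∧ poly k x ζ = 0 := by
    intro ζ hζ
    have h1 : p.eval ζ = 0 := (Polynomial.mem_roots'.1 hζ).2
    refine ⟨?_, eval_curvePolynomial k x ζ ▸ h1⟩
    rintro rfl
    exact hx.1 (heval0 ▸ h1)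
  have hsplit := IsAlgClosed.splits p
  have hprod : ∀ z, p.eval z = p.leadingCoeff * (p.roots.map fun ζ => z - ζ).prod :=
    fun z => hsplit.eval_eq_prod_roots z
  obtain ⟨ζ₀, hζ₀⟩ : ∃ ζ, ζ ∈ p.roots := by
    obtain ⟨ζ, hζ⟩ := IsAlgClosed.exists_root p
      (Polynomial.natDegree_pos_iff_degree_pos.1 (hk.natDegree_curvePolynomial_pos hx)).ne'
    exact ⟨ζ, (Polynomial.mem_roots hp0).2 hζ⟩
  have hpoly : ∀ z, poly k x z = x 0 * (p.roots.map fun ζ => 1 - z / ζ).prod := by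
    intro z
    rw [← eval_curvePolynomial, ← hp, hprod, ← heval0, hprod, mul_assoc, ← Multiset.prod_map_mul]
    congr 2
    refine Multiset.map_congr rfl fun ζ hζ => ?_
    have := (hroot ζ hζ).1
    field_simp
    ring
  have hslit : ∀ ζ ∈ p.roots, ∀ z ∈ sector Θ, 1 - z / ζ ∈ Complex.slitPlane := fun ζ hζ z hz =>
    one_sub_div_mem_slitPlane hz.1 (hroot ζ hζ).1
      (hΘ.disjoint hz (hroot ζ hζ).1 (hroot ζ hζ).2)
  refine ⟨fun z => Complex.log (-(z / ζ₀)) + Complex.log (-ζ₀),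
    fun z => Complex.log (x 0) + (p.roots.map fun ζ => Complex.log (1 - z / ζ)).sum, ?_, ?_, ?_, ?_⟩
  · refine ContinuousOn.add (ContinuousOn.clog (by fun_prop) fun z hz => ?_) continuousOn_const
    exact neg_div_mem_slitPlane hz.1 (hroot ζ₀ hζ₀).1
      (hΘ.disjoint hz (hroot ζ₀ hζ₀).1 (hroot ζ₀ hζ₀).2)
  · intro z hz
    have h0 := (hroot ζ₀ hζ₀).1
    rw [Complex.exp_add, Complex.exp_log (neg_ne_zero.2 (div_ne_zero hz.1 h0)),
      Complex.exp_log (neg_ne_zero.2 h0)]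
    field_simp
  · refine continuousOn_const.add ?_
    have : ∀ m : Multiset ℂ, (∀ ζ ∈ m, ζ ∈ p.roots) →
        ContinuousOn (fun z => (m.map fun ζ => Complex.log (1 - z / ζ)).sum) (sector Θ) := by
      intro m
      induction m using Multiset.induction_on with
      | empty => intro _; simpa using continuousOn_const
      | cons ζ m ih =>
        intro hm
        simp only [Multiset.map_cons, Multiset.sum_cons]
        refine ContinuousOn.add (ContinuousOn.clog (by fun_prop)
          (hslit ζ (hm ζ (Multiset.mem_cons_self ζ m)))) (ih fun ζ' h' =>
            hm ζ' (Multiset.mem_cons_of_mem h'))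
    exact this _ fun ζ h => h
  · intro z hz
    rw [Complex.exp_add, Complex.exp_log hx.1, hpoly, Complex.exp_multiset_sum, Multiset.map_map]
    congr 2
    refine Multiset.map_congr rfl fun ζ hζ => ?_
    exact Complex.exp_log (Complex.slitPlane_ne_zero (hslit ζ hζ z hz))

theorem exists_isBranch_isVertexLog (hk : IsCurve k) (hx : x ∈ nonzeroEnds n)
    (hΘ : IsComponent k x Θ) (F : Facet) {v : ℂ} (hv : Complex.exp v = x F.vertex) :
    ∃ lz lf, IsBranch k x Θ lz lf ∧ IsVertexLog k Θ lz lf v F := by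
  obtain ⟨lz, lf, hb⟩ := exists_isBranch hk hx hΘ
  obtain ⟨v', hv', hlim⟩ := hb.exists_vertexLog hk hx hΘ F
  have h1 : Complex.exp (v - v') = 1 := by
    rw [Complex.exp_sub, hv, hv', div_self (hv ▸ Complex.exp_ne_zero v)]
  -- Two logarithms of the same coefficient differ by a multiple of 2πi, and adding it to `lf` gives
  -- another branch.
  refine ⟨lz, fun z => lf z + (v - v'), ⟨hb.continuousOn_z, hb.exp_z,
    hb.continuousOn_f.add continuousOn_const, fun z hz => ?_⟩, ?_⟩
  · rw [Complex.exp_add, h1, mul_one, hb.exp_f z hz]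
  · cases F with
    | origin =>
      have := Tendsto.add_const (v - v') hlim
      rwa [add_sub_cancel] at this
    | infinity =>
      have := Tendsto.add_const (v - v') hlim
      rw [add_sub_cancel] at this
      exact this.congr fun z => by ring

end Component

/-! ### Convergence of Euler–Mellin integrals -/

/-- The function `f(z) ^ β₁ * z ^ (-β₂)`. -/
noncomputable def powerKernel (lz lf : ℂ → ℂ) (β : ℂ × ℂ) (z : ℂ) : ℂ :=
  Complex.exp (β.1 * lf z - β.2 * lz z)

theorem integrand_eq (lz lf : ℂ → ℂ) (θ : Real.Angle) (β : ℂ × ℂ) (r : ℝ) :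
    integrand lz lf θ β r = powerKernel lz lf β (rayPoint θ r) / r := rfl

/-- A bound on the ray of argument `θ` for the distance of the branches to their leading terms. -/
structure RayBound {n : ℕ} (k : Fin (n + 1) → ℕ) (lz lf : ℂ → ℂ) (θ : Real.Angle) (C : ℝ) :
    Prop where
  norm_lz : ∀ r : ℝ, 0 < r → ‖lz (rayPoint θ r) - Real.log r‖ ≤ C
  norm_lf : ∀ r : ℝ, 0 < r → r ≤ 1 → ‖lf (rayPoint θ r)‖ ≤ C
  norm_lf_sub : ∀ r : ℝ, 1 ≤ r → ‖lf (rayPoint θ r) - degree k * lz (rayPoint θ r)‖ ≤ C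

section Bounds

variable {n : ℕ} {k : Fin (n + 1) → ℕ} {x : Fin (n + 1) → ℂ} {Θ : Set Real.Angle} {lz lf : ℂ → ℂ}

theorem IsBranch.lz_rayPoint (hb : IsBranch k x Θ lz lf) {θ : Real.Angle} (hθ : θ ∈ Θ) {r : ℝ}
    (hr : 0 < r) : lz (rayPoint θ r) - Real.log r = lz (rayPoint θ 1) := by
  have hmaps : Set.MapsTo (rayPoint θ) (Set.Ioi 0) (sector Θ) := fun r hr =>
    rayPoint_mem_sector hθ hr
  have hcont : ContinuousOn (fun r : ℝ => lz (rayPoint θ r) - Real.log r) (Set.Ioi 0) := by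
    refine ContinuousOn.sub (hb.continuousOn_z.comp ?_ hmaps) ?_
    · exact (continuous_rayPoint.comp (Continuous.prodMk_right θ)).continuousOn
    · exact Complex.continuous_ofReal.comp_continuousOn
        (Real.continuousOn_log.mono fun r hr => ne_of_gt hr)
  have hexp : ∀ r ∈ Set.Ioi (0 : ℝ),
      Complex.exp (lz (rayPoint θ r) - Real.log r) = θ.toCircle := by
    intro r hr
    have hr' : (r : ℂ) ≠ 0 := Complex.ofReal_ne_zero.2 (ne_of_gt hr)
    rw [Complex.exp_sub, hb.exp_z _ (hmaps hr), ← Complex.ofReal_exp, Real.exp_log hr, rayPoint]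
    field_simp
  have := eq_of_exp_eq_const isPreconnected_Ioi hcont hexp (z := r) (z' := 1) hr
    (Set.mem_Ioi.2 one_pos)
  simpa using this

/-- The ends of the rays are controlled by the limits at the two vertices, the middle by
compactness. Uniformity over compact sets of arguments is needed for differentiating in the argument
of the ray. -/
theorem IsBranch.exists_rayBound (hb : IsBranch k x Θ lz lf) (hk : IsCurve k)
    (hx : x ∈ nonzeroEnds n) (hΘ : IsComponent k x Θ) {K : Set Real.Angle} (hK : IsCompact K)
    (hKΘ : K ⊆ Θ) : ∃ C, ∀ θ ∈ K, RayBound k lz lf θ C := by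
  obtain ⟨v₀, -, h₀⟩ := hb.exists_vertexLog hk hx hΘ Facet.origin
  obtain ⟨v₁, -, h₁⟩ := hb.exists_vertexLog hk hx hΘ Facet.infinity
  have e₀ := Tendsto.eventually h₀ (Metric.ball_mem_nhds v₀ one_pos)
  have e₁ := Tendsto.eventually h₁ (Metric.ball_mem_nhds v₁ one_pos)
  rw [eventually_nhdsWithin_iff, Metric.eventually_nhds_iff] at e₀
  obtain ⟨ε, hε, e₀⟩ := e₀
  rw [eventually_inf_principal] at e₁
  obtain ⟨R, -, e₁⟩ := (Metric.hasBasis_cobounded_compl_closedBall (0 : ℂ)).eventually_iff.1 e₁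
  have hcomp : ∀ (a c : ℝ), 0 < a → ∀ g : ℂ → ℂ, ContinuousOn g (sector Θ) →
      ∃ C, ∀ θ ∈ K, ∀ r ∈ Set.Icc a c, ‖g (rayPoint θ r)‖ ≤ C := by
    intro a c ha g hg
    have hmaps : Set.MapsTo (fun q : Real.Angle × ℝ => rayPoint q.1 q.2) (K ×ˢ Set.Icc a c)
        (sector Θ) := fun q hq => rayPoint_mem_sector (hKΘ hq.1) (ha.trans_le hq.2.1)
    obtain ⟨C, hC⟩ := (hK.prod isCompact_Icc).exists_bound_of_continuousOn
      (hg.comp continuous_rayPoint.continuousOn hmaps)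
    exact ⟨C, fun θ hθ r hr => hC (θ, r) ⟨hθ, hr⟩⟩
  obtain ⟨C₁, hC₁⟩ := hcomp 1 1 one_pos lz hb.continuousOn_z
  obtain ⟨C₂, hC₂⟩ := hcomp ε 1 hε lf hb.continuousOn_f
  obtain ⟨C₃, hC₃⟩ := hcomp 1 R one_pos (fun z => lf z - degree k * lz z)
    (hb.continuousOn_f.sub (continuousOn_const.mul hb.continuousOn_z))
  have hball : ∀ v y : ℂ, y ∈ Metric.ball v 1 → ‖y‖ ≤ ‖v‖ + 1 := by
    intro v y hy
    rw [mem_ball_iff_norm] at hy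
    have := norm_le_norm_add_norm_sub' y v
    linarith
  refine ⟨max (max C₁ C₂) (max C₃ (max (‖v₀‖ + 1) (‖v₁‖ + 1))), fun θ hθ => ⟨?_, ?_, ?_⟩⟩
  · intro r hr
    rw [hb.lz_rayPoint (hKΘ hθ) hr]
    exact (hC₁ θ hθ 1 ⟨le_rfl, le_rfl⟩).trans (by simp)
  · intro r hr hr1
    rcases lt_or_ge r ε with h | h
    · refine (hball v₀ _ (e₀ ?_ (rayPoint_mem_sector (hKΘ hθ) hr))).trans (by simp)
      rwa [dist_zero_right, norm_rayPoint θ hr]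
    · exact (hC₂ θ hθ r ⟨h, hr1⟩).trans (by simp)
  · intro r hr1
    have hr : 0 < r := one_pos.trans_le hr1
    rcases lt_or_ge R r with h | h
    · refine (hball v₁ _ (e₁ ?_ (rayPoint_mem_sector (hKΘ hθ) hr))).trans (by simp)
      simpa [norm_rayPoint θ hr] using h
    · exact (hC₃ θ hθ r ⟨hr1, h⟩).trans (by simp)

/-- The size of a parameter in the estimates for the kernel. -/
noncomputable def paramSize (k : Fin (n + 1) → ℕ) (β : ℂ × ℂ) : ℝ :=
  ‖β.1‖ + ‖β.2‖ + ‖degree k * β.1 - β.2‖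

theorem continuous_paramSize : Continuous (paramSize k) := by
  unfold paramSize
  fun_prop

variable {θ : Real.Angle} {C : ℝ}

theorem RayBound.nonneg (h : RayBound k lz lf θ C) : 0 ≤ C :=
  (norm_nonneg _).trans (h.norm_lz 1 one_pos)

/-- Up to a bounded factor the kernel has absolute value r^(-Re β₂) near 0, and the margin δ bounds
this by r^δ = exp(-δ |log r|). At infinity the infinity form plays the role of β₂, giving the same
bound with |log r|. -/
theorem RayBound.norm_le_origin (h : RayBound k lz lf θ C) {β : ℂ × ℂ} {δ r : ℝ}
    (hβ : (Facet.origin.form k β).re ≤ -δ) (hr : 0 < r) (hr1 : r ≤ 1) :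
    ‖powerKernel lz lf β (rayPoint θ r)‖ ≤
      Real.exp (C * paramSize k β - δ * |Real.log r|) := by
  simp only [Facet.form] at hβ
  have hlog : Real.log r ≤ 0 := Real.log_nonpos hr.le hr1
  rw [powerKernel, Complex.norm_exp, Real.exp_le_exp, abs_of_nonpos hlog]
  have e : β.1 * lf (rayPoint θ r) - β.2 * lz (rayPoint θ r) =
      β.1 * lf (rayPoint θ r) - β.2 * (lz (rayPoint θ r) - Real.log r)
        - (Real.log r : ℂ) * β.2 := by ring
  rw [e, Complex.sub_re, Complex.re_ofReal_mul]
  have h1 : (β.1 * lf (rayPoint θ r) - β.2 * (lz (rayPoint θ r) - Real.log r)).re ≤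
      C * (‖β.1‖ + ‖β.2‖) := by
    refine (Complex.re_le_norm _).trans ((norm_sub_le _ _).trans ?_)
    rw [norm_mul, norm_mul, mul_add, mul_comm C, mul_comm C]
    gcongr
    exacts [h.norm_lf r hr hr1, h.norm_lz r hr]
  have h2 : C * (‖β.1‖ + ‖β.2‖) ≤ C * paramSize k β :=
    mul_le_mul_of_nonneg_left (le_add_of_nonneg_right (norm_nonneg _)) h.nonneg
  nlinarith

theorem RayBound.norm_le_infinity (h : RayBound k lz lf θ C) {β : ℂ × ℂ} {δ r : ℝ}
    (hβ : (Facet.infinity.form k β).re ≤ -δ) (hr1 : 1 ≤ r) :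
    ‖powerKernel lz lf β (rayPoint θ r)‖ ≤
      Real.exp (C * paramSize k β - δ * |Real.log r|) := by
  simp only [Facet.form] at hβ
  have hr : 0 < r := one_pos.trans_le hr1
  have hlog : 0 ≤ Real.log r := Real.log_nonneg hr1
  rw [powerKernel, Complex.norm_exp, Real.exp_le_exp, abs_of_nonneg hlog]
  have e : β.1 * lf (rayPoint θ r) - β.2 * lz (rayPoint θ r) =
      β.1 * (lf (rayPoint θ r) - degree k * lz (rayPoint θ r))
        + (degree k * β.1 - β.2) * (lz (rayPoint θ r) - Real.log r)
        + (Real.log r : ℂ) * (degree k * β.1 - β.2) := by ring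
  rw [e, Complex.add_re, Complex.re_ofReal_mul]
  have h1 : (β.1 * (lf (rayPoint θ r) - degree k * lz (rayPoint θ r))
        + (degree k * β.1 - β.2) * (lz (rayPoint θ r) - Real.log r)).re ≤
      C * (‖β.1‖ + ‖degree k * β.1 - β.2‖) := by
    refine (Complex.re_le_norm _).trans ((norm_add_le _ _).trans ?_)
    rw [norm_mul, norm_mul, mul_add, mul_comm C, mul_comm C]
    gcongr
    exacts [h.norm_lf_sub r hr1, h.norm_lz r hr]
  have h2 : C * (‖β.1‖ + ‖degree k * β.1 - β.2‖) ≤ C * paramSize k β := by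
    refine mul_le_mul_of_nonneg_left ?_ h.nonneg
    unfold paramSize
    linarith [norm_nonneg β.2]
  nlinarith

theorem RayBound.norm_le (h : RayBound k lz lf θ C) {β : ℂ × ℂ} {δ r : ℝ}
    (hβ : ∀ F : Facet, (F.form k β).re ≤ -δ) (hr : 0 < r) :
    ‖powerKernel lz lf β (rayPoint θ r)‖ ≤
      Real.exp (C * paramSize k β - δ * |Real.log r|) := by
  rcases le_total r 1 with h1 | h1
  · exact h.norm_le_origin (hβ _) hr h1
  · exact h.norm_le_infinity (hβ _) h1

theorem integrableOn_exp_neg_mul_abs_log {δ : ℝ} (hδ : 0 < δ) :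
    IntegrableOn (fun r : ℝ => Real.exp (-δ * |Real.log r|) / r) (Set.Ioi 0) := by
  rw [← Set.Ioc_union_Ioi_eq_Ioi (zero_le_one' ℝ)]
  refine IntegrableOn.union ?_ ?_
  · have h1 : IntegrableOn (fun r : ℝ => r ^ (δ - 1)) (Set.Ioc 0 1) := by
      rw [← intervalIntegrable_iff_integrableOn_Ioc_of_le zero_le_one]
      exact intervalIntegral.intervalIntegrable_rpow' (by linarith)
    refine h1.congr_fun (fun r hr => ?_) measurableSet_Ioc
    dsimp only
    rw [abs_of_nonpos (Real.log_nonpos hr.1.le hr.2), Real.rpow_sub_one hr.1.ne',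
      Real.rpow_def_of_pos hr.1]
    ring_nf
  · have h1 : IntegrableOn (fun r : ℝ => r ^ (-δ - 1)) (Set.Ioi 1) :=
      integrableOn_Ioi_rpow_of_lt (by linarith) one_pos
    refine h1.congr_fun (fun r hr => ?_) measurableSet_Ioi
    have hr0 : 0 < r := one_pos.trans hr
    dsimp only
    rw [abs_of_nonneg (Real.log_nonneg (le_of_lt hr)), Real.rpow_sub_one hr0.ne',
      Real.rpow_def_of_pos hr0]
    ring_nf

theorem IsBranch.continuousOn_powerKernel (hb : IsBranch k x Θ lz lf) (β : ℂ × ℂ) :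
    ContinuousOn (powerKernel lz lf β) (sector Θ) :=
  ((continuousOn_const.mul hb.continuousOn_f).sub
    (continuousOn_const.mul hb.continuousOn_z)).cexp

theorem continuousOn_comp_rayPoint {g : ℂ → ℂ} (hg : ContinuousOn g (sector Θ)) (hθ : θ ∈ Θ) :
    ContinuousOn (fun r => g (rayPoint θ r)) (Set.Ioi 0) :=
  hg.comp (continuous_rayPoint.comp (Continuous.prodMk_right θ)).continuousOn
    fun _ hr => rayPoint_mem_sector hθ hr

theorem continuousOn_comp_rayPoint_div {g : ℂ → ℂ} (hg : ContinuousOn g (sector Θ))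
    (hθ : θ ∈ Θ) : ContinuousOn (fun r : ℝ => g (rayPoint θ r) / r) (Set.Ioi 0) :=
  (continuousOn_comp_rayPoint hg hθ).div Complex.continuous_ofReal.continuousOn
    fun _ hr => Complex.ofReal_ne_zero.2 (ne_of_gt hr)

theorem IsBranch.aestronglyMeasurable_integrand (hb : IsBranch k x Θ lz lf) (hθ : θ ∈ Θ)
    (β : ℂ × ℂ) :
    AEStronglyMeasurable (integrand lz lf θ β) (volume.restrict (Set.Ioi 0)) :=
  (continuousOn_comp_rayPoint_div (hb.continuousOn_powerKernel β) hθ).aestronglyMeasurable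
    measurableSet_Ioi

theorem RayBound.norm_integrand_le (h : RayBound k lz lf θ C) {β : ℂ × ℂ} {δ r B : ℝ}
    (hβ : ∀ F : Facet, (F.form k β).re ≤ -δ) (hB : paramSize k β ≤ B) (hr : 0 < r) :
    ‖integrand lz lf θ β r‖ ≤ Real.exp (C * B) * (Real.exp (-δ * |Real.log r|) / r) := by
  rw [integrand_eq, norm_div, Complex.norm_real, Real.norm_of_nonneg hr.le, mul_div_assoc',
    ← Real.exp_add]
  gcongr
  refine (h.norm_le hβ hr).trans (Real.exp_le_exp.2 ?_)
  have := mul_le_mul_of_nonneg_left hB h.nonneg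
  linarith

theorem exists_margin {β : ℂ × ℂ} (hβ : β ∈ convergenceDomain k) :
    ∃ δ : ℝ, 0 < δ ∧ ∀ F : Facet, (F.form k β).re < -δ := by
  have h0 := hβ Facet.origin
  have h1 := hβ Facet.infinity
  refine ⟨min (-(Facet.origin.form k β).re) (-(Facet.infinity.form k β).re) / 2,
    half_pos (lt_min (by linarith) (by linarith)), fun F => ?_⟩
  have m0 := min_le_left (-(Facet.origin.form k β).re) (-(Facet.infinity.form k β).re)
  have m1 := min_le_right (-(Facet.origin.form k β).re) (-(Facet.infinity.form k β).re)
  cases F <;> linarith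

theorem IsBranch.integrableOn_integrand (hb : IsBranch k x Θ lz lf) (hθ : θ ∈ Θ)
    (h : RayBound k lz lf θ C) {β : ℂ × ℂ} (hβ : β ∈ convergenceDomain k) :
    IntegrableOn (integrand lz lf θ β) (Set.Ioi 0) := by
  obtain ⟨δ, hδ, hβδ⟩ := exists_margin hβ
  refine Integrable.mono' ((integrableOn_exp_neg_mul_abs_log hδ).const_mul
    (Real.exp (C * paramSize k β))) (hb.aestronglyMeasurable_integrand hθ β) ?_
  filter_upwards [ae_restrict_mem measurableSet_Ioi] with r hr
  exact h.norm_integrand_le (fun F => (hβδ F).le) le_rfl hr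

/-- Differentiating the kernel in β brings down a factor of size 1 + |log r|. Half of the
exponential decay absorbs it. -/
theorem one_add_mul_exp_neg_le {δ y : ℝ} (hδ : 0 < δ) (hy : 0 ≤ y) :
    (1 + y) * Real.exp (-δ * y) ≤ (1 + 2 / δ) * Real.exp (-(δ / 2) * y) := by
  have e : Real.exp (-δ * y) = Real.exp (-(δ / 2) * y) * Real.exp (-(δ / 2) * y) := by
    rw [← Real.exp_add]
    ring_nf
  have h1 : (1 + y) * Real.exp (-(δ / 2) * y) ≤ 1 + 2 / δ := by
    have h2 : δ / 2 * y ≤ Real.exp (δ / 2 * y) := by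
      linarith [Real.add_one_le_exp (δ / 2 * y)]
    have h3 : y ≤ 2 / δ * Real.exp (δ / 2 * y) := by
      have := mul_le_mul_of_nonneg_left h2 (by positivity : (0 : ℝ) ≤ 2 / δ)
      have e2 : 2 / δ * (δ / 2 * y) = y := by field_simp
      linarith
    have h4 : (1 : ℝ) ≤ Real.exp (δ / 2 * y) := Real.one_le_exp (by positivity)
    have h5 : 1 + y ≤ (1 + 2 / δ) * Real.exp (δ / 2 * y) := by linarith
    calc (1 + y) * Real.exp (-(δ / 2) * y)
        ≤ (1 + 2 / δ) * Real.exp (δ / 2 * y) * Real.exp (-(δ / 2) * y) := by gcongr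
      _ = 1 + 2 / δ := by
        rw [mul_assoc, ← Real.exp_add, neg_mul, add_neg_cancel, Real.exp_zero, mul_one]
  rw [e, ← mul_assoc]
  gcongr

/-- Differentiation under the integral sign, dominated on a neighbourhood where the margin δ and the
parameter size are uniform. The derivative of the integrand in β is itself times the linear form `A
r` with entries log f and -log z. -/
theorem IsBranch.differentiableAt_eulerMellin (hb : IsBranch k x Θ lz lf) (hθ : θ ∈ Θ)
    (h : RayBound k lz lf θ C) {β₀ : ℂ × ℂ} (hβ₀ : β₀ ∈ convergenceDomain k) :
    DifferentiableAt ℂ (eulerMellin lz lf θ) β₀ := by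
  obtain ⟨δ, hδ, hβδ⟩ := exists_margin hβ₀
  have hC := h.nonneg
  set B := paramSize k β₀ + 1
  set s : Set (ℂ × ℂ) := {β | (Facet.origin.form k β).re < -δ ∧
    (Facet.infinity.form k β).re < -δ ∧ paramSize k β < B} with hs
  have hsopen : IsOpen s := by
    have hre : ∀ F : Facet, Continuous fun β => (F.form k β).re := fun F =>
      Complex.continuous_re.comp F.differentiable_form.continuous
    exact (isOpen_lt (hre _) continuous_const).inter ((isOpen_lt (hre _) continuous_const).inter
      (isOpen_lt continuous_paramSize continuous_const))
  have hsβ : ∀ β ∈ s, ∀ F : Facet, (F.form k β).re ≤ -δ := by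
    rintro β ⟨h0, h1, -⟩ F
    cases F
    exacts [h0.le, h1.le]
  set a : ℝ → ℂ := fun r => lf (rayPoint θ r)
  set b : ℝ → ℂ := fun r => lz (rayPoint θ r)
  let A : ℝ → (ℂ × ℂ →L[ℂ] ℂ) := fun r =>
    a r • ContinuousLinearMap.fst ℂ ℂ ℂ - b r • ContinuousLinearMap.snd ℂ ℂ ℂ
  set D : ℝ := (degree k + 2) * (C + 1)
  have hA : ∀ r : ℝ, 0 < r → ‖A r‖ ≤ D * (1 + |Real.log r|) := by
    intro r hr
    have hb' : ‖b r‖ ≤ C + |Real.log r| := by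
      have e : b r = (b r - Real.log r) + Real.log r := by ring
      rw [e]
      refine (norm_add_le _ _).trans (add_le_add (h.norm_lz r hr) ?_)
      rw [Complex.norm_real, Real.norm_eq_abs]
    have ha' : ‖a r‖ ≤ C + degree k * (C + |Real.log r|) := by
      rcases le_total r 1 with h1 | h1
      · have := h.norm_lf r hr h1
        have : (0 : ℝ) ≤ degree k * (C + |Real.log r|) := by positivity
        linarith
      · have e : a r = (a r - degree k * b r) + degree k * b r := by ring
        rw [e]
        refine (norm_add_le _ _).trans (add_le_add (h.norm_lf_sub r h1) ?_)
        rw [norm_mul, Complex.norm_natCast]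
        gcongr
    have h1 : ‖A r‖ ≤ ‖a r‖ + ‖b r‖ := by
      refine (norm_sub_le _ _).trans ?_
      rw [norm_smul, norm_smul]
      gcongr
      · exact mul_le_of_le_one_right (norm_nonneg _) (ContinuousLinearMap.norm_fst_le ℂ ℂ ℂ)
      · exact mul_le_of_le_one_right (norm_nonneg _) (ContinuousLinearMap.norm_snd_le ℂ ℂ ℂ)
    have h2 : C + |Real.log r| ≤ (C + 1) * (1 + |Real.log r|) := by
      nlinarith [abs_nonneg (Real.log r), mul_nonneg hC (abs_nonneg (Real.log r))]
    have h3 : C ≤ (C + 1) * (1 + |Real.log r|) := by linarith [abs_nonneg (Real.log r)]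
    have h4 := mul_le_mul_of_nonneg_left h2 (Nat.cast_nonneg (α := ℝ) (degree k))
    calc ‖A r‖ ≤ C + degree k * (C + |Real.log r|) + (C + |Real.log r|) := by linarith
      _ ≤ D * (1 + |Real.log r|) := by simp only [D]; linarith
  have hexp : ∀ r β, HasFDerivAt (fun β => integrand lz lf θ β r)
      (integrand lz lf θ β r • A r) β := by
    intro r β
    have h1 : HasFDerivAt (fun β : ℂ × ℂ => β.1 * a r - β.2 * b r) (A r) β :=
      (hasFDerivAt_fst.mul_const (a r)).sub (hasFDerivAt_snd.mul_const (b r))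
    have h2 := h1.cexp.mul_const ((r : ℂ)⁻¹)
    have e : integrand lz lf θ β r • A r = (r : ℂ)⁻¹ • Complex.exp (β.1 * a r - β.2 * b r) • A r := by
      rw [smul_smul, integrand, div_eq_inv_mul]
    rw [e]
    exact h2
  refine (hasFDerivAt_integral_of_dominated_of_fderiv_le (𝕜 := ℂ)
    (μ := volume.restrict (Set.Ioi 0)) (F := fun β r => integrand lz lf θ β r)
    (F' := fun β r => integrand lz lf θ β r • A r) (s := s)
    (bound := fun r => Real.exp (C * B) * D * (1 + 2 / δ) *
      (Real.exp (-(δ / 2) * |Real.log r|) / r)) ?_ ?_ ?_ ?_ ?_ ?_ ?_).differentiableAt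
  · exact hsopen.mem_nhds ⟨hβδ _, hβδ _, lt_add_one _⟩
  · exact Eventually.of_forall fun β => hb.aestronglyMeasurable_integrand hθ β
  · exact hb.integrableOn_integrand hθ h hβ₀
  · refine (hb.aestronglyMeasurable_integrand hθ β₀).smul
      (ContinuousOn.aestronglyMeasurable ?_ measurableSet_Ioi)
    exact ((continuousOn_comp_rayPoint hb.continuousOn_f hθ).smul continuousOn_const).sub
      ((continuousOn_comp_rayPoint hb.continuousOn_z hθ).smul continuousOn_const)
  · filter_upwards [ae_restrict_mem measurableSet_Ioi] with r hr β hβ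
    have hr : 0 < r := hr
    rw [norm_smul]
    have h1 := h.norm_integrand_le (hsβ β hβ) hβ.2.2.le hr
    have h2 := one_add_mul_exp_neg_le hδ (abs_nonneg (Real.log r))
    have hD : 0 ≤ D := by positivity
    calc ‖integrand lz lf θ β r‖ * ‖A r‖
        ≤ Real.exp (C * B) * (Real.exp (-δ * |Real.log r|) / r) * (D * (1 + |Real.log r|)) := by
          gcongr
          exact hA r hr
      _ = Real.exp (C * B) * D * ((1 + |Real.log r|) * Real.exp (-δ * |Real.log r|)) / r := by ring
      _ ≤ Real.exp (C * B) * D * ((1 + 2 / δ) * Real.exp (-(δ / 2) * |Real.log r|)) / r := by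
          gcongr
      _ = _ := by ring
  · exact (integrableOn_exp_neg_mul_abs_log (half_pos hδ)).const_mul _
  · exact Eventually.of_forall fun r β _ => hexp r β

end Bounds

/-! ### Integration by parts and rotation of the ray -/

/-- The sign with which integration by parts enters for the given facet. -/
def Facet.sign : Facet → ℂ
  | .origin => 1
  | .infinity => -1

theorem Facet.sign_ne_zero (F : Facet) : F.sign ≠ 0 := by
  cases F <;> simp [Facet.sign]

/-- The end of a ray at the given facet. -/
def Facet.rayEnd : Facet → Filter ℝ
  | .origin => 𝓝[>] 0
  | .infinity => atTop

section ByParts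

variable {n : ℕ} {k : Fin (n + 1) → ℕ} {x : Fin (n + 1) → ℂ} {Θ : Set Real.Angle} {lz lf : ℂ → ℂ}
  {θ : Real.Angle} {C : ℝ}

theorem IsBranch.poly_ne_zero (hb : IsBranch k x Θ lz lf) {z : ℂ} (hz : z ∈ sector Θ) :
    poly k x z ≠ 0 :=
  hb.exp_f z hz ▸ Complex.exp_ne_zero _

theorem IsBranch.powerKernel_sub_column (hb : IsBranch k x Θ lz lf) (β : ℂ × ℂ) (i : Fin (n + 1))
    {z : ℂ} (hz : z ∈ sector Θ) :
    powerKernel lz lf (β - column k i) z = powerKernel lz lf β z * z ^ k i / poly k x z := by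
  have hpow : z ^ k i = Complex.exp (k i * lz z) := by rw [Complex.exp_nat_mul, hb.exp_z z hz]
  rw [eq_div_iff (hb.poly_ne_zero hz), ← hb.exp_f z hz, hpow]
  simp only [powerKernel, column, Prod.fst_sub, Prod.snd_sub, ← Complex.exp_add]
  ring_nf

theorem IsBranch.sum_mul_powerKernel (hb : IsBranch k x Θ lz lf) (β : ℂ × ℂ) {z : ℂ}
    (hz : z ∈ sector Θ) :
    ∑ i, x i * powerKernel lz lf (β - column k i) z = powerKernel lz lf β z := by
  simp only [hb.powerKernel_sub_column β _ hz]
  have : ∀ i, x i * (powerKernel lz lf β z * z ^ k i / poly k x z) =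
      powerKernel lz lf β z / poly k x z * (x i * z ^ k i) := fun i => by ring
  simp only [this]
  rw [← Finset.mul_sum]
  exact div_mul_cancel₀ _ (hb.poly_ne_zero hz)

theorem mul_deriv_poly (k : Fin (n + 1) → ℕ) (x : Fin (n + 1) → ℂ) (z : ℂ) :
    ∃ d, HasDerivAt (poly k x) d z ∧ z * d = ∑ i, (k i : ℂ) * x i * z ^ k i := by
  refine ⟨∑ i, x i * (k i * z ^ (k i - 1)), ?_, ?_⟩
  · exact HasDerivAt.fun_sum fun i _ => (hasDerivAt_pow (k i) z).const_mul (x i)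
  · rw [Finset.mul_sum]
    refine Finset.sum_congr rfl fun i _ => ?_
    rcases Nat.eq_zero_or_pos (k i) with h | h
    · simp [h]
    · have : z ^ k i = z * z ^ (k i - 1) := by rw [← pow_succ', Nat.sub_add_cancel h]
      rw [this]
      ring

/-- The logarithmic derivative of the kernel with respect to `z`. -/
theorem IsBranch.hasDerivAt_powerKernel (hb : IsBranch k x Θ lz lf) (hk : IsCurve k)
    (hΘ : IsOpen Θ) (F : Facet) (β : ℂ × ℂ) {z : ℂ} (hz : z ∈ sector Θ) :
    HasDerivAt (powerKernel lz lf β)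
      (F.sign * (β.1 * ∑ i, (F.weight k i : ℂ) * x i * powerKernel lz lf (β - column k i) z
        - F.form k β * powerKernel lz lf β z) / z) z := by
  have hmem := (isOpen_sector hΘ).mem_nhds hz
  have hdz : DifferentiableAt ℂ lz z := (analyticAt_of_exp_eq
    (hb.continuousOn_z.continuousAt hmem) analyticAt_id
    (Filter.eventually_of_mem hmem hb.exp_z)).differentiableAt
  obtain ⟨d, hd, hzd⟩ := mul_deriv_poly k x z
  have hpoly : AnalyticAt ℂ (poly k x) z := by
    unfold poly
    fun_prop
  have hdf : DifferentiableAt ℂ lf z := (analyticAt_of_exp_eq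
    (hb.continuousOn_f.continuousAt hmem) hpoly
    (Filter.eventually_of_mem hmem hb.exp_f)).differentiableAt
  have hez : z * deriv lz z = 1 := by
    have h1 := hdz.hasDerivAt.cexp
    rw [hb.exp_z z hz] at h1
    exact h1.unique ((hasDerivAt_id z).congr_of_eventuallyEq
      (Filter.eventually_of_mem hmem hb.exp_z))
  have hef : poly k x z * deriv lf z = d := by
    have h1 := hdf.hasDerivAt.cexp
    rw [hb.exp_f z hz] at h1
    exact h1.unique (hd.congr_of_eventuallyEq (Filter.eventually_of_mem hmem hb.exp_f))
  have hder := ((hdf.hasDerivAt.const_mul β.1).sub (hdz.hasDerivAt.const_mul β.2)).cexp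
  have hz0 : z ≠ 0 := hz.1
  have hp0 := hb.poly_ne_zero hz
  have hsum : ∑ i, (k i : ℂ) * x i * powerKernel lz lf (β - column k i) z =
      powerKernel lz lf β z * (z * deriv lf z) := by
    simp only [hb.powerKernel_sub_column β _ hz]
    have : ∀ i, (k i : ℂ) * x i * (powerKernel lz lf β z * z ^ k i / poly k x z) =
        powerKernel lz lf β z / poly k x z * ((k i : ℂ) * x i * z ^ k i) := fun i => by ring
    simp only [this]
    rw [← Finset.mul_sum, ← hzd, ← hef]
    field_simp
  have horigin : Facet.origin.sign * (β.1 * ∑ i, (Facet.origin.weight k i : ℂ) * x i *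
      powerKernel lz lf (β - column k i) z - Facet.origin.form k β * powerKernel lz lf β z) / z =
      powerKernel lz lf β z * (β.1 * deriv lf z - β.2 * deriv lz z) := by
    simp only [Facet.sign, Facet.weight, Facet.form, hsum]
    rw [div_eq_iff hz0]
    linear_combination (β.2 * powerKernel lz lf β z) * hez
  cases F with
  | origin =>
    rw [horigin]
    exact hder
  | infinity =>
    -- The two weights add up to the degree, as do the forms to degree·β₁, and ∑ x_i times the
    -- shifted kernels is the kernel. The expression for infinity is therefore the negative of that
    -- for the origin, and the sign compensates.
    have hswap : Facet.infinity.sign * (β.1 * ∑ i, (Facet.infinity.weight k i : ℂ) * x i *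
        powerKernel lz lf (β - column k i) z - Facet.infinity.form k β * powerKernel lz lf β z) =
        Facet.origin.sign * (β.1 * ∑ i, (Facet.origin.weight k i : ℂ) * x i *
        powerKernel lz lf (β - column k i) z - Facet.origin.form k β * powerKernel lz lf β z) := by
      have hw : ∑ i, (Facet.infinity.weight k i : ℂ) * x i *
          powerKernel lz lf (β - column k i) z = degree k * powerKernel lz lf β z -
          ∑ i, (Facet.origin.weight k i : ℂ) * x i * powerKernel lz lf (β - column k i) z := by
        rw [← hb.sum_mul_powerKernel β hz, Finset.mul_sum, ← Finset.sum_sub_distrib]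
        refine Finset.sum_congr rfl fun i _ => ?_
        have : (Facet.origin.weight k i : ℂ) + Facet.infinity.weight k i = degree k := by
          exact_mod_cast hk.weight_add_weight_opp Facet.origin i
        rw [← this]
        ring
      rw [hw]
      simp only [Facet.sign, Facet.form]
      ring
    rw [hswap, horigin]
    exact hder

theorem rayPoint_coe (φ r : ℝ) : rayPoint φ r = r * Complex.exp (φ * Complex.I) := by
  rw [rayPoint, Real.Angle.toCircle_coe, Circle.coe_exp]

theorem IsBranch.hasDerivAt_powerKernel_ray (hb : IsBranch k x Θ lz lf) (hk : IsCurve k)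
    (hΘ : IsOpen Θ) (hθ : θ ∈ Θ) (F : Facet) (β : ℂ × ℂ) {r : ℝ} (hr : 0 < r) :
    HasDerivAt (fun r => powerKernel lz lf β (rayPoint θ r))
      (F.sign * (β.1 * ∑ i, (F.weight k i : ℂ) * x i * integrand lz lf θ (β - column k i) r
        - F.form k β * integrand lz lf θ β r)) r := by
  have h1 := hb.hasDerivAt_powerKernel hk hΘ F β (rayPoint_mem_sector hθ hr)
  have h2 : HasDerivAt (rayPoint θ) (θ.toCircle : ℂ) r := by
    unfold rayPoint
    simpa using (Complex.ofRealCLM.hasDerivAt (x := r)).mul_const (θ.toCircle : ℂ)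
  have h3 := h1.comp r h2
  refine HasDerivAt.congr_deriv h3 ?_
  have hr' : (r : ℂ) ≠ 0 := Complex.ofReal_ne_zero.2 hr.ne'
  have hz : rayPoint θ r ≠ 0 := (rayPoint_mem_sector hθ hr).1
  have hu : (θ.toCircle : ℂ) * r = rayPoint θ r := mul_comm _ _
  simp only [integrand_eq, mul_div_assoc', ← Finset.sum_div, ← sub_div]
  rw [div_mul_eq_mul_div, eq_div_iff hr', div_mul_eq_mul_div, div_eq_iff hz, ← hu]
  ring

theorem integral_Ioi_eq_sub_of_tendsto {G G' : ℝ → ℂ} {m₀ m₁ : ℂ}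
    (hG : ∀ r ∈ Set.Ioi (0 : ℝ), HasDerivAt G (G' r) r) (hG' : IntegrableOn G' (Set.Ioi 0))
    (h₀ : Tendsto G (𝓝[>] 0) (𝓝 m₀)) (h₁ : Tendsto G atTop (𝓝 m₁)) :
    ∫ r in Set.Ioi (0 : ℝ), G' r = m₁ - m₀ := by
  have key := integral_Ioi_of_hasDerivAt_of_tendsto (f := Function.update G 0 m₀) (f' := G')
    (a := 0) (m := m₁) ?_ ?_ hG' ?_
  · simpa using key
  · rw [continuousWithinAt_update_same]
    simpa using h₀
  · intro r hr
    refine (hG r hr).congr_of_eventuallyEq ?_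
    filter_upwards [isOpen_ne.mem_nhds (ne_of_gt hr)] with y hy
    exact Function.update_of_ne hy _ _
  · refine h₁.congr' ?_
    filter_upwards [eventually_ne_atTop 0] with y hy
    exact (Function.update_of_ne hy _ _).symm

theorem tendsto_abs_log_rayEnd (F : Facet) :
    Tendsto (fun r => |Real.log r|) F.rayEnd atTop := by
  cases F
  · exact tendsto_abs_atBot_atTop.comp Real.tendsto_log_nhdsGT_zero
  · exact tendsto_abs_atTop_atTop.comp Real.tendsto_log_atTop

theorem RayBound.tendsto_powerKernel_zero (h : RayBound k lz lf θ C) {F : Facet} {β : ℂ × ℂ}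
    (hβ : (F.form k β).re < 0) :
    Tendsto (fun r => powerKernel lz lf β (rayPoint θ r)) F.rayEnd (𝓝 0) := by
  set δ := -(F.form k β).re with hδ
  have hδ0 : 0 < δ := by linarith
  have hlim : Tendsto (fun r => Real.exp (C * paramSize k β - δ * |Real.log r|)) F.rayEnd
      (𝓝 0) := by
    refine Real.tendsto_exp_atBot.comp ?_
    refine tendsto_atBot_add_const_left _ (C * paramSize k β) ?_
    exact tendsto_neg_atTop_atBot.comp ((tendsto_abs_log_rayEnd F).const_mul_atTop hδ0)
  refine squeeze_zero_norm' ?_ hlim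
  cases F with
  | origin =>
    filter_upwards [Ioc_mem_nhdsGT (zero_lt_one' ℝ)] with r hr
    exact h.norm_le_origin (by rw [hδ, neg_neg]) hr.1 hr.2
  | infinity =>
    filter_upwards [eventually_ge_atTop 1] with r hr
    exact h.norm_le_infinity (by rw [hδ, neg_neg]) hr

theorem tendsto_powerKernel_vertex (hθ : θ ∈ Θ) {F : Facet} {v : ℂ}
    (hv : IsVertexLog k Θ lz lf v F) {β : ℂ × ℂ} (hβ : F.form k β = 0) :
    Tendsto (fun r => powerKernel lz lf β (rayPoint θ r)) F.rayEnd
      (𝓝 (Complex.exp (β.1 * v))) := by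
  have hcont : Continuous (rayPoint θ) := continuous_rayPoint.comp (Continuous.prodMk_right θ)
  cases F with
  | origin =>
    have h1 : Tendsto (rayPoint θ) (𝓝[>] 0) (𝓝[sector Θ] 0) := by
      refine tendsto_nhdsWithin_iff.2 ⟨?_, ?_⟩
      · have := hcont.tendsto 0
        rw [show rayPoint θ 0 = 0 by simp [rayPoint]] at this
        exact this.mono_left nhdsWithin_le_nhds
      · filter_upwards [self_mem_nhdsWithin] with r hr
        exact rayPoint_mem_sector hθ hr
    refine (((Tendsto.comp hv h1).const_mul β.1).cexp).congr fun r => ?_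
    have : β.2 = 0 := hβ
    simp [powerKernel, this]
  | infinity =>
    have h1 : Tendsto (rayPoint θ) atTop (Bornology.cobounded ℂ ⊓ 𝓟 (sector Θ)) := by
      refine tendsto_inf.2 ⟨?_, tendsto_principal.2 ?_⟩
      · rw [← tendsto_norm_atTop_iff_cobounded]
        refine tendsto_id.congr' ?_
        filter_upwards [eventually_gt_atTop 0] with r hr
        rw [norm_rayPoint θ hr, id]
      · filter_upwards [eventually_gt_atTop 0] with r hr
        exact rayPoint_mem_sector hθ hr
    refine (((Tendsto.comp hv h1).const_mul β.1).cexp).congr fun r => ?_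
    have : (degree k : ℂ) * β.1 - β.2 = 0 := hβ
    simp only [powerKernel, Function.comp]
    congr 1
    linear_combination (-lz (rayPoint θ r)) * this

theorem IsCurve.sub_column_mem (hk : IsCurve k) {β : ℂ × ℂ} (hβ : β ∈ convergenceDomain k)
    (i : Fin (n + 1)) : β - column k i ∈ convergenceDomain k := by
  intro F
  rw [hk.form_sub_column, Complex.sub_re, Complex.natCast_re]
  have h1 := hβ F
  have h2 : (0 : ℝ) ≤ F.weight k i := Nat.cast_nonneg _
  linarith

/-- The integral of the derivative of the kernel along the ray is zero, since in the convergence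
domain the kernel vanishes at both ends. -/
theorem IsBranch.form_mul_eulerMellin (hb : IsBranch k x Θ lz lf) (hk : IsCurve k)
    (hΘ : IsOpen Θ) (hθ : θ ∈ Θ) (h : RayBound k lz lf θ C) (F : Facet) {β : ℂ × ℂ}
    (hβ : β ∈ convergenceDomain k) :
    F.form k β * eulerMellin lz lf θ β =
      β.1 * ∑ i, (F.weight k i : ℂ) * x i * eulerMellin lz lf θ (β - column k i) := by
  have hint : ∀ i, IntegrableOn (fun r => (F.weight k i : ℂ) * x i *
      integrand lz lf θ (β - column k i) r) (Set.Ioi 0) := fun i =>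
    (hb.integrableOn_integrand hθ h (hk.sub_column_mem hβ i)).const_mul _
  have hint' := (hb.integrableOn_integrand hθ h hβ).const_mul (F.form k β)
  have hsum := (integrable_finsetSum Finset.univ fun i _ => hint i).const_mul β.1
  have key := integral_Ioi_eq_sub_of_tendsto
    (fun r hr => hb.hasDerivAt_powerKernel_ray hk hΘ hθ F β hr)
    ((hsum.sub hint').const_mul F.sign)
    (h.tendsto_powerKernel_zero (hβ Facet.origin))
    (h.tendsto_powerKernel_zero (hβ Facet.infinity))
  rw [integral_const_mul, integral_sub hsum hint', integral_const_mul, integral_const_mul,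
    integral_finsetSum _ fun i _ => hint i, sub_zero, mul_eq_zero,
    or_iff_right F.sign_ne_zero, sub_eq_zero] at key
  simp only [integral_const_mul] at key
  exact key.symm

/-- On the boundary line of the convergence domain the kernel no longer vanishes at the vertex of
`F` but tends to exp(β₁ v), which becomes the right side. The integrals on the left still converge:
a shift with nonzero weight re-enters the domain, and weight zero kills the term. `Facet.sign` makes
the two ends give the same formula. -/
theorem IsBranch.sum_eulerMellin_of_form_eq_zero (hb : IsBranch k x Θ lz lf) (hk : IsCurve k)
    (hΘ : IsOpen Θ) (hθ : θ ∈ Θ) (h : RayBound k lz lf θ C) {F : Facet} {v : ℂ}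
    (hv : IsVertexLog k Θ lz lf v F) {β : ℂ × ℂ} (hβ : F.form k β = 0)
    (hβ' : (F.opp.form k β).re < 0) :
    β.1 * ∑ i, (F.weight k i : ℂ) * x i * eulerMellin lz lf θ (β - column k i) =
      -Complex.exp (β.1 * v) := by
  have hint : ∀ i, IntegrableOn (fun r => (F.weight k i : ℂ) * x i *
      integrand lz lf θ (β - column k i) r) (Set.Ioi 0) := by
    intro i
    rcases Nat.eq_zero_or_pos (F.weight k i) with h0 | h0
    · simp [h0]
    · refine (hb.integrableOn_integrand hθ h fun F' => ?_).const_mul _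
      rw [hk.form_sub_column, Complex.sub_re, Complex.natCast_re]
      have h1 : (0 : ℝ) < F.weight k i := by exact_mod_cast h0
      have h2 : (0 : ℝ) ≤ F.opp.weight k i := Nat.cast_nonneg _
      have h3 : (F.form k β).re = 0 := by rw [hβ, Complex.zero_re]
      cases F <;> cases F' <;> simp only [Facet.opp] at * <;> linarith
  have hsum := (integrable_finsetSum Finset.univ fun i _ => hint i).const_mul β.1
  have hder : ∀ r ∈ Set.Ioi (0 : ℝ), HasDerivAt (fun r => powerKernel lz lf β (rayPoint θ r))
      (F.sign * (β.1 * ∑ i, (F.weight k i : ℂ) * x i *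
        integrand lz lf θ (β - column k i) r)) r := by
    intro r hr
    have := hb.hasDerivAt_powerKernel_ray hk hΘ hθ F β hr
    rwa [hβ, zero_mul, sub_zero] at this
  have hval : ∫ r in Set.Ioi (0 : ℝ), F.sign * (β.1 * ∑ i, (F.weight k i : ℂ) * x i *
        integrand lz lf θ (β - column k i) r) = F.sign * (-Complex.exp (β.1 * v)) := by
    have h1 := tendsto_powerKernel_vertex hθ hv hβ
    have h2 := h.tendsto_powerKernel_zero hβ'
    cases F with
    | origin =>
      rw [integral_Ioi_eq_sub_of_tendsto hder (hsum.const_mul _) h1 h2]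
      simp [Facet.sign]
    | infinity =>
      rw [integral_Ioi_eq_sub_of_tendsto hder (hsum.const_mul _) h2 h1]
      simp [Facet.sign]
  rw [integral_const_mul, integral_const_mul, integral_finsetSum _ fun i _ => hint i] at hval
  simp only [integral_const_mul] at hval
  exact mul_left_cancel₀ F.sign_ne_zero hval

/-- The derivative of the integrand in the angle is I times the derivative of the kernel in r. Its
integral vanishes by `form_mul_eulerMellin`, so the Euler–Mellin integral is locally constant in the
angle and no contour argument is required. -/
theorem IsBranch.eventually_eulerMellin_eq (hb : IsBranch k x Θ lz lf) (hk : IsCurve k)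
    (hx : x ∈ nonzeroEnds n) (hΘ : IsComponent k x Θ) {β : ℂ × ℂ}
    (hβ : β ∈ convergenceDomain k) {φ₀ : ℝ} (hφ₀ : (φ₀ : Real.Angle) ∈ Θ) :
    ∀ᶠ φ : ℝ in 𝓝 φ₀, eulerMellin lz lf φ₀ β = eulerMellin lz lf φ β := by
  have hopen := hΘ.isOpen hk hx
  obtain ⟨ε, hε, hεΘ⟩ := Metric.nhds_basis_closedBall.mem_iff.1
    (Real.Angle.continuous_coe.continuousAt.preimage_mem_nhds (hopen.mem_nhds hφ₀))
  set K : Set Real.Angle := Real.Angle.coe '' Metric.closedBall φ₀ ε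
  have hK : IsCompact K := (isCompact_closedBall φ₀ ε).image Real.Angle.continuous_coe
  have hKΘ : K ⊆ Θ := Set.image_subset_iff.2 hεΘ
  obtain ⟨C, hC⟩ := hb.exists_rayBound hk hx hΘ hK hKΘ
  have hbd : ∀ φ ∈ Metric.ball φ₀ ε, RayBound k lz lf φ C := fun φ hφ =>
    hC φ ⟨φ, Metric.ball_subset_closedBall hφ, rfl⟩
  have hmem : ∀ φ ∈ Metric.ball φ₀ ε, (φ : Real.Angle) ∈ Θ := fun φ hφ =>
    hεΘ (Metric.ball_subset_closedBall hφ)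
  let D : ℝ → ℝ → ℂ := fun φ r => Complex.I * (β.1 * ∑ i, (k i : ℂ) * x i *
    integrand lz lf φ (β - column k i) r - β.2 * integrand lz lf φ β r)
  have hderiv : ∀ φ ∈ Metric.ball φ₀ ε, ∀ r : ℝ, 0 < r →
      HasDerivAt (fun φ : ℝ => integrand lz lf φ β r) (D φ r) φ := by
    intro φ hφ r hr
    have h1 := hb.hasDerivAt_powerKernel hk hopen Facet.origin β
      (rayPoint_mem_sector (hmem φ hφ) hr)
    have h2 : HasDerivAt (fun φ : ℝ => rayPoint φ r) (Complex.I * rayPoint φ r) φ := by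
      simp only [rayPoint_coe]
      have := (((Complex.ofRealCLM.hasDerivAt (x := φ)).mul_const Complex.I).cexp).const_mul (r : ℂ)
      refine HasDerivAt.congr_deriv this ?_
      simp only [Complex.ofRealCLM_apply, Complex.ofReal_one]
      ring
    have h3 := (h1.comp φ h2).div_const (r : ℂ)
    refine HasDerivAt.congr_deriv h3 ?_
    have hr' : (r : ℂ) ≠ 0 := Complex.ofReal_ne_zero.2 hr.ne'
    have hu : rayPoint φ r ≠ 0 := (rayPoint_mem_sector (hmem φ hφ) hr).1
    simp only [D, integrand_eq, Facet.sign, Facet.weight, Facet.form, mul_div_assoc',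
      ← Finset.sum_div, ← sub_div, one_mul]
    field_simp
  obtain ⟨δ, hδ, hβδ⟩ := exists_margin hβ
  have hβδ' : ∀ i, ∀ F : Facet, (F.form k (β - column k i)).re ≤ -δ := by
    intro i F
    rw [hk.form_sub_column, Complex.sub_re, Complex.natCast_re]
    have h1 := hβδ F
    have h2 : (0 : ℝ) ≤ F.weight k i := Nat.cast_nonneg _
    linarith
  let bound : ℝ → ℝ := fun r => ‖β.1‖ * ∑ i, ‖(k i : ℂ) * x i‖ *
      (Real.exp (C * paramSize k (β - column k i)) * (Real.exp (-δ * |Real.log r|) / r)) +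
      ‖β.2‖ * (Real.exp (C * paramSize k β) * (Real.exp (-δ * |Real.log r|) / r))
  have hint : ∀ φ ∈ Metric.ball φ₀ ε, ∀ i, IntegrableOn (fun r => (k i : ℂ) * x i *
      integrand lz lf φ (β - column k i) r) (Set.Ioi 0) := fun φ hφ i =>
    (hb.integrableOn_integrand (hmem φ hφ) (hbd φ hφ) (hk.sub_column_mem hβ i)).const_mul _
  have hint' : ∀ φ ∈ Metric.ball φ₀ ε, IntegrableOn (fun r => β.2 * integrand lz lf φ β r)
      (Set.Ioi 0) := fun φ hφ =>
    (hb.integrableOn_integrand (hmem φ hφ) (hbd φ hφ) hβ).const_mul _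
  have hsum : ∀ φ ∈ Metric.ball φ₀ ε, IntegrableOn (fun r => β.1 * ∑ i, (k i : ℂ) * x i *
      integrand lz lf φ (β - column k i) r) (Set.Ioi 0) := fun φ hφ =>
    (integrable_finsetSum Finset.univ fun i _ => hint φ hφ i).const_mul β.1
  have hD0 : ∀ φ ∈ Metric.ball φ₀ ε, ∫ r in Set.Ioi (0 : ℝ), D φ r = 0 := by
    intro φ hφ
    have h1 := hb.form_mul_eulerMellin hk hopen (hmem φ hφ) (hbd φ hφ) Facet.origin hβ
    simp only [Facet.form, Facet.weight] at h1
    simp only [D]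
    rw [integral_const_mul, integral_sub (hsum φ hφ) (hint' φ hφ), integral_const_mul,
      integral_const_mul, integral_finsetSum _ fun i _ => hint φ hφ i]
    simp only [integral_const_mul]
    rw [← eulerMellin, h1]
    simp [eulerMellin]
  have hmain : ∀ φ ∈ Metric.ball φ₀ ε,
      HasDerivAt (fun φ : ℝ => eulerMellin lz lf φ β) 0 φ := by
    intro φ hφ
    have := (hasDerivAt_integral_of_dominated_loc_of_deriv_le (𝕜 := ℝ)
      (μ := volume.restrict (Set.Ioi 0)) (F := fun (φ : ℝ) r => integrand lz lf φ β r)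
      (F' := D) (bound := bound) (Metric.isOpen_ball.mem_nhds hφ) ?_ ?_ ?_ ?_ ?_ ?_).2
    · rwa [hD0 φ hφ] at this
    · filter_upwards [Metric.isOpen_ball.mem_nhds hφ] with φ' hφ'
      exact hb.aestronglyMeasurable_integrand (hmem φ' hφ') β
    · exact hb.integrableOn_integrand (hmem φ hφ) (hbd φ hφ) hβ
    · exact (((hsum φ hφ).sub (hint' φ hφ)).const_mul _).aestronglyMeasurable
    · filter_upwards [ae_restrict_mem measurableSet_Ioi] with r hr φ' hφ'
      simp only [D, bound]
      rw [norm_mul, Complex.norm_I, one_mul]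
      refine (norm_sub_le _ _).trans (add_le_add ?_ ?_)
      · rw [norm_mul]
        refine mul_le_mul_of_nonneg_left ((norm_sum_le _ _).trans
          (Finset.sum_le_sum fun i _ => ?_)) (norm_nonneg _)
        rw [norm_mul]
        exact mul_le_mul_of_nonneg_left
          ((hbd φ' hφ').norm_integrand_le (hβδ' i) le_rfl hr) (norm_nonneg _)
      · rw [norm_mul]
        exact mul_le_mul_of_nonneg_left
          ((hbd φ' hφ').norm_integrand_le (fun F => (hβδ F).le) le_rfl hr) (norm_nonneg _)
    · have hμ := integrableOn_exp_neg_mul_abs_log hδ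
      exact ((integrable_finsetSum Finset.univ fun i _ =>
        (hμ.const_mul _).const_mul _).const_mul _).add ((hμ.const_mul _).const_mul _)
    · filter_upwards [ae_restrict_mem measurableSet_Ioi] with r hr φ' hφ'
      exact hderiv φ' hφ' r hr
  filter_upwards [Metric.ball_mem_nhds φ₀ hε] with φ hφ
  exact Metric.isOpen_ball.is_const_of_deriv_eq_zero (convex_ball φ₀ ε).isPreconnected
    (fun φ hφ => (hmain φ hφ).differentiableAt.differentiableWithinAt)
    (fun φ hφ => (hmain φ hφ).deriv) (Metric.mem_ball_self hε) hφ

/-- The Euler–Mellin integral does not depend on the ray in the component. -/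
theorem IsBranch.eulerMellin_eq (hb : IsBranch k x Θ lz lf) (hk : IsCurve k)
    (hx : x ∈ nonzeroEnds n) (hΘ : IsComponent k x Θ) {β : ℂ × ℂ}
    (hβ : β ∈ convergenceDomain k) {θ θ' : Real.Angle} (hθ : θ ∈ Θ) (hθ' : θ' ∈ Θ) :
    eulerMellin lz lf θ β = eulerMellin lz lf θ' β := by
  refine hΘ.isPreconnected.induction₂
    (fun θ θ' => eulerMellin lz lf θ β = eulerMellin lz lf θ' β) ?_
    (fun _ _ _ _ _ _ h h' => h.trans h') (fun _ _ _ _ h => h.symm) hθ hθ'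
  intro θ hθ
  induction θ using Real.Angle.induction_on with
  | _ φ =>
    refine Filter.Eventually.filter_mono nhdsWithin_le_nhds ?_
    have hopen : IsOpenMap Real.Angle.coe := QuotientAddGroup.isOpenMap_coe
    exact Filter.Eventually.filter_mono (hopen.nhds_le φ)
      (Filter.eventually_map.2 (hb.eventually_eulerMellin_eq hk hx hΘ hβ hθ))

end ByParts

/-! ### Entire extension -/

section Extension

variable {n : ℕ} {k : Fin (n + 1) → ℕ}

/-- The quotient of the Euler–Mellin integral and the extended Euler–Mellin integral. -/
noncomputable def gammaFactor (k : Fin (n + 1) → ℕ) (β : ℂ × ℂ) : ℂ :=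
  (Complex.Gamma (-β.1))⁻¹
    * Complex.Gamma (-(Facet.origin.form k β)) * Complex.Gamma (-(Facet.infinity.form k β))
    * Facet.origin.gapProd k (Facet.origin.form k β)
    * Facet.infinity.gapProd k (Facet.infinity.form k β)

theorem gammaFactor_eq (F : Facet) (β : ℂ × ℂ) :
    gammaFactor k β = (Complex.Gamma (-β.1))⁻¹
      * (Complex.Gamma (-(F.form k β)) * Complex.Gamma (-(F.opp.form k β)))
      * (F.gapProd k (F.form k β) * F.opp.gapProd k (F.opp.form k β)) := by
  cases F <;> simp only [gammaFactor, Facet.opp] <;> ring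

theorem re_natCast_mul (m : ℕ) (z : ℂ) : ((m : ℂ) * z).re = m * z.re := by
  rw [← Complex.ofReal_natCast, Complex.re_ofReal_mul]

theorem IsCurve.fst_re_neg (hk : IsCurve k) {β : ℂ × ℂ} (hβ : β ∈ convergenceDomain k) :
    β.1.re < 0 := by
  have h := congrArg Complex.re (Facet.origin.form_add_form_opp (k := k) β)
  rw [Complex.add_re, re_natCast_mul] at h
  have h0 := hβ Facet.origin
  have h1 := hβ Facet.infinity
  have hd : (0 : ℝ) < degree k := by exact_mod_cast hk.degree_pos
  simp only [Facet.opp] at h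
  nlinarith

theorem isOpen_convergenceDomain : IsOpen (convergenceDomain k) := by
  have hre : ∀ F : Facet, IsOpen {β | (F.form k β).re < 0} := fun F =>
    isOpen_lt (Complex.continuous_re.comp F.differentiable_form.continuous) continuous_const
  have : convergenceDomain k = {β | (Facet.origin.form k β).re < 0} ∩
      {β | (Facet.infinity.form k β).re < 0} := by
    ext β
    constructor
    · exact fun h => ⟨h _, h _⟩
    · rintro ⟨h0, h1⟩ F
      cases F
      exacts [h0, h1]
  rw [this]
  exact (hre _).inter (hre _)

theorem IsCurve.exists_mem_convergenceDomain (hk : IsCurve k) :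
    ∃ β, β ∈ convergenceDomain k := by
  refine ⟨(-2, -1), fun F => ?_⟩
  have hd : (1 : ℝ) ≤ degree k := by exact_mod_cast hk.degree_pos
  cases F
  · simp [Facet.form]
  · simp only [Facet.form, Complex.sub_re, re_natCast_mul]
    norm_num
    linarith

theorem IsCurve.gammaFactor_ne_zero (hk : IsCurve k) {β : ℂ × ℂ}
    (hβ : β ∈ convergenceDomain k) : gammaFactor k β ≠ 0 := by
  have hΓ : ∀ s : ℂ, s.re < 0 → Complex.Gamma (-s) ≠ 0 := fun s hs =>
    Complex.Gamma_ne_zero_of_re_pos (by simpa using hs)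
  refine mul_ne_zero (mul_ne_zero (mul_ne_zero (mul_ne_zero
    (inv_ne_zero (hΓ _ (hk.fst_re_neg hβ))) (hΓ _ (hβ _))) (hΓ _ (hβ _))) ?_) ?_
  exacts [hk.gapProd_ne_zero_of_re_neg _ (hβ _), hk.gapProd_ne_zero_of_re_neg _ (hβ _)]

theorem IsCurve.differentiableAt_gammaFactor (hk : IsCurve k) {β : ℂ × ℂ}
    (hβ : β ∈ convergenceDomain k) : DifferentiableAt ℂ (gammaFactor k) β := by
  have hΓ : ∀ F : Facet, DifferentiableAt ℂ (fun β => Complex.Gamma (-(F.form k β))) β := by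
    intro F
    refine DifferentiableAt.comp β (Complex.differentiableAt_Gamma _ fun m hm => ?_)
      (F.differentiable_form β).neg
    have h1 := hβ F
    have h2 := congrArg Complex.re hm
    simp only [Complex.neg_re, Complex.natCast_re, neg_inj] at h2
    rw [h2] at h1
    exact absurd h1 (not_lt.2 (Nat.cast_nonneg m))
  have hg : ∀ F : Facet, DifferentiableAt ℂ (fun β => F.gapProd k (F.form k β)) β := fun F =>
    (hk.differentiable_gapProd F).comp F.differentiable_form β
  have h0 : DifferentiableAt ℂ (fun β : ℂ × ℂ => (Complex.Gamma (-β.1))⁻¹) β :=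
    (Complex.differentiable_one_div_Gamma.comp differentiable_fst.neg) β
  exact (((h0.mul (hΓ _)).mul (hΓ _)).mul (hg _)).mul (hg _)

/-! ### Contiguity relations and the entire extension -/

/-- The coefficients of the contiguity relation for the facet `F`: they relate the extended
Euler–Mellin integral at `β` to its values at `β` minus the columns of `A`. -/
theorem IsCurve.exists_contiguity_coeff (hk : IsCurve k) (F : Facet) (i : Fin (n + 1)) :
    ∃ c : ℂ × ℂ → ℂ, Differentiable ℂ c ∧ (F.weight k i = 0 → c = 0) ∧
      ∀ β, c β * (F.gapProd k (F.form k β) * F.opp.gapProd k (F.opp.form k β)) =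
        F.weight k i * (∏ j ∈ Finset.Ico 1 (F.weight k i), ((j : ℂ) - F.form k β)) *
          (∏ j ∈ Finset.range (F.opp.weight k i), ((j : ℂ) - F.opp.form k β)) *
          (F.gapProd k (F.form k (β - column k i)) *
            F.opp.gapProd k (F.opp.form k (β - column k i))) := by
  rcases Nat.eq_zero_or_pos (F.weight k i) with h0 | h0
  · exact ⟨0, differentiable_const _, fun _ => rfl, fun β => by simp [h0]⟩
  -- For `F` the factor j = 0 is left out, since it is the one that cancels against the form on the
  -- left of the integration by parts. This is harmless because 0 is not a gap. The opposite facet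
  -- keeps the full range.
  obtain ⟨Q, hQ, hQ'⟩ := hk.exists_mul_gapProd_eq F (F.weight_mem_monoid i)
    (J := Finset.Ico 1 (F.weight k i)) (fun j hj => (Finset.mem_Ico.1 hj).2) (fun j hj hj' =>
      Finset.mem_Ico.2 ⟨Nat.one_le_iff_ne_zero.2 fun h => hj (h ▸ zero_mem _), hj'⟩)
  obtain ⟨R, hR, hR'⟩ := hk.exists_mul_gapProd_eq F.opp (F.opp.weight_mem_monoid i)
    (J := Finset.range (F.opp.weight k i)) (fun j hj => Finset.mem_range.1 hj)
    (fun j _ hj' => Finset.mem_range.2 hj')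
  refine ⟨fun β => F.weight k i * Q (F.form k β) * R (F.opp.form k β), ?_,
    fun h => absurd h h0.ne', fun β => ?_⟩
  · exact ((hQ.comp F.differentiable_form).const_mul _).mul (hR.comp F.opp.differentiable_form)
  · rw [hk.form_sub_column, hk.form_sub_column]
    linear_combination (F.weight k i : ℂ) * R (F.opp.form k β) *
        F.opp.gapProd k (F.opp.form k β) * hQ' (F.form k β) +
      (F.weight k i : ℂ) * (∏ j ∈ Finset.Ico 1 (F.weight k i), ((j : ℂ) - F.form k β)) *
        F.gapProd k (F.form k β - F.weight k i) * hR' (F.opp.form k β)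

/-- The coefficient of the contiguity relation. -/
noncomputable def IsCurve.contiguityCoeff (hk : IsCurve k) (F : Facet) (i : Fin (n + 1)) :
    ℂ × ℂ → ℂ :=
  (hk.exists_contiguity_coeff F i).choose

theorem IsCurve.differentiable_contiguityCoeff (hk : IsCurve k) (F : Facet) (i : Fin (n + 1)) :
    Differentiable ℂ (hk.contiguityCoeff F i) :=
  (hk.exists_contiguity_coeff F i).choose_spec.1

theorem IsCurve.contiguityCoeff_eq_zero (hk : IsCurve k) {F : Facet} {i : Fin (n + 1)}
    (h : F.weight k i = 0) : hk.contiguityCoeff F i = 0 :=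
  (hk.exists_contiguity_coeff F i).choose_spec.2.1 h

theorem IsCurve.contiguityCoeff_mul (hk : IsCurve k) (F : Facet) (i : Fin (n + 1)) (β : ℂ × ℂ) :
    hk.contiguityCoeff F i β * (F.gapProd k (F.form k β) * F.opp.gapProd k (F.opp.form k β)) =
      F.weight k i * (∏ j ∈ Finset.Ico 1 (F.weight k i), ((j : ℂ) - F.form k β)) *
        (∏ j ∈ Finset.range (F.opp.weight k i), ((j : ℂ) - F.opp.form k β)) *
        (F.gapProd k (F.form k (β - column k i)) *
          F.opp.gapProd k (F.opp.form k (β - column k i))) :=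
  (hk.exists_contiguity_coeff F i).choose_spec.2.2 β

theorem Gamma_natCast_sub {s : ℂ} (hs : s.re < 0) (a : ℕ) :
    Complex.Gamma (a - s) = (∏ j ∈ Finset.range a, ((j : ℂ) - s)) * Complex.Gamma (-s) := by
  have h := inv_Gamma_neg_eq s a
  have h1 : Complex.Gamma (-s) ≠ 0 := Complex.Gamma_ne_zero_of_re_pos (by simpa using hs)
  have h2 : Complex.Gamma (a - s) ≠ 0 := Complex.Gamma_ne_zero_of_re_pos (by
    rw [Complex.sub_re, Complex.natCast_re]
    linarith [Nat.cast_nonneg (α := ℝ) a])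
  field_simp at h
  rw [h, mul_comm]

theorem prod_range_eq_neg_mul_prod_Ico {s : ℂ} {a : ℕ} (ha : 0 < a) :
    ∏ j ∈ Finset.range a, ((j : ℂ) - s) = -s * ∏ j ∈ Finset.Ico 1 a, ((j : ℂ) - s) := by
  rw [Finset.range_eq_Ico, Finset.prod_eq_prod_Ico_succ_bot ha]
  simp

/-- The Gamma functional equations turn the shift by a column into products of linear factors. The j
= 0 factor for `F` is -F(β), and 1/Γ(-β₁) supplies the factor -β₁, so the two sides match after
`contiguityCoeff_mul`. -/
theorem IsCurve.fst_mul_gammaFactor (hk : IsCurve k) (F : Facet) (i : Fin (n + 1)) {β : ℂ × ℂ}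
    (hβ : β ∈ convergenceDomain k) :
    β.1 * F.weight k i * gammaFactor k (β - column k i) =
      F.form k β * hk.contiguityCoeff F i β * gammaFactor k β := by
  rcases Nat.eq_zero_or_pos (F.weight k i) with h0 | h0
  · simp [h0, hk.contiguityCoeff_eq_zero h0]
  have hc := hk.contiguityCoeff_mul F i β
  rw [gammaFactor_eq F, gammaFactor_eq F β]
  have e1 : -(F.form k (β - column k i)) = F.weight k i - F.form k β := by
    rw [hk.form_sub_column]
    ring
  have e2 : -(F.opp.form k (β - column k i)) = F.opp.weight k i - F.opp.form k β := by
    rw [hk.form_sub_column]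
    ring
  have e3 : (Complex.Gamma (-β.1))⁻¹ = -β.1 * (Complex.Gamma (-(β - column k i).1))⁻¹ := by
    have := inv_Gamma_neg_eq β.1 1
    have e : -(β - column k i).1 = 1 - β.1 := by simp [column]
    rw [e, this]
    simp
  rw [e1, e2, e3, Gamma_natCast_sub (hβ F), Gamma_natCast_sub (hβ F.opp),
    prod_range_eq_neg_mul_prod_Ico h0]
  linear_combination F.form k β * β.1 * (Complex.Gamma (-(β - column k i).1))⁻¹ *
    Complex.Gamma (-F.form k β) * Complex.Gamma (-F.opp.form k β) * hc

theorem IsCurve.contiguity_of_mem (hk : IsCurve k) {x : Fin (n + 1) → ℂ} {M Ψ : ℂ × ℂ → ℂ}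
    {F : Facet}
    (hM : ∀ β ∈ convergenceDomain k, F.form k β * M β =
      β.1 * ∑ i, (F.weight k i : ℂ) * x i * M (β - column k i))
    (hΨ : ∀ β ∈ convergenceDomain k, M β = Ψ β * gammaFactor k β) {β : ℂ × ℂ}
    (hβ : β ∈ convergenceDomain k) :
    Ψ β = ∑ i, hk.contiguityCoeff F i β * x i * Ψ (β - column k i) := by
  have hs : F.form k β ≠ 0 := by
    intro h
    have := hβ F
    rw [h, Complex.zero_re] at this
    exact lt_irrefl _ this
  apply mul_left_cancel₀ (mul_ne_zero hs (hk.gammaFactor_ne_zero hβ))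
  have h1 := hM β hβ
  rw [hΨ β hβ, Finset.mul_sum] at h1
  rw [Finset.mul_sum]
  calc F.form k β * gammaFactor k β * Ψ β = F.form k β * (Ψ β * gammaFactor k β) := by ring
    _ = _ := h1
    _ = _ := by
      refine Finset.sum_congr rfl fun i _ => ?_
      rw [hΨ _ (hk.sub_column_mem hβ i)]
      linear_combination x i * Ψ (β - column k i) * hk.fst_mul_gammaFactor F i hβ

/-- A function on the tubular domain of convergence that satisfies a relation expressing it by its
translates in the direction of the domain extends to an entire function. -/
theorem exists_entire_of_shift {ι : Type*} [Fintype ι] {c : ι → ℂ × ℂ → ℂ} {γ : ι → ℂ × ℂ}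
    (hc : ∀ j, Differentiable ℂ (c j))
    (hγ : ∀ j, c j = 0 ∨ ∀ F : Facet, 1 ≤ (F.form k (γ j)).re) {ψ : ℂ × ℂ → ℂ}
    (hψ : ∀ β ∈ convergenceDomain k, DifferentiableAt ℂ ψ β)
    (hrec : ∀ β ∈ convergenceDomain k, ψ β = ∑ j, c j β * ψ (β - γ j)) :
    ∃ Ψ : ℂ × ℂ → ℂ, Differentiable ℂ Ψ ∧ ∀ β ∈ convergenceDomain k, Ψ β = ψ β := by
  -- The operator `T` below turns a function on `D m` into one on `D (m + 1)`. By the relation,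
  -- successive iterates agree where both are controlled, so they glue to an entire function.
  let D : ℕ → Set (ℂ × ℂ) := fun m => {β | ∀ F : Facet, (F.form k β).re < m}
  have hD0 : D 0 = convergenceDomain k := by simp [D, convergenceDomain]
  have hDopen : ∀ m, IsOpen (D m) := by
    intro m
    have hre : ∀ F : Facet, IsOpen {β | (F.form k β).re < m} := fun F =>
      isOpen_lt (Complex.continuous_re.comp F.differentiable_form.continuous) continuous_const
    have : D m = {β | (Facet.origin.form k β).re < m} ∩
        {β | (Facet.infinity.form k β).re < m} := by
      ext β
      constructor
      · exact fun h => ⟨h _, h _⟩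
      · rintro ⟨h0, h1⟩ F
        cases F
        exacts [h0, h1]
    rw [this]
    exact (hre _).inter (hre _)
  have hDmono : Monotone D := fun m m' hm β hβ F =>
    (hβ F).trans_le (Nat.cast_le.2 hm)
  have hDex : ∀ β, ∃ m, β ∈ D m := by
    intro β
    obtain ⟨m₀, h₀⟩ := exists_nat_gt (Facet.origin.form k β).re
    obtain ⟨m₁, h₁⟩ := exists_nat_gt (Facet.infinity.form k β).re
    refine ⟨max m₀ m₁, fun F => ?_⟩
    cases F
    · exact h₀.trans_le (Nat.cast_le.2 (le_max_left _ _))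
    · exact h₁.trans_le (Nat.cast_le.2 (le_max_right _ _))
  have hshift : ∀ j m β, c j ≠ 0 → β ∈ D (m + 1) → β - γ j ∈ D m := by
    intro j m β hj hβ F
    have h1 := (hγ j).resolve_left hj F
    have h2 := hβ F
    rw [F.form_sub, Complex.sub_re]
    push_cast at h2
    linarith
  let T : (ℂ × ℂ → ℂ) → ℂ × ℂ → ℂ := fun Φ β => ∑ j, c j β * Φ (β - γ j)
  have hTcongr : ∀ m Φ Φ', Set.EqOn Φ Φ' (D m) → Set.EqOn (T Φ) (T Φ') (D (m + 1)) := by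
    intro m Φ Φ' h β hβ
    refine Finset.sum_congr rfl fun j _ => ?_
    by_cases hj : c j = 0
    · simp [hj]
    · rw [h (hshift j m β hj hβ)]
  have hTdiff : ∀ m Φ, (∀ β ∈ D m, DifferentiableAt ℂ Φ β) →
      ∀ β ∈ D (m + 1), DifferentiableAt ℂ (T Φ) β := by
    intro m Φ h β hβ
    refine DifferentiableAt.fun_sum fun j _ => ?_
    by_cases hj : c j = 0
    · simp [hj]
    · exact (hc j β).mul (DifferentiableAt.comp β (h _ (hshift j m β hj hβ))
        (differentiableAt_id.sub_const _))
  let Φ : ℕ → ℂ × ℂ → ℂ := fun m => T^[m] ψ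
  have hΦs : ∀ m, Φ (m + 1) = T (Φ m) := fun m => Function.iterate_succ_apply' T m ψ
  have hstep : ∀ m, Set.EqOn (Φ (m + 1)) (Φ m) (D m) := by
    intro m
    induction m with
    | zero =>
      intro β hβ
      exact (hrec β (hD0 ▸ hβ)).symm
    | succ m ih =>
      have := hTcongr m _ _ ih
      rwa [← hΦs, ← hΦs] at this
  have hle : ∀ m p, m ≤ p → Set.EqOn (Φ p) (Φ m) (D m) := by
    intro m p hmp
    induction p, hmp using Nat.le_induction with
    | base => exact fun _ _ => rfl
    | succ p hp ih => exact fun β hβ => (hstep p (hDmono hp hβ)).trans (ih hβ)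
  have hdiff : ∀ m, ∀ β ∈ D m, DifferentiableAt ℂ (Φ m) β := by
    intro m
    induction m with
    | zero => exact fun β hβ => hψ β (hD0 ▸ hβ)
    | succ m ih =>
      rw [hΦs]
      exact hTdiff m _ ih
  choose m hm using hDex
  have heq : ∀ p, Set.EqOn (fun β => Φ (m β) β) (Φ p) (D p) := by
    intro p β hβ
    exact (hle _ _ (le_max_left (m β) p) (hm β)).symm.trans (hle _ _ (le_max_right (m β) p) hβ)
  refine ⟨fun β => Φ (m β) β, fun β => ?_, fun β hβ => heq 0 (hD0 ▸ hβ)⟩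
  exact (hdiff (m β) β (hm β)).congr_of_eventuallyEq
    ((heq (m β)).eventuallyEq_of_mem ((hDopen _).mem_nhds (hm β)))

theorem IsCurve.form_column (hk : IsCurve k) (F : Facet) (i : Fin (n + 1)) :
    F.form k (column k i) = F.weight k i := by
  have h := hk.form_sub_column F (column k i) i
  have h0 : F.form k 0 = 0 := by cases F <;> simp [Facet.form]
  rw [sub_self, h0] at h
  exact (sub_eq_zero.1 h.symm)

theorem Facet.form_add (F : Facet) (β γ : ℂ × ℂ) :
    F.form k (β + γ) = F.form k β + F.form k γ := by
  cases F
  · rfl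
  · simp only [Facet.form, Prod.fst_add, Prod.snd_add]
    ring

variable {x : Fin (n + 1) → ℂ} {Θ : Set Real.Angle} {lz lf : ℂ → ℂ}

theorem isExtendedEulerMellin_eq {Ψ : ℂ × ℂ → ℂ} (h : IsExtendedEulerMellin k Θ lz lf Ψ)
    {θ : Real.Angle} (hθ : θ ∈ Θ) {β : ℂ × ℂ} (hβ : β ∈ convergenceDomain k) :
    eulerMellin lz lf θ β = Ψ β * gammaFactor k β := by
  rw [h.eq θ hθ β hβ, gammaFactor]
  ring

theorem IsBranch.exists_isExtendedEulerMellin (hb : IsBranch k x Θ lz lf) (hk : IsCurve k)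
    (hx : x ∈ nonzeroEnds n) (hΘ : IsComponent k x Θ) :
    ∃ Ψ, IsExtendedEulerMellin k Θ lz lf Ψ := by
  obtain ⟨θ₀, hθ₀⟩ := hΘ.nonempty
  have hbound : ∀ θ ∈ Θ, ∃ C, RayBound k lz lf θ C := by
    intro θ hθ
    obtain ⟨C, hC⟩ := hb.exists_rayBound hk hx hΘ (isCompact_singleton (x := θ))
      (Set.singleton_subset_iff.2 hθ)
    exact ⟨C, hC θ rfl⟩
  obtain ⟨C₀, hC₀⟩ := hbound θ₀ hθ₀
  have hopen := hΘ.isOpen hk hx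
  let ψ : ℂ × ℂ → ℂ := fun β => eulerMellin lz lf θ₀ β * (gammaFactor k β)⁻¹
  have hψ : ∀ β ∈ convergenceDomain k, eulerMellin lz lf θ₀ β = ψ β * gammaFactor k β :=
    fun β hβ => (inv_mul_cancel_right₀ (hk.gammaFactor_ne_zero hβ) _).symm
  have hrec : ∀ F : Facet, ∀ β ∈ convergenceDomain k,
      ψ β = ∑ i, hk.contiguityCoeff F i β * x i * ψ (β - column k i) := fun F β hβ =>
    hk.contiguity_of_mem (fun β hβ => hb.form_mul_eulerMellin hk hopen hθ₀ hC₀ F hβ) hψ hβ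
  -- One facet's relation is only sure to lower its own form. In the composite of both, each nonzero
  -- term has positive origin weight in its first shift and positive infinity weight in its second,
  -- so both forms drop by at least 1.
  let c : Fin (n + 1) × Fin (n + 1) → ℂ × ℂ → ℂ := fun q β =>
    hk.contiguityCoeff Facet.origin q.1 β * x q.1 *
      (hk.contiguityCoeff Facet.infinity q.2 (β - column k q.1) * x q.2)
  have hc : ∀ q, Differentiable ℂ (c q) := by
    intro q
    have h1 := (hk.differentiable_contiguityCoeff Facet.infinity q.2).comp
      (differentiable_id.sub_const (column k q.1))
    exact ((hk.differentiable_contiguityCoeff Facet.origin q.1).mul_const _).mul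
      (h1.mul_const (x q.2))
  have hγ : ∀ q, c q = 0 ∨ ∀ F : Facet, 1 ≤ (F.form k (column k q.1 + column k q.2)).re := by
    intro q
    by_cases h0 : Facet.origin.weight k q.1 = 0
    · left
      ext β
      simp [c, hk.contiguityCoeff_eq_zero h0]
    by_cases h1 : Facet.infinity.weight k q.2 = 0
    · left
      ext β
      simp [c, hk.contiguityCoeff_eq_zero h1]
    right
    intro F
    rw [F.form_add, hk.form_column, hk.form_column]
    norm_cast
    cases F <;> omega
  have hψd : ∀ β ∈ convergenceDomain k, DifferentiableAt ℂ ψ β := fun β hβ =>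
    (hb.differentiableAt_eulerMellin hθ₀ hC₀ hβ).mul
      ((hk.differentiableAt_gammaFactor hβ).inv (hk.gammaFactor_ne_zero hβ))
  have hψc : ∀ β ∈ convergenceDomain k,
      ψ β = ∑ q, c q β * ψ (β - (column k q.1 + column k q.2)) := by
    intro β hβ
    rw [hrec Facet.origin β hβ, Fintype.sum_prod_type]
    refine Finset.sum_congr rfl fun i _ => ?_
    rw [hrec Facet.infinity _ (hk.sub_column_mem hβ i), Finset.mul_sum]
    refine Finset.sum_congr rfl fun j _ => ?_
    rw [sub_add_eq_sub_sub]
    ring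
  obtain ⟨Ψ, hΨ, hΨψ⟩ := exists_entire_of_shift hc hγ hψd hψc
  refine ⟨Ψ, hΨ, fun θ hθ β hβ => ?_, fun θ hθ β hβ => ?_⟩
  · obtain ⟨C, hC⟩ := hbound θ hθ
    exact hb.integrableOn_integrand hθ hC hβ
  · rw [hb.eulerMellin_eq hk hx hΘ hβ hθ hθ₀, hψ β hβ, hΨψ β hβ, gammaFactor]
    ring

theorem isExtendedEulerMellin_unique (hk : IsCurve k) (hΘ : IsComponent k x Θ)
    {Ψ Ψ' : ℂ × ℂ → ℂ} (h : IsExtendedEulerMellin k Θ lz lf Ψ)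
    (h' : IsExtendedEulerMellin k Θ lz lf Ψ') : Ψ = Ψ' := by
  obtain ⟨θ, hθ⟩ := hΘ.nonempty
  obtain ⟨β₀, hβ₀⟩ := hk.exists_mem_convergenceDomain
  refine eq_of_eventuallyEq_of_differentiable h.entire h'.entire (p := β₀) ?_
  filter_upwards [isOpen_convergenceDomain.mem_nhds hβ₀] with β hβ
  refine mul_right_cancel₀ (hk.gammaFactor_ne_zero hβ) ?_
  rw [← isExtendedEulerMellin_eq h hθ hβ, isExtendedEulerMellin_eq h' hθ hβ]

end Extension

/-! ### Values on the polar lines -/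

/-- The point of the line `polarLine k F N` with first coordinate `t`. -/
def linePoint {n : ℕ} (k : Fin (n + 1) → ℕ) : Facet → ℕ → ℂ → ℂ × ℂ
  | .origin, N, t => (t, N)
  | .infinity, N, t => (t, degree k * t - N)

theorem mul_prod_Ico_mul_factorial (N w : ℕ) (hw : 1 ≤ w) (hwN : w ≤ N) :
    (N : ℂ) * (∏ j ∈ Finset.Ico 1 w, ((j : ℂ) - N)) * ((N - w).factorial : ℂ) =
      (-1) ^ (w - 1) * (N.factorial : ℂ) := by
  induction w, hw using Nat.le_induction with
  | base =>
    have : (N.factorial : ℂ) = N * ((N - 1).factorial : ℂ) := by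
      exact_mod_cast (Nat.mul_factorial_pred (by omega : N ≠ 0)).symm
    simp [this]
  | succ w hw ih =>
    have hlt : w < N := hwN
    have h1 : ((N - w).factorial : ℂ) = (N - w) * ((N - (w + 1)).factorial : ℂ) := by
      rw [← Nat.cast_sub hlt.le]
      have := (Nat.mul_factorial_pred (by omega : N - w ≠ 0)).symm
      rw [show N - w - 1 = N - (w + 1) by omega] at this
      exact_mod_cast this
    have h2 := ih hlt.le
    rw [h1] at h2
    rw [Finset.prod_Ico_succ_top hw]
    have e : (-1 : ℂ) ^ (w + 1 - 1) = -(-1) ^ (w - 1) := by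
      obtain ⟨m, rfl⟩ : ∃ m, w = m + 1 := ⟨w - 1, by omega⟩
      simp [pow_succ]
    rw [e]
    linear_combination -h2

/-- The factor j = N occurs. This removes the columns of weight greater than N from the relation on
the line F = N. -/
theorem prod_Ico_eq_zero {N w : ℕ} (hN : 1 ≤ N) (h : N < w) :
    ∏ j ∈ Finset.Ico 1 w, ((j : ℂ) - N) = 0 :=
  Finset.prod_eq_zero (Finset.mem_Ico.2 ⟨hN, h⟩) (sub_self _)

section Line

variable {n : ℕ} {k : Fin (n + 1) → ℕ}

theorem form_linePoint (F : Facet) (N : ℕ) (t : ℂ) : F.form k (linePoint k F N t) = N := by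
  cases F <;> simp [Facet.form, linePoint]

theorem linePoint_fst (F : Facet) (N : ℕ) (t : ℂ) : (linePoint k F N t).1 = t := by
  cases F <;> rfl

theorem eq_linePoint {F : Facet} {N : ℕ} {β : ℂ × ℂ} (h : F.form k β = N) :
    β = linePoint k F N β.1 := by
  cases F
  · exact Prod.ext rfl h
  · refine Prod.ext rfl ?_
    simp only [linePoint, Facet.form] at h ⊢
    linear_combination -h

theorem form_opp_linePoint (F : Facet) (N : ℕ) (t : ℂ) :
    F.opp.form k (linePoint k F N t) = degree k * t - N := by
  have h := F.form_add_form_opp (k := k) (linePoint k F N t)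
  rw [form_linePoint, linePoint_fst] at h
  linear_combination h

theorem differentiable_linePoint (F : Facet) (N : ℕ) : Differentiable ℂ (linePoint k F N) := by
  cases F
  · exact differentiable_id.prodMk (differentiable_const _)
  · exact differentiable_id.prodMk ((differentiable_id.const_mul _).sub_const _)

variable {x : Fin (n + 1) → ℂ} {Θ : Set Real.Angle} {lz lf : ℂ → ℂ} {Ψ : ℂ × ℂ → ℂ}

/-- Both sides are entire and agree on the nonempty open convergence domain. -/
theorem IsExtendedEulerMellin.contiguity (h : IsExtendedEulerMellin k Θ lz lf Ψ)
    (hb : IsBranch k x Θ lz lf) (hk : IsCurve k) (hx : x ∈ nonzeroEnds n)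
    (hΘ : IsComponent k x Θ) (F : Facet) (β : ℂ × ℂ) :
    Ψ β = ∑ i, hk.contiguityCoeff F i β * x i * Ψ (β - column k i) := by
  obtain ⟨θ, hθ⟩ := hΘ.nonempty
  obtain ⟨C, hC⟩ := hb.exists_rayBound hk hx hΘ (isCompact_singleton (x := θ))
    (Set.singleton_subset_iff.2 hθ)
  obtain ⟨β₀, hβ₀⟩ := hk.exists_mem_convergenceDomain
  have hd : Differentiable ℂ
      fun β => ∑ i, hk.contiguityCoeff F i β * x i * Ψ (β - column k i) :=
    Differentiable.fun_sum fun i _ => ((hk.differentiable_contiguityCoeff F i).mul_const _).mul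
      (h.entire.comp (differentiable_id.sub_const _))
  refine congrFun (eq_of_eventuallyEq_of_differentiable h.entire hd (p := β₀) ?_) β
  filter_upwards [isOpen_convergenceDomain.mem_nhds hβ₀] with β hβ
  exact hk.contiguity_of_mem (M := eulerMellin lz lf θ)
    (fun β hβ => hb.form_mul_eulerMellin hk (hΘ.isOpen hk hx) hθ (hC θ rfl) F hβ)
    (fun β hβ => isExtendedEulerMellin_eq h hθ hβ) hβ

/-- The extended Euler–Mellin integral times the products over the gaps. -/
noncomputable def gapMul (k : Fin (n + 1) → ℕ) (Ψ : ℂ × ℂ → ℂ) (F : Facet) (β : ℂ × ℂ) : ℂ :=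
  Ψ β * (F.gapProd k (F.form k β) * F.opp.gapProd k (F.opp.form k β))

theorem IsExtendedEulerMellin.gapMul_eq (h : IsExtendedEulerMellin k Θ lz lf Ψ)
    (hb : IsBranch k x Θ lz lf) (hk : IsCurve k) (hx : x ∈ nonzeroEnds n)
    (hΘ : IsComponent k x Θ) (F : Facet) (β : ℂ × ℂ) :
    gapMul k Ψ F β = ∑ i, F.weight k i * x i *
      (∏ j ∈ Finset.Ico 1 (F.weight k i), ((j : ℂ) - F.form k β)) *
      (∏ j ∈ Finset.range (F.opp.weight k i), ((j : ℂ) - F.opp.form k β)) *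
      gapMul k Ψ F (β - column k i) := by
  rw [gapMul, h.contiguity hb hk hx hΘ F β, Finset.sum_mul]
  refine Finset.sum_congr rfl fun i _ => ?_
  rw [gapMul]
  linear_combination x i * Ψ (β - column k i) * hk.contiguityCoeff_mul F i β

/-- For Re t < 0, contiguity expresses the value on F = 0 by points β - a_i of nonzero weight inside
the convergence domain. There Ψ is an actual integral, and the sum of these integrals is the
boundary term. Both sides are entire in t, so the half-plane suffices. -/
theorem IsExtendedEulerMellin.gapMul_of_form_eq_zero (h : IsExtendedEulerMellin k Θ lz lf Ψ)
    (hb : IsBranch k x Θ lz lf) (hk : IsCurve k) (hx : x ∈ nonzeroEnds n)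
    (hΘ : IsComponent k x Θ) {F : Facet} {v : ℂ} (hv : IsVertexLog k Θ lz lf v F) (t : ℂ) :
    (Complex.Gamma (-t))⁻¹ * gapMul k Ψ F (linePoint k F 0 t) =
      (Complex.Gamma (-(degree k * t)))⁻¹ * Complex.exp (t * v) := by
  obtain ⟨θ, hθ⟩ := hΘ.nonempty
  obtain ⟨C, hC⟩ := hb.exists_rayBound hk hx hΘ (isCompact_singleton (x := θ))
    (Set.singleton_subset_iff.2 hθ)
  have hd₁ : Differentiable ℂ fun t => (Complex.Gamma (-t))⁻¹ *
      gapMul k Ψ F (linePoint k F 0 t) := by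
    have hl := differentiable_linePoint (k := k) F 0
    have hf : ∀ F' : Facet, Differentiable ℂ
        fun t => F'.gapProd k (F'.form k (linePoint k F 0 t)) := fun F' =>
      (hk.differentiable_gapProd F').comp (F'.differentiable_form.comp hl)
    exact (Complex.differentiable_one_div_Gamma.comp differentiable_neg).mul
      ((h.entire.comp hl).mul ((hf F).mul (hf F.opp)))
  have hd₂ : Differentiable ℂ fun t => (Complex.Gamma (-(degree k * t)))⁻¹ *
      Complex.exp (t * v) :=
    (Complex.differentiable_one_div_Gamma.comp (differentiable_id.const_mul _).neg).mul
      (differentiable_id.mul_const v).cexp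
  refine congrFun (eq_of_eventuallyEq_of_differentiable hd₁ hd₂ (p := -1) ?_) t
  have hev : ∀ᶠ t : ℂ in 𝓝 (-1), t.re < 0 :=
    (isOpen_lt Complex.continuous_re continuous_const).mem_nhds (by simp)
  filter_upwards [hev] with t ht
  have ht0 : t ≠ 0 := by
    rintro rfl
    simp at ht
  set β := linePoint k F 0 t with hβ
  have hβF : F.form k β = 0 := by simpa using form_linePoint (k := k) F 0 t
  have hβ1 : β.1 = t := linePoint_fst F 0 t
  have hβopp : F.opp.form k β = degree k * t := by simpa using form_opp_linePoint (k := k) F 0 t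
  have hre : (F.opp.form k β).re < 0 := by
    rw [hβopp, re_natCast_mul]
    have hd : (0 : ℝ) < degree k := by exact_mod_cast hk.degree_pos
    exact mul_neg_of_pos_of_neg hd ht
  have hsum := hb.sum_eulerMellin_of_form_eq_zero hk (hΘ.isOpen hk hx) hθ (hC θ rfl) hv hβF hre
  have hterm : ∀ i, (F.weight k i : ℂ) * x i *
      (∏ j ∈ Finset.Ico 1 (F.weight k i), ((j : ℂ) - F.form k β)) *
      (∏ j ∈ Finset.range (F.opp.weight k i), ((j : ℂ) - F.opp.form k β)) *
      gapMul k Ψ F (β - column k i) =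
      Complex.Gamma (1 - t) * (Complex.Gamma (-(degree k * t)))⁻¹ *
        ((F.weight k i : ℂ) * x i * eulerMellin lz lf θ (β - column k i)) := by
    intro i
    rcases Nat.eq_zero_or_pos (F.weight k i) with h0 | h0
    · simp [h0]
    have hmem : β - column k i ∈ convergenceDomain k := by
      intro F'
      rw [hk.form_sub_column, Complex.sub_re, Complex.natCast_re]
      have h1 : (0 : ℝ) < F.weight k i := by exact_mod_cast h0
      have h2 : (0 : ℝ) ≤ F.opp.weight k i := Nat.cast_nonneg _
      have h3 : (F.form k β).re = 0 := by rw [hβF, Complex.zero_re]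
      clear_value β
      cases F <;> cases F' <;> simp only [Facet.opp] at * <;> linarith
    rw [isExtendedEulerMellin_eq h hθ hmem, gammaFactor_eq F, gapMul]
    have e1 : -(β - column k i).1 = 1 - t := by simp [column, hβ1]
    have e2 : -(F.form k (β - column k i)) = F.weight k i := by
      rw [hk.form_sub_column, hβF]
      ring
    have e3 : -(F.opp.form k (β - column k i)) = F.opp.weight k i - F.opp.form k β := by
      rw [hk.form_sub_column]
      ring
    -- On F = 0 this product is (w_i - 1)!, the value Γ(w_i) occurring in the Gamma factor at β -
    -- a_i.
    have e4 : ∏ j ∈ Finset.Ico 1 (F.weight k i), ((j : ℂ) - F.form k β) =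
        Complex.Gamma (F.weight k i) := by
      obtain ⟨m, hm⟩ : ∃ m, F.weight k i = m + 1 := ⟨F.weight k i - 1, by omega⟩
      rw [hm, Nat.cast_succ, Complex.Gamma_nat_eq_factorial, hβF, ← Finset.prod_Ico_id_eq_factorial]
      push_cast
      simp
    have hΓ1 : Complex.Gamma (1 - t) ≠ 0 := Complex.Gamma_ne_zero_of_re_pos (by
      rw [Complex.sub_re, Complex.one_re]
      linarith)
    have hΓ2 : Complex.Gamma (F.opp.weight k i - F.opp.form k β) ≠ 0 := by
      refine Complex.Gamma_ne_zero_of_re_pos ?_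
      rw [Complex.sub_re, Complex.natCast_re]
      linarith [Nat.cast_nonneg (α := ℝ) (F.opp.weight k i)]
    rw [e1, e2, e3, e4, ← hβopp, inv_Gamma_neg_eq (F.opp.form k β) (F.opp.weight k i)]
    field_simp
  rw [h.gapMul_eq hb hk hx hΘ F β]
  simp only [hterm]
  rw [← Finset.mul_sum]
  have hg : (Complex.Gamma (-t))⁻¹ = -t * (Complex.Gamma (1 - t))⁻¹ := by
    simpa using inv_Gamma_neg_eq t 1
  have hΓ1 : Complex.Gamma (1 - t) ≠ 0 := Complex.Gamma_ne_zero_of_re_pos (by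
    rw [Complex.sub_re, Complex.one_re]
    linarith)
  rw [hβ1] at hsum
  rw [hg]
  calc -t * (Complex.Gamma (1 - t))⁻¹ * (Complex.Gamma (1 - t) *
        (Complex.Gamma (-(degree k * t)))⁻¹ *
        ∑ i, (F.weight k i : ℂ) * x i * eulerMellin lz lf θ (β - column k i))
      = ((Complex.Gamma (1 - t))⁻¹ * Complex.Gamma (1 - t)) *
        (-(Complex.Gamma (-(degree k * t)))⁻¹ *
          (t * ∑ i, (F.weight k i : ℂ) * x i * eulerMellin lz lf θ (β - column k i))) := by ring
    _ = _ := by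
      rw [inv_mul_cancel₀ hΓ1, hsum]
      ring

theorem IsVertexLog.exp_eq {v : ℂ} {F : Facet} (hv : IsVertexLog k Θ lz lf v F)
    (hb : IsBranch k x Θ lz lf) (hk : IsCurve k) (hx : x ∈ nonzeroEnds n)
    (hΘ : IsComponent k x Θ) : Complex.exp v = x F.vertex := by
  obtain ⟨θ, hθ⟩ := hΘ.nonempty
  obtain ⟨v', hv', hlim⟩ := hb.exists_vertexLog hk hx hΘ F
  obtain ⟨β, hβ, hβ1⟩ : ∃ β : ℂ × ℂ, F.form k β = 0 ∧ β.1 = 1 :=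
    ⟨linePoint k F 0 1, by simpa using form_linePoint (k := k) F 0 1, linePoint_fst F 0 1⟩
  have h1 := tendsto_powerKernel_vertex hθ hv hβ
  have h2 := tendsto_powerKernel_vertex hθ hlim hβ
  have : F.rayEnd.NeBot := by
    cases F
    · exact nhdsGT_neBot 0
    · exact atTop_neBot
  have h3 := tendsto_nhds_unique h1 h2
  rwa [hβ1, one_mul, one_mul, hv'] at h3

/-- Strong induction on N, starting from the boundary term on F = 0. Contiguity leads to lower lines
at t - 1 just as `mul_powerCoeff` does. The Gamma quotient absorbs the opposite product, and the
product over [1, w_i) produces the ratio of factorials and the sign. -/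
theorem IsExtendedEulerMellin.gapMul_linePoint (h : IsExtendedEulerMellin k Θ lz lf Ψ)
    (hb : IsBranch k x Θ lz lf) (hk : IsCurve k) (hx : x ∈ nonzeroEnds n)
    (hΘ : IsComponent k x Θ) {F : Facet} {v : ℂ} (hv : IsVertexLog k Θ lz lf v F) (N : ℕ) (t : ℂ) :
    (Complex.Gamma (-t))⁻¹ * gapMul k Ψ F (linePoint k F N t) =
      (-1) ^ N * N.factorial * (Complex.Gamma (N - degree k * t))⁻¹ *
        powerCoeff (F.weight k) F.vertex v x N t := by
  have hexp := hv.exp_eq hb hk hx hΘ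
  induction N using Nat.strong_induction_on generalizing t with
  | _ N ih =>
    rcases Nat.eq_zero_or_pos N with rfl | hN
    · have e := powerCoeff_zero (F.weight k) F.vertex v x t
      rw [h.gapMul_of_form_eq_zero hb hk hx hΘ hv]
      simp [e]
    set β := linePoint k F N t with hβ
    have hβF : F.form k β = N := form_linePoint F N t
    have hβopp : F.opp.form k β = degree k * t - N := form_opp_linePoint F N t
    have hβ1 : β.1 = t := linePoint_fst F N t
    have hN0 : (N : ℂ) ≠ 0 := by exact_mod_cast hN.ne'
    have hg : (Complex.Gamma (-t))⁻¹ = -t * (Complex.Gamma (1 - t))⁻¹ := by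
      simpa using inv_Gamma_neg_eq t 1
    apply mul_left_cancel₀ hN0
    have hr := mul_powerCoeff (F.weight k) F.vertex hexp N t
    rw [Int.cast_natCast] at hr
    rw [h.gapMul_eq hb hk hx hΘ F β]
    have hterm : ∀ i, (N : ℂ) * ((Complex.Gamma (-t))⁻¹ * (F.weight k i * x i *
        (∏ j ∈ Finset.Ico 1 (F.weight k i), ((j : ℂ) - F.form k β)) *
        (∏ j ∈ Finset.range (F.opp.weight k i), ((j : ℂ) - F.opp.form k β)) *
        gapMul k Ψ F (β - column k i))) =
        (-1) ^ N * N.factorial * (Complex.Gamma (N - degree k * t))⁻¹ *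
        (t * ((F.weight k i : ℂ) * x i *
          powerCoeff (F.weight k) F.vertex v x (N - F.weight k i) (t - 1))) := by
      intro i
      rcases Nat.eq_zero_or_pos (F.weight k i) with h0 | h0
      · simp [h0]
      rw [hβF]
      rcases lt_or_ge N (F.weight k i) with hlt | hle
      · rw [prod_Ico_eq_zero hN hlt, powerCoeff_of_neg _ _ _ _ (by omega)]
        simp
      have hpt : β - column k i = linePoint k F (N - F.weight k i) (t - 1) := by
        have : (β - column k i).1 = t - 1 := by simp [column, hβ1]
        rw [← this]
        refine eq_linePoint ?_
        rw [hk.form_sub_column, hβF, Nat.cast_sub hle]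
      have hI := ih (N - F.weight k i) (by omega) (t - 1)
      rw [← hpt, neg_sub] at hI
      have hcast : (((N - F.weight k i : ℕ) : ℤ)) = (N : ℤ) - F.weight k i := by omega
      rw [hcast] at hI
      have hG : (Complex.Gamma (N - degree k * t))⁻¹ =
          (∏ j ∈ Finset.range (F.opp.weight k i), ((j : ℂ) - F.opp.form k β)) *
          (Complex.Gamma ((N - F.weight k i : ℕ) - degree k * (t - 1)))⁻¹ := by
        have hw : (F.weight k i : ℂ) + F.opp.weight k i = degree k := by
          exact_mod_cast hk.weight_add_weight_opp F i
        have e1 : (N : ℂ) - degree k * t = -(F.opp.form k β) := by rw [hβopp]; ring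
        have e2 : ((N - F.weight k i : ℕ) : ℂ) - degree k * (t - 1) =
            F.opp.weight k i - F.opp.form k β := by
          rw [hβopp, Nat.cast_sub hle]
          linear_combination -hw
        rw [e1, e2]
        exact inv_Gamma_neg_eq _ _
      have hfac := mul_prod_Ico_mul_factorial N (F.weight k i) h0 hle
      have hsign : (-1 : ℂ) ^ (F.weight k i - 1) * (-1) ^ (N - F.weight k i) = -(-1) ^ N := by
        rw [← pow_add, show F.weight k i - 1 + (N - F.weight k i) = N - 1 by omega]
        obtain ⟨m, rfl⟩ : ∃ m, N = m + 1 := ⟨N - 1, by omega⟩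
        simp [pow_succ]
      rw [hg, hG]
      set P := ∏ j ∈ Finset.Ico 1 (F.weight k i), ((j : ℂ) - N)
      set R := ∏ j ∈ Finset.range (F.opp.weight k i), ((j : ℂ) - F.opp.form k β)
      set G := (Complex.Gamma ((N - F.weight k i : ℕ) - degree k * (t - 1)))⁻¹
      set T := powerCoeff (F.weight k) F.vertex v x ((N : ℤ) - F.weight k i) (t - 1)
      set s := (-1 : ℂ) ^ (N - F.weight k i)
      calc _ = (N : ℂ) * (-t * F.weight k i * x i * P * R) *
            ((Complex.Gamma (1 - t))⁻¹ * gapMul k Ψ F (β - column k i)) := by ring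
        _ = -t * F.weight k i * x i * R * s * G * T *
            ((N : ℂ) * P * (N - F.weight k i).factorial) := by rw [hI]; ring
        _ = -t * F.weight k i * x i * R * G * T * N.factorial *
            ((-1) ^ (F.weight k i - 1) * s) := by rw [hfac]; ring
        _ = _ := by rw [hsign]; ring
    rw [Finset.mul_sum, Finset.mul_sum]
    simp only [hterm]
    rw [← Finset.mul_sum, ← Finset.mul_sum, ← hr]
    ring

theorem continuous_polarSeries (w : Fin (n + 1) → ℕ) (b : Fin (n + 1)) (N : ℕ) (v : ℂ)
    (x : Fin (n + 1) → ℂ) : Continuous (polarSeries w b N v x) := by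
  unfold polarSeries
  fun_prop

theorem IsCurve.dense_generic (hk : IsCurve k) (N : ℕ) :
    Dense {t : ℂ | (∀ j : ℕ, t ≠ j) ∧ ∀ j : ℕ, degree k * t ≠ N + j} := by
  have hd : (degree k : ℂ) ≠ 0 := by exact_mod_cast hk.degree_pos.ne'
  have hc : ((Set.range fun j : ℕ => (j : ℂ)) ∪
      Set.range fun j : ℕ => ((N : ℂ) + j) / degree k).Countable :=
    (Set.countable_range _).union (Set.countable_range _)
  refine (hc.dense_compl ℝ).mono fun t ht => ?_
  simp only [Set.mem_compl_iff, Set.mem_union, Set.mem_range, not_or, not_exists] at ht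
  refine ⟨fun j hj => ht.1 j hj.symm, fun j hj => ht.2 j ?_⟩
  rw [← hj]
  field_simp

/-- For generic t all Gamma and gap factors in `gapMul_linePoint` can be divided out, and Γ(ℓ -
t)/Γ(-t) = (-1)^ℓ ∏_{i<ℓ} (t - i) cancels the factor removed from the power coefficient. Both sides
are continuous in t, so the exceptional countable set is no restriction. -/
theorem IsExtendedEulerMellin.eq_on_polarLine (h : IsExtendedEulerMellin k Θ lz lf Ψ)
    (hb : IsBranch k x Θ lz lf) (hk : IsCurve k) (hx : x ∈ nonzeroEnds n)
    (hΘ : IsComponent k x Θ) {F : Facet} {v : ℂ} (hv : IsVertexLog k Θ lz lf v F) {N : ℕ}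
    (hN : N ∈ F.monoid k) {g : ℂ → ℂ} (hg : Differentiable ℂ g)
    (hg' : ∀ t : ℂ, (∀ j : ℕ, t ≠ j) → (∀ j : ℕ, degree k * t ≠ N + j) →
        g t = (-1) ^ (N + minLength (F.weight k) N) * (N.factorial : ℂ)
            * Complex.Gamma (minLength (F.weight k) N - t)
          / (Complex.Gamma (N - degree k * t) * F.gapProd k N
            * F.opp.gapProd k (degree k * t - N)))
    {β : ℂ × ℂ} (hβ : β ∈ polarLine k F N) :
    Ψ β = g β.1 * polarSeries (F.weight k) F.vertex N v x β.1 := by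
  have key : (fun t => Ψ (linePoint k F N t)) =
      fun t => g t * polarSeries (F.weight k) F.vertex N v x t := by
    refine Continuous.ext_on (hk.dense_generic N)
      (h.entire.comp (differentiable_linePoint F N)).continuous
      (hg.continuous.mul (continuous_polarSeries _ _ _ _ _)) fun t ht => ?_
    obtain ⟨ht, ht'⟩ := ht
    have h1 := h.gapMul_linePoint hb hk hx hΘ hv N t
    rw [gapMul, form_linePoint, form_opp_linePoint] at h1
    have hgap : F.gapProd k N ≠ 0 := hk.gapProd_natCast_ne_zero F hN
    have hgap' : F.opp.gapProd k (degree k * t - N) ≠ 0 := by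
      rw [Ne, hk.gapProd_eq_zero_iff]
      rintro ⟨κ, -, hκ⟩
      exact ht' κ (by linear_combination hκ)
    set ℓ := minLength (F.weight k) N
    have hΓ : Complex.Gamma (-t) ≠ 0 := Complex.Gamma_ne_zero fun m hm => ht m (neg_injective hm)
    have hΓℓ : Complex.Gamma (ℓ - t) ≠ 0 := Complex.Gamma_ne_zero fun m hm =>
      ht (ℓ + m) (by push_cast; linear_combination -hm)
    have hℓ : (Complex.Gamma (-t))⁻¹ * Complex.Gamma (ℓ - t) =
        (-1) ^ ℓ * ∏ i ∈ Finset.range ℓ, (t - i) := by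
      rw [inv_Gamma_neg_eq t ℓ, mul_assoc, inv_mul_cancel₀ hΓℓ, mul_one]
      have : ∏ i ∈ Finset.range ℓ, ((i : ℂ) - t) = ∏ i ∈ Finset.range ℓ, (-1) * (t - i) :=
        Finset.prod_congr rfl fun i _ => by ring
      rw [this, Finset.prod_mul_distrib, Finset.prod_const, Finset.card_range]
    rw [← prod_mul_polarSeries] at h1
    have hs : (-1 : ℂ) ^ ℓ * (-1) ^ ℓ = 1 := by rw [← mul_pow]; simp
    apply mul_left_cancel₀ (mul_ne_zero (inv_ne_zero hΓ) (mul_ne_zero hgap hgap'))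
    rw [hg' t ht ht', pow_add, div_eq_mul_inv, mul_inv, mul_inv]
    set S := polarSeries (F.weight k) F.vertex N v x t
    set a := F.gapProd k N
    set a' := F.opp.gapProd k (degree k * t - N)
    set G := (Complex.Gamma (N - degree k * t))⁻¹
    symm
    calc _ = (a * a⁻¹) * (a' * a'⁻¹) * ((-1) ^ N * (-1) ^ ℓ * N.factorial * G * S) *
          ((Complex.Gamma (-t))⁻¹ * Complex.Gamma (ℓ - t)) := by ring
      _ = (-1) ^ N * N.factorial * G * ((∏ i ∈ Finset.range ℓ, (t - i)) * S) := by
        rw [mul_inv_cancel₀ hgap, mul_inv_cancel₀ hgap', hℓ]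
        linear_combination ((-1) ^ N * N.factorial * G * S * ∏ i ∈ Finset.range ℓ, (t - i)) * hs
      _ = _ := by rw [← h1]; ring
  have := congrFun key β.1
  rwa [← eq_linePoint hβ] at this

end Line

/-! ### Lines in the polar locus -/

section PolarLocus

variable {n : ℕ} {k : Fin (n + 1) → ℕ}

theorem Facet.form_add_smul (F : Facet) (p d : ℂ × ℂ) (t : ℂ) :
    F.form k (p + t • d) = F.form k p + t * F.form k d := by
  cases F
  · simp [Facet.form]
  · simp only [Facet.form, Prod.fst_add, Prod.snd_add, Prod.smul_fst, Prod.smul_snd, smul_eq_mul]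
    ring

theorem IsCurve.eq_zero_of_form_eq_zero (hk : IsCurve k) (F : Facet) {d : ℂ × ℂ}
    (h : F.form k d = 0) (h' : F.opp.form k d = 0) : d = 0 := by
  have hd : (degree k : ℂ) ≠ 0 := by exact_mod_cast hk.degree_pos.ne'
  have h1 : d.1 = 0 := by
    have := F.form_add_form_opp (k := k) d
    rw [h, h', add_zero] at this
    exact (mul_eq_zero.1 this.symm).resolve_left hd
  refine Prod.ext h1 ?_
  cases F
  · exact h
  · exact h'

theorem countable_form_mem_range (F : Facet) (p : ℂ × ℂ) {d : ℂ × ℂ} (hd : F.form k d ≠ 0) :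
    {t : ℂ | ∃ N : ℕ, F.form k (p + t • d) = N}.Countable := by
  refine (Set.countable_range fun N : ℕ => (N - F.form k p) / F.form k d).mono ?_
  rintro t ⟨N, hN⟩
  refine ⟨N, ?_⟩
  dsimp only
  rw [← hN, F.form_add_smul]
  field_simp
  ring

/-- The complex affine lines in the polar locus are the polar lines. -/
theorem IsCurve.exists_eq_polarLine (hk : IsCurve k) {L : AffineSubspace ℂ (ℂ × ℂ)}
    (hL : Module.finrank ℂ L.direction = 1) (hpolar : (L : Set (ℂ × ℂ)) ⊆ polarLocus k) :
    ∃ F : Facet, ∃ N ∈ F.monoid k, (L : Set (ℂ × ℂ)) = polarLine k F N := by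
  obtain ⟨⟨d, hdL⟩, hd0, hspan⟩ := finrank_eq_one_iff'.1 hL
  have hd : d ≠ 0 := fun h => hd0 (Subtype.ext h)
  obtain ⟨p, hp⟩ : (L : Set (ℂ × ℂ)).Nonempty := by
    refine L.eq_bot_or_nonempty.resolve_left fun h => ?_
    rw [h, AffineSubspace.direction_bot] at hdL
    exact hd hdL
  have hmem : ∀ t : ℂ, p + t • d ∈ L := fun t => by
    have := AffineSubspace.vadd_mem_of_mem_direction (L.direction.smul_mem t hdL) hp
    rwa [vadd_eq_add, add_comm] at this
  have hLp : ∀ q ∈ L, ∃ t : ℂ, q = p + t • d := fun q hq => by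
    obtain ⟨t, ht⟩ := hspan ⟨q -ᵥ p, AffineSubspace.vsub_mem_direction hq hp⟩
    refine ⟨t, ?_⟩
    have := congrArg Subtype.val ht
    simp only [vsub_eq_sub, Submodule.coe_smul] at this
    rw [this]
    abel
  have hunc : ∀ s : Set ℂ, s.Countable → ∃ t, t ∉ s := fun s hs =>
    (hs.dense_compl ℝ).nonempty
  -- If both forms were nonconstant along the line, each would take natural values at countably many
  -- points only, and those could not exhaust ℂ.
  obtain ⟨F, hF⟩ : ∃ F : Facet, F.form k d = 0 := by
    by_contra! h
    obtain ⟨t, ht⟩ := hunc _ ((countable_form_mem_range .origin p (h .origin)).union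
      (countable_form_mem_range .infinity p (h .infinity)))
    obtain ⟨F, N, -, hN⟩ := hpolar (hmem t)
    cases F
    · exact ht (Or.inl ⟨N, hN⟩)
    · exact ht (Or.inr ⟨N, hN⟩)
  have hF' : F.opp.form k d ≠ 0 := fun h => hd (hk.eq_zero_of_form_eq_zero F hF h)
  -- At a point where the opposite form is not a natural number, membership in the polar locus must
  -- come from `F`. This fixes N and its membership in the monoid.
  obtain ⟨t, ht⟩ := hunc _ (countable_form_mem_range F.opp p hF')
  obtain ⟨F', N, hNm, hN⟩ := hpolar (hmem t)
  have hFF : F' = F := by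
    by_contra hne
    have : F' = F.opp := by cases F <;> cases F' <;> simp_all [Facet.opp]
    exact ht ⟨N, this ▸ hN⟩
  subst hFF
  have hpN : F'.form k p = N := by
    have : F'.form k (p + t • d) = N := hN
    rwa [F'.form_add_smul, hF, mul_zero, add_zero] at this
  refine ⟨F', N, hNm, Set.Subset.antisymm (fun q hq => ?_) fun q hq => ?_⟩
  · obtain ⟨s, rfl⟩ := hLp q hq
    change F'.form k _ = N
    rw [F'.form_add_smul, hF, mul_zero, add_zero, hpN]
  · have hq' : F'.form k q = N := hq
    suffices q = p + (F'.opp.form k (q - p) / F'.opp.form k d) • d by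
      rw [this]
      exact hmem _
    rw [← sub_eq_zero]
    refine hk.eq_zero_of_form_eq_zero F' ?_ ?_
    · rw [Facet.form_sub, Facet.form_add_smul, hF, hq', hpN]
      ring
    · rw [Facet.form_sub, Facet.form_add_smul, Facet.form_sub]
      field_simp
      ring

end PolarLocus

/-! ### The solutions on a polar line -/

section PolarSolution

variable {n : ℕ} {k : Fin (n + 1) → ℕ}

theorem IsCurve.sum_weight_mul_eq (hk : IsCurve k) (F : Facet) {u u' : Fin (n + 1) → ℕ}
    (h1 : ∑ i, u i = ∑ i, u' i) (h2 : ∑ i, k i * u i = ∑ i, k i * u' i) :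
    ∑ i, F.weight k i * u i = ∑ i, F.weight k i * u' i := by
  cases F with
  | origin => exact h2
  | infinity =>
    have e : ∀ u : Fin (n + 1) → ℕ,
        ∑ i, Facet.infinity.weight k i * u i + ∑ i, k i * u i = degree k * ∑ i, u i := fun u => by
      rw [← Finset.sum_add_distrib, Finset.mul_sum]
      refine Finset.sum_congr rfl fun i _ => ?_
      rw [← add_mul]
      congr 1
      exact hk.weight_add_weight_opp .infinity i
    have h3 := e u
    rw [h1, h2, ← e u'] at h3
    exact Nat.add_right_cancel h3

theorem IsCurve.isSolution_polarSeries (hk : IsCurve k) (F : Facet) (N : ℕ)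
    {U : Set (Fin (n + 1) → ℂ)} {v : (Fin (n + 1) → ℂ) → ℂ} (h : IsLogBranch F.vertex U v)
    {β : ℂ × ℂ} (hβ : β ∈ polarLine k F N) :
    IsSolution k β U (fun x => polarSeries (F.weight k) F.vertex N (v x) x β.1) where
  analytic x hx := h.analyticAt_polarSeries _ N β.1 hx
  toric u u' h1 h2 x hx := h.monomialDeriv_polarSeries_eq (hk.weight_eq_zero_iff F) N β.1 u u' h1
    (hk.sum_weight_mul_eq F h1 h2) hx
  euler_one x hx := (h.sum_mul_partialDeriv_polarSeries (hk.weight_eq_zero_iff F) N β.1 hx).1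
  euler_two x hx := by
    obtain ⟨h1, h2⟩ := h.sum_mul_partialDeriv_polarSeries (hk.weight_eq_zero_iff F) N β.1 hx
    have hβ' : F.form k β = N := hβ
    cases F with
    | origin =>
      rw [← hβ'] at h2
      exact h2
    | infinity =>
      rw [← hβ'] at h2
      simp only [Facet.form] at h2
      -- At infinity the second Euler operator is the degree times the first minus the weighted one,
      -- so its eigenvalue is degree·β₁ - N = β₂.
      have e : ∀ j, (k j : ℂ) = degree k - (Facet.infinity.weight k j : ℕ) := fun j => by
        simp [Facet.weight, Nat.cast_sub (hk.le_degree j)]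
      simp only [e, sub_mul, Finset.sum_sub_distrib]
      rw [h2]
      simp only [mul_assoc]
      rw [← Finset.mul_sum, h1]
      ring

end PolarSolution

end ToricCurve

theorem mainTheorem5 {n : ℕ} (k : Fin (n + 1) → ℕ) (hk : IsCurve k)
    (L : AffineSubspace ℂ (ℂ × ℂ)) (hL : Module.finrank ℂ L.direction = 1)
    (hpolar : (L : Set (ℂ × ℂ)) ⊆ polarLocus k) :
    ∃ (F : Facet) (N : ℕ) (h : ℂ → ℂ),
      N ∈ F.monoid k ∧ (L : Set (ℂ × ℂ)) = polarLine k F N ∧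
      -- the removed factor `h` is entire on `L`, with an explicit generic value
      Differentiable ℂ h ∧
      (∀ t : ℂ, (∀ j : ℕ, t ≠ j) → (∀ j : ℕ, degree k * t ≠ N + j) →
        h t = (-1) ^ (N + minLength (F.weight k) N) * (N.factorial : ℂ)
            * Complex.Gamma (minLength (F.weight k) N - t)
          / (Complex.Gamma (N - degree k * t) * F.gapProd k N
            * F.opp.gapProd k (degree k * t - N))) ∧
      (∀ x ∈ nonzeroEnds n,
        -- for each component and each branch, the extended Euler–Mellin integral exists, is
        -- unique, and equals `h` times the series on `L`
        (∀ Θ lz lf, IsComponent k x Θ → IsBranch k x Θ lz lf →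
          (∃! Ψ, IsExtendedEulerMellin k Θ lz lf Ψ) ∧
          (∃ v, Complex.exp v = x F.vertex ∧ IsVertexLog k Θ lz lf v F) ∧
          ∀ Ψ v, IsExtendedEulerMellin k Θ lz lf Ψ → IsVertexLog k Θ lz lf v F →
            ∀ β ∈ L, Ψ β = h β.1 * polarSeries (F.weight k) F.vertex N v x β.1) ∧
        -- for each logarithm of the vertex coefficient, all components have compatible branches
        (∀ v, Complex.exp v = x F.vertex → ∀ Θ, IsComponent k x Θ →
          ∃ lz lf, IsBranch k x Θ lz lf ∧ IsVertexLog k Θ lz lf v F) ∧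
        -- all extended Euler–Mellin integrals with compatible branches coincide on `L`
        (∀ v Θ lz lf Ψ Θ' lz' lf' Ψ',
          IsComponent k x Θ → IsBranch k x Θ lz lf → IsVertexLog k Θ lz lf v F →
          IsExtendedEulerMellin k Θ lz lf Ψ →
          IsComponent k x Θ' → IsBranch k x Θ' lz' lf' → IsVertexLog k Θ' lz' lf' v F →
          IsExtendedEulerMellin k Θ' lz' lf' Ψ' →
          ∀ β ∈ L, Ψ β = Ψ' β)) ∧
      -- for each local branch of the logarithm of the vertex coefficient, the series is jointly
      -- analytic, solves the hypergeometric system, and is not identically zero in `x`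
      (∀ (U : Set (Fin (n + 1) → ℂ)) (v : (Fin (n + 1) → ℂ) → ℂ),
        IsOpen U → U.Nonempty → U ⊆ nonzeroEnds n → ContinuousOn v U →
        (∀ x ∈ U, Complex.exp (v x) = x F.vertex) →
        AnalyticOnNhd ℂ
          (fun q : (Fin (n + 1) → ℂ) × ℂ =>
            polarSeries (F.weight k) F.vertex N (v q.1) q.1 q.2) (U ×ˢ Set.univ) ∧
        ∀ β ∈ L,
          IsSolution k β U (fun x => polarSeries (F.weight k) F.vertex N (v x) x β.1) ∧
          ∃ x ∈ U, polarSeries (F.weight k) F.vertex N (v x) x β.1 ≠ 0) := by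

  obtain ⟨F, N, hN, hLN⟩ := hk.exists_eq_polarLine hL hpolar
  obtain ⟨h, hdiff, hval⟩ := hk.exists_entire_factor F hN
  have hmem : ∀ β ∈ L, β ∈ polarLine k F N := fun β hβ => hLN ▸ (SetLike.mem_coe.2 hβ)
  refine ⟨F, N, h, hN, hLN, hdiff, hval, fun x hx => ⟨fun Θ lz lf hΘ hb => ⟨?_, ?_, ?_⟩, ?_, ?_⟩,
    fun U v hU hne _ hv hexp => ?_⟩
  · obtain ⟨Ψ, hΨ⟩ := hb.exists_isExtendedEulerMellin hk hx hΘ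
    exact ⟨Ψ, hΨ, fun Ψ' hΨ' => isExtendedEulerMellin_unique hk hΘ hΨ' hΨ⟩
  · obtain ⟨v, hv⟩ := hb.exists_vertexLog hk hx hΘ F
    exact ⟨v, hv⟩
  · exact fun Ψ v hΨ hv β hβ => hΨ.eq_on_polarLine hb hk hx hΘ hv hN hdiff hval (hmem β hβ)
  · exact fun v hv Θ hΘ => exists_isBranch_isVertexLog hk hx hΘ F hv
  · intro v Θ lz lf Ψ Θ' lz' lf' Ψ' hΘ hb hv hΨ hΘ' hb' hv' hΨ' β hβ
    -- Both values equal the same expression, which involves the component and the branches only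
    -- through `v`.
    rw [hΨ.eq_on_polarLine hb hk hx hΘ hv hN hdiff hval (hmem β hβ),
      hΨ'.eq_on_polarLine hb' hk hx hΘ' hv' hN hdiff hval (hmem β hβ)]
  · have hlog : IsLogBranch F.vertex U v := ⟨hU, hv, hexp⟩
    exact ⟨hlog.analyticOnNhd_polarSeries _ N, fun β hβ =>
      ⟨hk.isSolution_polarSeries F N hlog (hmem β hβ),
        hlog.exists_polarSeries_ne_zero hne (hk.weight_eq_zero_iff F) hN β.1⟩⟩
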